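/- Let $p$ be an odd prime. For $n\ge 0$ let $\Sigma_n$ be the symmetric group, $B_n=\{\pm1\}^n\rtimes\Sigma_n$ the hyperoctahedral group of signed permutation matrices (the normaliser in $O(n)$ of the group of diagonal matrices), and $B_n^+\subset B_n$ the alternating subgroup, i.e. the kernel of the sign (determinant) $B_n\to\{\pm1\}$, $(\varepsilon,\sigma)\mapsto \operatorname{sgn}(\sigma)\prod_i\varepsilon_i$. (1) For every $n\ge 0$ the projection $\pi_n\colon B_n^+\to\Sigma_n$, $(\varepsilon,\sigma)\mapsto\sigma$, induces an isomorphism $\pi_n^*\colon H^d(\Sigma_n;\mathbb F_p)\to H^d(B_n^+;\mathbb F_p)$ in every degree $d\ge 0$. (2) For $G_n=\Sigma_n$ or $G_n=B_n^+$ consider on the bigraded vector space $A=\bigoplus_{n,d}H^d(G_n;\mathbb F_p)$ (component $n$, dimension $d$) the following structure: the cup product, component by component (products of classes in different components are $0$); the coproduct $\Delta\colon A\to A\otimes A$ given by restriction along the standard inclusions $G_n\times G_m\to G_{n+m}$ and the Künneth isomorphism; the transfer product $\odot$, for which $x\odot y$ (with $x\in H^d(G_n)$, $y\in H^e(G_m)$)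 is the image of the cross product $x\times y$ under the transfer of $G_n\times G_m\to G_{n+m}$ divided by the integer $c_{n,m}$; the unit and counit that identify $H^0(G_0;\mathbb F_p)$ with $\mathbb F_p$; and the antipode, multiplication by $(-1)^n$ on the component $n$. Here $c_{n,m}=1$ for $G_n=\Sigma_n$, so that one obtains the usual Hopf ring $A_{\{*\}}=\bigoplus_n H^*(\Sigma_n;\mathbb F_p)$. For $G_n=B_n^+$, $c_{n,m}$ is the index of $B_n^+\times B_m^+$ in $(B_n\times B_m)\cap B_{n+m}^+$, which is $2$ if $n,m\ge1$ and $1$ otherwise; equivalently, $x\odot y$ is the transfer from $(B_n\times B_m)\cap B^+_{n+m}$ to $B^+_{n+m}$ of the unique class that restricts to $x\times y$ on $B_n^+\times B_m^+$. Then the sum of the maps $\pi_n^*$, $$A_{\{*\}}=\bigoplus_n H^*(\Sigma_n;\mathbb F_p)\longrightarrow\bigoplus_n H^*(B_n^+;\mathbb F_p),$$ is an isomorphism of Hopf rings: it is bijective, bigraded, and preserves both products, the coproduct, the unit, the counit and the antipode. -/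

import Mathlib

open CategoryTheory
open scoped DirectSum
noncomputable section

/-- `H^d(G; k)`: the `d`-th cohomology of the group `G` with trivial coefficients in `k`. -/
abbrev coh (k : Type) [CommRing k] (G : Type) [Group G] (d : ℕ) : ModuleCat k :=
  groupCohomology (Rep.trivial k G k) d

/-- The complex of inhomogeneous cochains `Fun(G^n, k)` of `G` with trivial coefficients. -/
abbrev cochainCx (k : Type) [CommRing k] (G : Type) [Group G] : CochainComplex (ModuleCat k) ℕ :=
  groupCohomology.inhomogeneousCochains (Rep.trivial k G k)

/-- The map `f^* : H^d(H; k) → H^d(G; k)` induced by a group homomorphism `f : G → H`. -/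
def cohPullback (k : Type) [CommRing k] {G H : Type} [Group G] [Group H] (f : G →* H) (d : ℕ) :
    coh k H d →ₗ[k] coh k G d :=
  (groupCohomology.map (A := Rep.trivial k H k) (B := Rep.trivial k G k) f
    (Rep.ofHom ⟨LinearMap.id, fun _ => rfl⟩) d).hom

section Cup

variable {k : Type} [CommRing k] {G : Type}

/-- The cup product of cochains, `(f ∪ g)(x₁, …, x_p) = f(x₁, …, x_m) g(x_{m+1}, …, x_p)` for
`p = m + n`. -/
def cupCochain {m n p : ℕ} (h : m + n = p) :
    ((Fin m → G) → k) →ₗ[k] ((Fin n → G) → k) →ₗ[k] ((Fin p → G) → k) :=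
  LinearMap.mk₂ k
    (fun f g x => f (fun i => x ⟨i, by omega⟩) * g (fun j => x ⟨m + j, by omega⟩))
    (fun _ _ _ => by ext; simp [add_mul]) (fun _ _ _ => by ext; simp [mul_assoc])
    (fun _ _ _ => by ext; simp [mul_add]) (fun _ _ _ => by ext; simp [mul_left_comm])

theorem cupCochain_apply {m n p : ℕ} (h : m + n = p) (f : (Fin m → G) → k)
    (g : (Fin n → G) → k) (x : Fin p → G) : cupCochain h f g x =
      f (fun i => x ⟨i, by omega⟩) * g (fun j => x ⟨m + j, by omega⟩) := rfl

variable [Group G]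

/-- The differential of inhomogeneous cochains with trivial coefficients. -/
def dCochain (n : ℕ) : ((Fin n → G) → k) →ₗ[k] ((Fin (n + 1) → G) → k) :=
  (inhomogeneousCochains.d (Rep.trivial k G k) n).hom

theorem dCochain_apply (n : ℕ) (f : (Fin n → G) → k) (g : Fin (n + 1) → G) :
    dCochain n f g = f (fun i => g i.succ) +
      ∑ j : Fin (n + 1), (-1 : k) ^ ((j : ℕ) + 1) * f (Fin.contractNth j (· * ·) g) := by
  rfl

/-- The class of a cocycle. -/
def cohClass (n : ℕ) : groupCohomology.cocycles (Rep.trivial k G k) n →ₗ[k] coh k G n :=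
  (groupCohomology.π (Rep.trivial k G k) n).hom

theorem cohClass_surjective (n : ℕ) :
    Function.Surjective (cohClass (k := k) (G := G) n) :=
  (ModuleCat.epi_iff_surjective _).1
    (inferInstanceAs (Epi ((cochainCx k G).homologyπ n)))

/-- The function `G^n → k` underlying a cocycle. -/
def cocycleVal (n : ℕ) : groupCohomology.cocycles (Rep.trivial k G k) n →ₗ[k] ((Fin n → G) → k) :=
  (groupCohomology.iCocycles (Rep.trivial k G k) n).hom

theorem cocycleVal_injective (n : ℕ) : Function.Injective (cocycleVal (k := k) (G := G) n) :=
  (ModuleCat.mono_iff_injective _).1 inferInstance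

theorem dCochain_cocycleVal (n : ℕ) (x : groupCohomology.cocycles (Rep.trivial k G k) n) :
    dCochain n (cocycleVal n x) = 0 := by
  have h := (cochainCx k G).iCycles_d n (n + 1)
  rw [groupCohomology.inhomogeneousCochains.d_def] at h
  exact congrArg (fun F => F.hom x) h


/-- The cocycle given by a function that the differential kills. -/
def mkCocycle (n : ℕ) (f : (Fin n → G) → k) (hf : dCochain n f = 0) :
    groupCohomology.cocycles (Rep.trivial k G k) n :=
  groupCohomology.cocyclesMk (A := Rep.trivial k G k) f hf

theorem cocycleVal_mkCocycle (n : ℕ) (f : (Fin n → G) → k) (hf : dCochain n f = 0) :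
    cocycleVal n (mkCocycle n f hf) = f :=
  groupCohomology.iCocycles_mk (A := Rep.trivial k G k) f hf

theorem cocycleVal_toCycles (n : ℕ) (f : (Fin n → G) → k) :
    cocycleVal (n + 1) (((cochainCx k G).toCycles n (n + 1)).hom f) = dCochain n f := by
  have h2 := (cochainCx k G).toCycles_i n (n + 1)
  rw [groupCohomology.inhomogeneousCochains.d_def] at h2
  exact congrArg (fun F => F.hom f) h2

theorem cohClass_eq_zero (n : ℕ)
    (x : groupCohomology.cocycles (Rep.trivial k G k) (n + 1)) (f : (Fin n → G) → k)
    (h : cocycleVal (n + 1) x = dCochain n f) : cohClass (n + 1) x = 0 := by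
  have hx : x = ((cochainCx k G).toCycles n (n + 1)).hom f := by
    apply cocycleVal_injective
    rw [h, cocycleVal_toCycles]
  rw [hx]
  exact congrArg (fun F => F.hom f) ((cochainCx k G).toCycles_comp_homologyπ n (n + 1))

theorem toCycles_comp_eq_zero {P : Type} [AddCommGroup P] [Module k P] (n : ℕ)
    (F : groupCohomology.cocycles (Rep.trivial k G k) n →ₗ[k] P)
    (hF : ∀ (m : ℕ) (hm : m + 1 = n) (f : (Fin m → G) → k)
      (x : groupCohomology.cocycles (Rep.trivial k G k) n),
      (∀ g, cocycleVal n x g = dCochain m f (fun i => g (Fin.cast hm i))) → F x = 0)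
    (j : ℕ) (hj : (ComplexShape.up ℕ).prev n = j) :
    (cochainCx k G).toCycles j n ≫ (ModuleCat.ofHom F :
      groupCohomology.cocycles (Rep.trivial k G k) n ⟶ ModuleCat.of k P) = 0 := by
  by_cases h : j + 1 = n
  · subst h
    refine ModuleCat.hom_ext (LinearMap.ext fun f => ?_)
    exact hF j rfl f _ (fun g => congrFun (cocycleVal_toCycles j f) g)
  · rw [HomologicalComplex.toCycles_eq_zero _ (by simpa using h)]
    exact Limits.zero_comp

/-- A linear map out of the cocycles that kills the coboundaries descends to cohomology. -/
def descCoh {P : Type} [AddCommGroup P] [Module k P] (n : ℕ)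
    (F : groupCohomology.cocycles (Rep.trivial k G k) n →ₗ[k] P)
    (hF : ∀ (m : ℕ) (hm : m + 1 = n) (f : (Fin m → G) → k)
      (x : groupCohomology.cocycles (Rep.trivial k G k) n),
      (∀ g, cocycleVal n x g = dCochain m f (fun i => g (Fin.cast hm i))) → F x = 0) :
    coh k G n →ₗ[k] P :=
  (((cochainCx k G).homologyIsCokernel _ n rfl).desc
    (Limits.CokernelCofork.ofπ (Z := ModuleCat.of k P) (ModuleCat.ofHom F :
      groupCohomology.cocycles (Rep.trivial k G k) n ⟶ ModuleCat.of k P)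
      (toCycles_comp_eq_zero n F hF _ rfl))).hom

theorem descCoh_cohClass {P : Type} [AddCommGroup P] [Module k P] (n : ℕ)
    (F : groupCohomology.cocycles (Rep.trivial k G k) n →ₗ[k] P)
    (hF) (x) : descCoh n F hF (cohClass n x) = F x := by
  have h := ((cochainCx k G).homologyIsCokernel _ n rfl).fac
    (Limits.CokernelCofork.ofπ (Z := ModuleCat.of k P) (ModuleCat.ofHom F :
      groupCohomology.cocycles (Rep.trivial k G k) n ⟶ ModuleCat.of k P)
      (toCycles_comp_eq_zero n F hF _ rfl)) Limits.WalkingParallelPair.one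
  exact congrArg (fun F => ModuleCat.Hom.hom F x) h

/-- The Leibniz rule `d(f ∪ g) = df ∪ g + (-1)^m f ∪ dg`. -/
theorem dCochain_cup {m n p : ℕ} (h : m + n = p) (f : (Fin m → G) → k) (g : (Fin n → G) → k) :
    dCochain p (cupCochain h f g) =
      cupCochain (m := m + 1) (n := n) (by omega) (dCochain m f) g +
        (-1 : k) ^ m • cupCochain (m := m) (n := n + 1) (by omega) f (dCochain n g) := by
  subst h
  refine funext fun x => ?_
  have e1 : ∀ j : Fin m, (fun i : Fin m => Fin.contractNth (α := G) (n := m + n)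
      ⟨j, by omega⟩ (· * ·) x ⟨i, by omega⟩) =
      Fin.contractNth j.castSucc (· * ·) (fun i : Fin (m + 1) => x ⟨i, by omega⟩) := by
    intro j; ext i
    simp only [Fin.contractNth]
    rfl
  have e2 : ∀ j : Fin m, (fun i : Fin n => Fin.contractNth (α := G) (n := m + n)
      ⟨j, by omega⟩ (· * ·) x ⟨m + i, by omega⟩) = fun i : Fin n => x ⟨m + 1 + i, by omega⟩ := by
    intro j; ext i
    rw [Fin.contractNth_apply_of_gt _ _ _ _ (by simp; omega)]
    congr 1; ext; simp; omega
  have e3 : ∀ j : Fin (n + 1), (fun i : Fin m => Fin.contractNth (α := G) (n := m + n)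
      ⟨m + j, by omega⟩ (· * ·) x ⟨i, by omega⟩) = fun i : Fin m => x ⟨i, by omega⟩ := by
    intro j; ext i
    rw [Fin.contractNth_apply_of_lt _ _ _ _ (by simp; omega)]
    rfl
  have e4 : ∀ j : Fin (n + 1), (fun i : Fin n => Fin.contractNth (α := G) (n := m + n)
      ⟨m + j, by omega⟩ (· * ·) x ⟨m + i, by omega⟩) =
      Fin.contractNth j (· * ·) (fun i : Fin (n + 1) => x ⟨m + i, by omega⟩) := by
    intro j; ext i
    simp only [Fin.contractNth, add_lt_add_iff_left, add_right_inj]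
    rfl
  have e5 : Fin.contractNth (Fin.last m) (· * ·) (fun i : Fin (m + 1) => x ⟨i, by omega⟩) =
      fun i : Fin m => x ⟨i, by omega⟩ := by
    ext i
    rw [Fin.contractNth_apply_of_lt _ _ _ _ (by simp)]
    rfl
  have e6 : (fun i : Fin n => x (Fin.succ ⟨m + i, by omega⟩)) =
      fun i : Fin n => x ⟨m + 1 + i, by omega⟩ := by
    ext i; congr 1; ext; simp; omega
  have e7 : (fun i : Fin n => x ⟨m + (i.succ : Fin (n + 1)), by omega⟩) =
      fun i : Fin n => x ⟨m + 1 + i, by omega⟩ := by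
    ext i; congr 1; ext; simp; omega
  have hs : ∀ F : Fin (m + n + 1) → k, ∑ j, F j =
      ∑ j : Fin m, F ⟨j, by omega⟩ + ∑ j : Fin (n + 1), F ⟨m + j, by omega⟩ := fun F =>
    Fin.sum_univ_add (a := m) (b := n + 1) F
  change _ = cupCochain _ (dCochain m f) g x + (-1 : k) ^ m * cupCochain _ f (dCochain n g) x
  rw [dCochain_apply, hs]
  simp only [cupCochain_apply, dCochain_apply]
  rw [Fin.sum_univ_castSucc (n := m)]
  simp only [e1, e2, e3, e4, e5, e6, e7, Fin.val_castSucc, Fin.val_last]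
  have hA : (fun i : Fin m => x (Fin.succ ⟨i, by omega⟩)) =
      fun i : Fin m => x ⟨(i.succ : Fin (m + 1)), by omega⟩ := rfl
  rw [hA]
  have hB : ∑ j : Fin (n + 1), (-1 : k) ^ (m + (j : ℕ) + 1) *
      (f (fun i : Fin m => x ⟨i, by omega⟩) *
        g (Fin.contractNth j (· * ·) (fun i : Fin (n + 1) => x ⟨m + i, by omega⟩))) =
      (-1 : k) ^ m * (f (fun i : Fin m => x ⟨i, by omega⟩) * ∑ j : Fin (n + 1),
        (-1 : k) ^ ((j : ℕ) + 1) *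
          g (Fin.contractNth j (· * ·) (fun i : Fin (n + 1) => x ⟨m + i, by omega⟩))) := by
    rw [Finset.mul_sum, Finset.mul_sum]
    exact Finset.sum_congr rfl fun j _ => by ring
  rw [hB, mul_add, mul_add, add_mul, add_mul, Finset.sum_mul]
  simp only [mul_assoc]
  ring

theorem dCochain_cup_cocycles (m n : ℕ) (x : groupCohomology.cocycles (Rep.trivial k G k) m)
    (y : groupCohomology.cocycles (Rep.trivial k G k) n) :
    dCochain (m + n) (cupCochain rfl (cocycleVal m x) (cocycleVal n y)) = 0 := by
  rw [dCochain_cup, dCochain_cocycleVal, dCochain_cocycleVal]; simp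

/-- The cup product of cocycles. -/
def cupCocycles (m n : ℕ) :
    groupCohomology.cocycles (Rep.trivial k G k) m →ₗ[k]
      groupCohomology.cocycles (Rep.trivial k G k) n →ₗ[k]
        groupCohomology.cocycles (Rep.trivial k G k) (m + n) :=
  LinearMap.mk₂ k
    (fun x y => mkCocycle (m + n) (cupCochain rfl (cocycleVal m x) (cocycleVal n y)) 
      (dCochain_cup_cocycles m n x y))
    (fun _ _ _ => cocycleVal_injective _ (by simp [cocycleVal_mkCocycle]))
    (fun _ _ _ => cocycleVal_injective _ (by simp [cocycleVal_mkCocycle]))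
    (fun _ _ _ => cocycleVal_injective _ (by simp [cocycleVal_mkCocycle]))
    (fun _ _ _ => cocycleVal_injective _ (by simp [cocycleVal_mkCocycle]))

theorem cocycleVal_cupCocycles (m n : ℕ) (x y) :
    cocycleVal (k := k) (G := G) (m + n) (cupCocycles m n x y) =
      cupCochain rfl (cocycleVal m x) (cocycleVal n y) :=
  cocycleVal_mkCocycle _ _ (dCochain_cup_cocycles m n x y)

theorem cohClass_cup_left (m n : ℕ) (l : ℕ) (hl : l + 1 = m) (f : (Fin l → G) → k)
    (x : groupCohomology.cocycles (Rep.trivial k G k) m)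
    (y : groupCohomology.cocycles (Rep.trivial k G k) n)
    (hx : ∀ g, cocycleVal m x g = dCochain l f (fun i => g (Fin.cast hl i))) :
    cohClass (m + n) (cupCocycles m n x y) = 0 := by
  subst hl
  have hx' : cocycleVal (l + 1) x = dCochain l f := funext hx
  have key : ∀ (q : ℕ) (hq : q = l + n) (hq' : l + 1 + n = q + 1)
      (z : groupCohomology.cocycles (Rep.trivial k G k) (q + 1)),
      cocycleVal (q + 1) z = cupCochain hq' (dCochain l f) (cocycleVal n y) →
      cohClass (q + 1) z = 0 := by
    intro q hq hq' z hz
    refine cohClass_eq_zero q z (cupCochain hq.symm f (cocycleVal n y)) ?_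
    rw [hz, dCochain_cup, dCochain_cocycleVal]
    simp
  have gen : ∀ (r : ℕ) (hr : l + 1 + n = r)
      (z : groupCohomology.cocycles (Rep.trivial k G k) r),
      cocycleVal r z = cupCochain hr (dCochain l f) (cocycleVal n y) → cohClass r z = 0 := by
    intro r hr z hz
    obtain ⟨q, rfl⟩ : ∃ q, r = q + 1 := ⟨l + n, by omega⟩
    exact key q (by omega) hr z hz
  exact gen _ rfl _ (by rw [cocycleVal_cupCocycles, hx'])

theorem cohClass_cup_right (m n : ℕ) (l : ℕ) (hl : l + 1 = n) (f : (Fin l → G) → k)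
    (x : groupCohomology.cocycles (Rep.trivial k G k) m)
    (y : groupCohomology.cocycles (Rep.trivial k G k) n)
    (hy : ∀ g, cocycleVal n y g = dCochain l f (fun i => g (Fin.cast hl i))) :
    cohClass (m + n) (cupCocycles m n x y) = 0 := by
  subst hl
  have hy' : cocycleVal (l + 1) y = dCochain l f := funext hy
  refine cohClass_eq_zero (m + l) _ ((-1 : k) ^ m • cupCochain rfl (cocycleVal m x) f) ?_
  rw [map_smul, dCochain_cup, dCochain_cocycleVal, smul_add, smul_smul, ← mul_pow]
  simp only [mul_neg, mul_one, neg_neg, one_pow, one_smul, map_zero, LinearMap.zero_apply,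
    smul_zero, zero_add]
  rw [← hy']
  exact cocycleVal_cupCocycles m (l + 1) x y

/-- The cup product of a cocycle and a cohomology class. -/
def cupAux (m n : ℕ) :
    coh k G n →ₗ[k] (groupCohomology.cocycles (Rep.trivial k G k) m →ₗ[k] coh k G (m + n)) :=
  descCoh n ((cupCocycles m n).flip.compr₂ (cohClass (m + n)))
    (fun l hl f y hy => LinearMap.ext fun x => cohClass_cup_right m n l hl f x y hy)

theorem cupAux_cohClass (m n : ℕ) (x : groupCohomology.cocycles (Rep.trivial k G k) m)
    (y : groupCohomology.cocycles (Rep.trivial k G k) n) :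
    cupAux m n (cohClass n y) x = cohClass (m + n) (cupCocycles m n x y) := by
  rw [cupAux, descCoh_cohClass]
  rfl

/-- The cup product `H^m(G; k) × H^n(G; k) → H^{m+n}(G; k)`. -/
def cupCoh (m n : ℕ) : coh k G m →ₗ[k] coh k G n →ₗ[k] coh k G (m + n) :=
  descCoh m (cupAux m n).flip (fun l hl f x hx => LinearMap.ext fun y => by
    obtain ⟨y, rfl⟩ := cohClass_surjective n y
    rw [LinearMap.flip_apply, cupAux_cohClass]
    exact cohClass_cup_left m n l hl f x y hx)

/-- The cup product of the classes of two cocycles is the class of their cup product. -/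
theorem cupCoh_cohClass (m n : ℕ) (x : groupCohomology.cocycles (Rep.trivial k G k) m)
    (y : groupCohomology.cocycles (Rep.trivial k G k) n) :
    cupCoh m n (cohClass m x) (cohClass n y) = cohClass (m + n) (cupCocycles m n x y) := by
  rw [cupCoh, descCoh_cohClass, LinearMap.flip_apply, cupAux_cohClass]

end Cup

section Transfer

variable {k : Type} [CommRing k] {G : Type} [Group G] (S : Subgroup G)

/-- The set `S \ G` of right cosets `S x`. -/
abbrev RightCosets : Type := Quotient (QuotientGroup.rightRel S)

/-- The chosen representative of the right coset `S x`. -/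
def cosetRep (x : G) : G := (Quotient.mk (QuotientGroup.rightRel S) x).out

theorem cosetRep_mul (h : S) (x : G) : cosetRep S (h * x) = cosetRep S x := by
  unfold cosetRep
  congr 1
  apply Quotient.sound
  exact QuotientGroup.rightRel_apply.2 (by simp)

/-- The retraction `G → S`, `x ↦ x t⁻¹`, where `t` is the chosen representative of `S x`; it is
left `S`-equivariant. -/
def cosetRetract (x : G) : S := ⟨x * (cosetRep S x)⁻¹, by
  have := Quotient.mk_out (s := QuotientGroup.rightRel S) x
  rwa [QuotientGroup.rightRel_apply] at this⟩

theorem cosetRetract_mul (h : S) (x : G) : cosetRetract S (h * x) = h * cosetRetract S x := by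
  ext
  simp [cosetRetract, cosetRep_mul, mul_assoc]

/-- The `n`-tuple in `S` attached to the starting point `x ∈ G` and to `g ∈ G^n`: with
`y_i = x g₁ ⋯ g_i` and the retraction `r`, its entries are `r(y_{i-1})⁻¹ r(y_i)`, that is
`t_{i-1} g_i t_i⁻¹`, where `t_i` is the chosen representative of `S y_i`. -/
def cosetTuple {n : ℕ} (x : G) (g : Fin n → G) (i : Fin n) : S :=
  (cosetRetract S (x * Fin.partialProd g i.castSucc))⁻¹ *
    cosetRetract S (x * Fin.partialProd g i.succ)

theorem cosetTuple_mul {n : ℕ} (h : S) (x : G) (g : Fin n → G) :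
    cosetTuple S (h * x) g = cosetTuple S x g := by
  ext i
  simp only [cosetTuple, mul_assoc, cosetRetract_mul]
  simp

theorem cosetTuple_succ {n : ℕ} (x : G) (g : Fin (n + 1) → G) :
    (fun i : Fin n => cosetTuple S x g i.succ) = cosetTuple S (x * g 0) (Fin.tail g) := by
  ext i
  simp only [cosetTuple, Fin.castSucc_succ, Fin.partialProd_succ', mul_assoc]

theorem partialProd_cosetTuple {n : ℕ} (x : G) (g : Fin n → G) (i : Fin (n + 1)) :
    Fin.partialProd (cosetTuple S x g) i =
      (cosetRetract S x)⁻¹ * cosetRetract S (x * Fin.partialProd g i) := by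
  induction i using Fin.induction with
  | zero => simp
  | succ i ih => rw [Fin.partialProd_succ, ih, cosetTuple]; group

theorem cosetTuple_contractNth {n : ℕ} (x : G) (g : Fin (n + 1) → G) (j : Fin (n + 1)) :
    Fin.contractNth j (· * ·) (cosetTuple S x g) =
      cosetTuple S x (Fin.contractNth j (· * ·) g) := by
  funext i
  rw [← Fin.partialProd_right_inv (Fin.contractNth j (· * ·) (cosetTuple S x g)) i]
  simp only [Fin.partialProd_contractNth, Function.comp_apply, partialProd_cosetTuple, cosetTuple]
  group

/-- The transfer of cochains: the sum over the right cosets `S x` of `f` evaluated at the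
`n`-tuple that starts at `x`. -/
def transferCochain [Fintype (RightCosets S)] (n : ℕ) :
    ((Fin n → S) → k) →ₗ[k] ((Fin n → G) → k) where
  toFun f g := ∑ q : RightCosets S, f (cosetTuple S q.out g)
  map_add' _ _ := funext fun _ => Finset.sum_add_distrib
  map_smul' _ _ := funext fun _ => Finset.mul_sum _ _ _ |>.symm

theorem transferCochain_apply [Fintype (RightCosets S)] (n : ℕ) (f : (Fin n → S) → k)
    (g : Fin n → G) :
    transferCochain S n f g = ∑ q : RightCosets S, f (cosetTuple S q.out g) := rfl

/-- Right translation by `a` permutes the right cosets. -/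
def cosetTranslate (a : G) : Equiv.Perm (RightCosets S) where
  toFun := Quotient.map (· * a) (fun x y h => by
    have h' := QuotientGroup.rightRel_apply.1 h
    exact QuotientGroup.rightRel_apply.2 (by simpa [mul_assoc] using h'))
  invFun := Quotient.map (· * a⁻¹) (fun x y h => by
    have h' := QuotientGroup.rightRel_apply.1 h
    exact QuotientGroup.rightRel_apply.2 (by simpa [mul_assoc] using h'))
  left_inv q := by induction q using Quotient.inductionOn; simp
  right_inv q := by induction q using Quotient.inductionOn; simp

theorem cosetTuple_out_translate {n : ℕ} (a : G) (q : RightCosets S) (g : Fin n → G) :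
    cosetTuple S (cosetTranslate S a q).out g = cosetTuple S (q.out * a) g := by
  have h : cosetTranslate S a q = Quotient.mk _ (q.out * a) := by
    conv_lhs => rw [← Quotient.out_eq q]
    rfl
  have h2 : (q.out * a) * (cosetTranslate S a q).out⁻¹ ∈ S := by
    rw [h]
    exact QuotientGroup.rightRel_apply.1
      (Quotient.mk_out (s := QuotientGroup.rightRel S) (q.out * a))
  rw [← cosetTuple_mul S ⟨_, h2⟩ (cosetTranslate S a q).out g]
  congr 1
  simp

/-- The transfer of cochains commutes with the differentials. -/
theorem dCochain_transfer [Fintype (RightCosets S)] (n : ℕ) (f : (Fin n → S) → k) :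
    dCochain n (transferCochain S n f) = transferCochain S (n + 1) (dCochain n f) := by
  refine funext fun g => ?_
  rw [dCochain_apply, transferCochain_apply]
  simp only [dCochain_apply, transferCochain_apply, cosetTuple_contractNth, cosetTuple_succ,
    Finset.sum_add_distrib, Finset.mul_sum]
  congr 1
  · rw [← Equiv.sum_comp (cosetTranslate S (g 0))]
    simp only [cosetTuple_out_translate]
    rfl
  · exact Finset.sum_comm

/-- The transfer as a map of cochain complexes. -/
def transferCx [Fintype (RightCosets S)] : cochainCx k S ⟶ cochainCx k G where
  f n := ModuleCat.ofHom (transferCochain S n)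
  comm' i j hij := by
    obtain rfl : i + 1 = j := hij
    rw [groupCohomology.inhomogeneousCochains.d_def, groupCohomology.inhomogeneousCochains.d_def]
    exact ModuleCat.hom_ext (LinearMap.ext fun f => dCochain_transfer S i f)

end Transfer

/-- The transfer (corestriction) `H^d(S; k) → H^d(G; k)` of a subgroup `S` of a finite group. -/
def transferSubgroup (k : Type) [CommRing k] {G : Type} [Group G] [Finite G] (S : Subgroup G)
    (d : ℕ) : coh k S d →ₗ[k] coh k G d :=
  letI := Fintype.ofFinite (RightCosets S)
  (HomologicalComplex.homologyMap (transferCx (k := k) S) d).hom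

/-- The transfer `H^d(H; k) → H^d(G; k)` of an injective homomorphism `f : H → G` of finite groups:
`H^d(H; k)` is identified with `H^d(f(H); k)`. -/
def transferHom (k : Type) [CommRing k] {G H : Type} [Group G] [Finite G] [Group H] (f : H →* G)
    (hf : Function.Injective f) (d : ℕ) : coh k H d →ₗ[k] coh k G d :=
  transferSubgroup k f.range d ∘ₗ cohPullback k (MonoidHom.ofInjective hf).symm.toMonoidHom d

/-- The cross product `x × y = pr₁^* x ∪ pr₂^* y` in the cohomology of `G × H`. -/
def crossCoh (k : Type) [CommRing k] (G H : Type) [Group G] [Group H] (d e : ℕ) :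
    coh k G d →ₗ[k] coh k H e →ₗ[k] coh k (G × H) (d + e) :=
  (cupCoh d e).compl₁₂ (cohPullback k (MonoidHom.fst G H) d) (cohPullback k (MonoidHom.snd G H) e)

/-- A sequence of finite groups `G 0, G 1, G 2, …` with injective homomorphisms
`G n × G m → G (n + m)` and with natural numbers `sheets n m` that normalise transfers. -/
structure GroupSystem where
  /-- The groups. -/
  G : ℕ → Type
  [grp : ∀ n, Group (G n)]
  [fin : ∀ n, Finite (G n)]
  /-- The inclusions. -/
  incl : ∀ n m, G n × G m →* G (n + m)
  incl_injective : ∀ n m, Function.Injective (incl n m)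
  /-- The normalising integers. -/
  sheets : ℕ → ℕ → ℕ

attribute [instance] GroupSystem.grp GroupSystem.fin

/-- A bilinear map on direct sums, given on the summands. -/
def bilinOfComponents (k : Type) [CommRing k] {I J : Type} [DecidableEq I] [DecidableEq J]
    {V : I → Type} {W : J → Type} {P : Type} [∀ i, AddCommGroup (V i)] [∀ i, Module k (V i)]
    [∀ j, AddCommGroup (W j)] [∀ j, Module k (W j)] [AddCommGroup P] [Module k P]
    (F : ∀ i j, V i →ₗ[k] W j →ₗ[k] P) : (⨁ i, V i) →ₗ[k] (⨁ j, W j) →ₗ[k] P :=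
  DirectSum.toModule k I _ fun i =>
    (DirectSum.toModule k J _ fun j => (F i j).flip).flip

namespace GroupSystem

variable (k : Type) [Field k] (X : GroupSystem)

/-- The bigraded vector space `A = ⨁_{n,d} H^d(G n; k)`. An index is a pair `(n, d)` of a component
`n` and a cohomological dimension `d`. -/
abbrev A : Type := ⨁ i : ℕ × ℕ, coh k (X.G i.1) i.2

/-- The inclusion of the summand `A^{n,d} = H^d(G n; k)`. -/
abbrev of (n d : ℕ) : coh k (X.G n) d →ₗ[k] X.A k :=
  DirectSum.lof k (ℕ × ℕ) (fun i => coh k (X.G i.1) i.2) (n, d)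

/-- The identity `G n → G m` for equal indices. -/
def castHom {n m : ℕ} (h : n = m) : X.G n →* X.G m := h ▸ MonoidHom.id (X.G n)

/-- The inclusion `G n × G m → G N` for `n + m = N`. -/
def inclOf {n m N : ℕ} (h : n + m = N) : X.G n × X.G m →* X.G N := (X.castHom h).comp (X.incl n m)

/-- The cup product on `A`, component by component; it vanishes on classes from two different
components. -/
def cup : X.A k →ₗ[k] X.A k →ₗ[k] X.A k :=
  bilinOfComponents k fun i j =>
    if h : i.1 = j.1 then
      ((cupCoh i.2 j.2).compl₂ (cohPullback k (X.castHom h) j.2)).compr₂ (X.of k i.1 (i.2 + j.2))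
    else 0

/-- The transfer product on `A`: for `x ∈ A^{n,d}` and `y ∈ A^{m,e}` it is the image of the cross
product `x × y` under the transfer of `G n × G m → G (n + m)`, divided by `sheets n m`. -/
def transferProd : X.A k →ₗ[k] X.A k →ₗ[k] X.A k :=
  bilinOfComponents k fun i j =>
    (crossCoh k (X.G i.1) (X.G j.1) i.2 j.2).compr₂
      (X.of k (i.1 + j.1) (i.2 + j.2) ∘ₗ
        ((X.sheets i.1 j.1 : k)⁻¹ • transferHom k (X.incl i.1 j.1) (X.incl_injective i.1 j.1)
          (i.2 + j.2)))

/-- The direct sum `⨁_{n,m,d} H^d(G n × G m; k)`. -/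
abbrev AA : Type := ⨁ i : (ℕ × ℕ) × ℕ, coh k (X.G i.1.1 × X.G i.1.2) i.2

/-- The Künneth map `A ⊗ A → ⨁_{n,m} H^*(G n × G m; k)`, `x ⊗ y ↦ x × y`. -/
def kunneth : TensorProduct k (X.A k) (X.A k) →ₗ[k] X.AA k :=
  TensorProduct.lift (bilinOfComponents k fun i j =>
    (crossCoh k (X.G i.1) (X.G j.1) i.2 j.2).compr₂
      (DirectSum.lof k ((ℕ × ℕ) × ℕ) (fun i => coh k (X.G i.1.1 × X.G i.1.2) i.2)
        ((i.1, j.1), i.2 + j.2)))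

/-- The restriction `A → ⨁_{n,m} H^*(G n × G m; k)` along the inclusions `G n × G m → G (n + m)`. -/
def restriction : X.A k →ₗ[k] X.AA k :=
  DirectSum.toModule k (ℕ × ℕ) _ fun i =>
    ∑ q ∈ (Finset.HasAntidiagonal.antidiagonal i.1).attach,
      DirectSum.lof k ((ℕ × ℕ) × ℕ) (fun i => coh k (X.G i.1.1 × X.G i.1.2) i.2) (q.1, i.2) ∘ₗ
        cohPullback k (X.inclOf (Finset.HasAntidiagonal.mem_antidiagonal.1 q.2)) i.2

open Classical in
/-- The coproduct `Δ : A → A ⊗ A`: restriction followed by the inverse of the Künneth map. (The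
Künneth map is bijective, as `k` is a field and the groups are finite, by the Künneth theorem; so
the second case of the definition is void.) -/
def coproduct : X.A k →ₗ[k] TensorProduct k (X.A k) (X.A k) :=
  if h : Function.Bijective (X.kunneth k) then
    (LinearEquiv.ofBijective (X.kunneth k) h).symm.toLinearMap ∘ₗ X.restriction k
  else 0

/-- The isomorphism `H^0(G; k) = k`. -/
def _root_.cohZeroEquiv (k : Type) [CommRing k] (G : Type) [Group G] : coh k G 0 ≃ₗ[k] k :=
  (groupCohomology.H0IsoOfIsTrivial (Rep.trivial k G k)).toLinearEquiv

/-- The unit `η : k → A`, which identifies `k` with `A^{0,0} = H^0(G 0; k)`. -/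
def unit : k →ₗ[k] X.A k := X.of k 0 0 ∘ₗ (cohZeroEquiv k (X.G 0)).symm.toLinearMap

/-- The counit `ε : A → k`, the projection to `A^{0,0} = H^0(G 0; k) = k`. -/
def counit : X.A k →ₗ[k] k :=
  (cohZeroEquiv k (X.G 0)).toLinearMap ∘ₗ
    DirectSum.component k (ℕ × ℕ) (fun i => coh k (X.G i.1) i.2) (0, 0)

/-- The antipode `S : A → A`, multiplication by `(-1)^n` on the component `n`. -/
def antipode : X.A k →ₗ[k] X.A k :=
  DirectSum.lmap fun i => (-1 : k) ^ i.1 • LinearMap.id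

/-- `φ` is an isomorphism of bigraded component Hopf rings: a bigraded linear bijection that
preserves the cup products, the transfer products, the coproducts, the units, the counits and the
antipodes. -/
structure IsHopfRingIso (X Y : GroupSystem) (φ : X.A k →ₗ[k] Y.A k) : Prop where
  bijective : Function.Bijective φ
  bigraded : ∀ (n d : ℕ) (x : coh k (X.G n) d),
    ∃ y : coh k (Y.G n) d, φ (X.of k n d x) = Y.of k n d y
  map_cup : ∀ x y, φ (X.cup k x y) = Y.cup k (φ x) (φ y)
  map_transferProd : ∀ x y, φ (X.transferProd k x y) = Y.transferProd k (φ x) (φ y)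
  map_coproduct : ∀ x, TensorProduct.map φ φ (X.coproduct k x) = Y.coproduct k (φ x)
  map_unit : ∀ c, φ (X.unit k c) = Y.unit k c
  map_counit : ∀ x, Y.counit k (φ x) = X.counit k x
  map_antipode : ∀ x, φ (X.antipode k x) = Y.antipode k (φ x)

end GroupSystem

section SignedPermutations

open Equiv

/-- The standard inclusion `Σ_n × Σ_m → Σ_{n+m}`: the first factor permutes the first `n` letters,
the second one permutes the last `m` letters. -/
def permIncl (n m : ℕ) : Perm (Fin n) × Perm (Fin m) →* Perm (Fin (n + m)) :=
  (finSumFinEquiv (m := n) (n := m)).permCongrHom.toMonoidHom.comp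
    (Perm.sumCongrHom (Fin n) (Fin m))

theorem permIncl_injective (n m : ℕ) : Function.Injective (permIncl n m) :=
  ((finSumFinEquiv (m := n) (n := m)).permCongrHom.injective).comp Perm.sumCongrHom_injective

/-- The symmetric groups `Σ_n`. -/
def symmetricSystem : GroupSystem where
  G n := Perm (Fin n)
  incl := permIncl
  incl_injective := permIncl_injective
  sheets _ _ := 1

/-- The action of `Σ_n` on `{±1}^n` that permutes the factors. -/
def permuteSigns (n : ℕ) : Perm (Fin n) →* MulAut (Fin n → ℤˣ) where
  toFun σ :=
    { toFun := fun ε i => ε (σ⁻¹ i)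
      invFun := fun ε i => ε (σ i)
      left_inv := fun ε => by ext i; simp
      right_inv := fun ε => by ext i; simp
      map_mul' := fun _ _ => rfl }
  map_one' := rfl
  map_mul' σ τ := by ext ε i; simp

/-- The hyperoctahedral group `B_n`, the wreath product `{±1}^n ⋊ Σ_n`. The element `(ε, σ)` is the
signed permutation matrix `diag(ε) P_σ`, with `P_σ e_i = e_{σ i}`; these matrices are the normaliser
in `O(n)` of the group of diagonal matrices. -/
abbrev Hyperoctahedral (n : ℕ) : Type := (Fin n → ℤˣ) ⋊[permuteSigns n] Perm (Fin n)

instance (n : ℕ) : Finite (Hyperoctahedral n) :=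
  Finite.of_equiv _ SemidirectProduct.equivProd.symm

/-- The sign homomorphism `B_n → {±1}`, that is the determinant `(ε, σ) ↦ (∏ ε_i) sgn σ`. -/
def hyperSign (n : ℕ) : Hyperoctahedral n →* ℤˣ where
  toFun x := (∏ i, x.left i) * Perm.sign x.right
  map_one' := by simp
  map_mul' x y := by
    have h : ∏ i, permuteSigns n x.right y.left i = ∏ i, y.left i :=
      Equiv.prod_comp (x.right⁻¹) y.left
    simp only [SemidirectProduct.mul_left, SemidirectProduct.mul_right, Pi.mul_apply,
      Finset.prod_mul_distrib, map_mul, h]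
    exact mul_mul_mul_comm _ _ _ _

/-- The alternating subgroup `B_n^+` of the hyperoctahedral group. -/
abbrev AltHyper (n : ℕ) : Subgroup (Hyperoctahedral n) := (hyperSign n).ker

/-- The projection `B_n^+ → Σ_n`. -/
def altProj (n : ℕ) : AltHyper n →* Perm (Fin n) :=
  SemidirectProduct.rightHom.comp (AltHyper n).subtype

theorem permIncl_symm_castAdd (n m : ℕ) (σ : Perm (Fin n)) (τ : Perm (Fin m)) (i : Fin n) :
    (permIncl n m (σ, τ))⁻¹ (Fin.castAdd m i) = Fin.castAdd m (σ⁻¹ i) := by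
  rw [← map_inv]
  simp [permIncl]

theorem permIncl_symm_natAdd (n m : ℕ) (σ : Perm (Fin n)) (τ : Perm (Fin m)) (i : Fin m) :
    (permIncl n m (σ, τ))⁻¹ (Fin.natAdd n i) = Fin.natAdd n (τ⁻¹ i) := by
  rw [← map_inv]
  simp [permIncl]

/-- The standard inclusion `B_n × B_m → B_{n+m}` (block sum of matrices). -/
def hyperIncl (n m : ℕ) : Hyperoctahedral n × Hyperoctahedral m →* Hyperoctahedral (n + m) where
  toFun x := ⟨Fin.append x.1.left x.2.left, permIncl n m (x.1.right, x.2.right)⟩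
  map_one' := by
    refine SemidirectProduct.ext ?_ (map_one (permIncl n m))
    funext i
    refine Fin.addCases (fun i => ?_) (fun i => ?_) i <;> simp
  map_mul' x y := by
    refine SemidirectProduct.ext ?_
      (map_mul (permIncl n m) (x.1.right, x.2.right) (y.1.right, y.2.right))
    funext i
    change Fin.append (x * y).1.left (x * y).2.left i = Fin.append x.1.left x.2.left i *
      Fin.append y.1.left y.2.left ((permIncl n m (x.1.right, x.2.right))⁻¹ i)
    refine Fin.addCases (fun i => ?_) (fun i => ?_) i
    · rw [permIncl_symm_castAdd, Fin.append_left, Fin.append_left, Fin.append_left]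
      rfl
    · rw [permIncl_symm_natAdd, Fin.append_right, Fin.append_right, Fin.append_right]
      rfl

theorem hyperIncl_injective (n m : ℕ) : Function.Injective (hyperIncl n m) := by
  intro x y h
  have h1 : Fin.append x.1.left x.2.left = Fin.append y.1.left y.2.left :=
    congrArg SemidirectProduct.left h
  have h2 := Prod.ext_iff.1 (permIncl_injective n m (congrArg SemidirectProduct.right h))
  refine Prod.ext (SemidirectProduct.ext ?_ h2.1) (SemidirectProduct.ext ?_ h2.2)
  · funext i
    simpa using congrFun h1 (Fin.castAdd m i)
  · funext i
    simpa using congrFun h1 (Fin.natAdd n i)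

theorem hyperSign_hyperIncl (n m : ℕ) (x : Hyperoctahedral n × Hyperoctahedral m) :
    hyperSign (n + m) (hyperIncl n m x) = hyperSign n x.1 * hyperSign m x.2 := by
  change (∏ i, Fin.append x.1.left x.2.left i) *
      Perm.sign (finSumFinEquiv.permCongr (Perm.sumCongr x.1.right x.2.right)) =
    ((∏ i, x.1.left i) * Perm.sign x.1.right) * ((∏ i, x.2.left i) * Perm.sign x.2.right)
  rw [Perm.sign_permCongr, Perm.sign_sumCongr, Fin.prod_univ_add]
  simp only [Fin.append_left, Fin.append_right]
  exact mul_mul_mul_comm _ _ _ _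

/-- The standard inclusion `B_n^+ × B_m^+ → B_{n+m}^+`. -/
def altIncl (n m : ℕ) : AltHyper n × AltHyper m →* AltHyper (n + m) :=
  ((hyperIncl n m).comp ((AltHyper n).subtype.prodMap (AltHyper m).subtype)).codRestrict
    (AltHyper (n + m)) (fun x => by
      have h1 : hyperSign n x.1 = 1 := x.1.2
      have h2 : hyperSign m x.2 = 1 := x.2.2
      rw [MonoidHom.mem_ker]
      refine (hyperSign_hyperIncl n m _).trans ?_
      simp [h1, h2])

theorem altIncl_injective (n m : ℕ) : Function.Injective (altIncl n m) := by
  intro x y h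
  have h1 := Prod.ext_iff.1 (hyperIncl_injective n m (congrArg Subtype.val h))
  exact Prod.ext (Subtype.ext h1.1) (Subtype.ext h1.2)

/-- The groups `B_n^+`. Here `sheets n m` is the index of `B_n^+ × B_m^+` in the preimage `P` of
`Σ_n × Σ_m` under `B_{n+m}^+ → Σ_{n+m}`, that is in `P = (B_n × B_m) ∩ B_{n+m}^+`; it is `2` if `n`
and `m` are positive, and `1` otherwise. With coefficients in which `2` is invertible, restriction
identifies `H^*(P)` with `H^*(B_n^+ × B_m^+)`, and the transfer of `B_n^+ × B_m^+ → B_{n+m}^+`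
divided by `sheets n m` is the transfer of `P → B_{n+m}^+`. Without this division the transfer
product and the coproduct would not satisfy the bialgebra axiom. -/
def altHyperSystem : GroupSystem where
  G n := AltHyper n
  incl := altIncl
  incl_injective := altIncl_injective
  sheets n m := (altIncl n m).range.relIndex ((permIncl n m).range.comap (altProj (n + m)))

/-- The map `⨁_n H^*(Σ_n; k) → ⨁_n H^*(B_n^+; k)` induced by the projections `B_n^+ → Σ_n`. -/
def projPullback (k : Type) [Field k] : symmetricSystem.A k →ₗ[k] altHyperSystem.A k :=
  DirectSum.lmap fun i => cohPullback k (altProj i.1) i.2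

end SignedPermutations
end

/-!
The projection `π : B_n^+ → Σ_n` is surjective, and its kernel consists of sign vectors, so that
it is a `2`-group. As `p` is odd, inflation along `π` is an isomorphism on mod `p` cohomology. The
remaining content is the compatibility with transfers, and the fact that the coproduct is really
defined, that is the Künneth theorem.

Cohomology is computed with homogeneous cochains `F : G ^ (n + 1) → k` (`HomogCochain.homClass`).
The advantage is that functions on `G ^ (n + 1)` can be averaged, argument by argument
(`HomogCochain.lift`), and that averaging is chain homotopic to the identity by a prism operator
(`HomogCochain.prism_homotopy`). Averaging over the fibres of a surjection whose kernel has
invertible order is inverse to inflation (`HomogCochain.cohPullback_bijective`).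

The transfer of a subgroup `S ≤ G` is a sum of translates over the right cosets of `S`
(`HomogCochain.transferSubgroup_homClass`). Let `f : G → Q` be a surjection that maps `S` onto
`R`. The map of right cosets `S \ G → R \ Q` has fibres with `[f⁻¹(R) : S]` elements, so that the
transfer of `S` is compatible with the transfer of `R` up to this factor
(`HomogCochain.transferHom_cohPullback`). For `B_n^+ × B_m^+ → Σ_n × Σ_m` the factor is the
integer by which the transfer product is divided; it is invertible, since it divides the order of
a kernel (`relIndex_dvd_card_ker`).

The coproduct is a restriction followed by the inverse of the Künneth map, so that its
compatibility with `π` follows from naturality, once the Künneth map is known to be bijective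
(`GroupSystem.kunneth_bijective`). For this, let `ξ_i` be cocycles that represent a basis of the
cohomology of `G`. For each finite-dimensional representation `M` of `H` there is a comparison map
`(y_i) ↦ ∑ ξ_i × y_i` from families of cochains of `H` to cochains of `G × H`, with coefficients
in `M`. It is a quasi-isomorphism if `M` is coinduced, since then both sides compute the
cohomology of `G` with values in a vector space (`HomogCochain.crossSurj_coindRep`,
`HomogCochain.crossInj_coindRep`). The embedding of `M` into the coinduced representation of
functions `H → M` and the four lemma reduce degree `N + 1` to degree `N`
(`HomogCochain.crossInj_and_crossSurj`).
-/

/-! ### Homogeneous cochains on a set -/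

namespace HomogCochain

section Basic

variable {k : Type} [CommRing k] {V : Type} [AddCommGroup V] [Module k V] {X Y Z : Type}

/-- The homogeneous cochain `x ↦ F (a, x)` obtained by fixing the first argument. -/
abbrev fixFirst {n : ℕ} (F : (Fin (n + 1) → X) → V) (a : X) : (Fin n → X) → V :=
  fun x => F (Fin.cons a x)

omit [AddCommGroup V] in
theorem ext_fixFirst {n : ℕ} {F F' : (Fin (n + 1) → X) → V}
    (h : ∀ a, fixFirst F a = fixFirst F' a) : F = F' := by
  funext x
  rw [← Fin.cons_self_tail x]
  exact congrFun (h (x 0)) (Fin.tail x)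

variable (k) in
/-- The differential of homogeneous cochains, the alternating sum over the arguments that are left
out. Here `n` is the number of arguments, so that cohomological degree `d` is `n = d + 1`. -/
def δ (n : ℕ) : ((Fin n → X) → V) →ₗ[k] ((Fin (n + 1) → X) → V) where
  toFun F x := ∑ i : Fin (n + 1), (-1 : k) ^ (i : ℕ) • F (fun j => x (i.succAbove j))
  map_add' F F' := by ext x; simp [Finset.sum_add_distrib]
  map_smul' c F := by ext x; simp [Finset.smul_sum, smul_comm c]

theorem δ_apply (n : ℕ) (F : (Fin n → X) → V) (x : Fin (n + 1) → X) :
    δ k n F x = ∑ i : Fin (n + 1), (-1 : k) ^ (i : ℕ) • F (fun j => x (i.succAbove j)) := rfl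

theorem fixFirst_δ_zero (F : (Fin 0 → X) → V) (a : X) : fixFirst (δ k 0 F) a = F := by
  funext x
  simp only [fixFirst, δ_apply]
  simp [Subsingleton.elim (fun j : Fin 0 => _) x]

/-- Fixing the first argument anticommutes with the differential, up to the term that leaves out
that argument. All identities for homogeneous cochains follow from this one by induction. -/
theorem fixFirst_δ_succ (n : ℕ) (F : (Fin (n + 1) → X) → V) (a : X) :
    fixFirst (δ k (n + 1) F) a = F - δ k n (fixFirst F a) := by
  funext x
  simp only [fixFirst, δ_apply, Pi.sub_apply]
  rw [Fin.sum_univ_succ, sub_eq_add_neg, ← Finset.sum_neg_distrib]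
  congr 1
  · simp
  · refine Finset.sum_congr rfl fun i _ => ?_
    have : (fun j : Fin (n + 1) => (Fin.cons a x : Fin (n + 2) → X) (i.succ.succAbove j)) =
        Fin.cons a (fun j => x (i.succAbove j)) := by
      funext j
      refine Fin.cases ?_ (fun j => ?_) j <;> simp
    rw [this]
    simp [pow_succ]

/-- The squared differential vanishes. -/
theorem δ_δ (n : ℕ) (F : (Fin n → X) → V) : δ k (n + 1) (δ k n F) = 0 := by
  induction n with
  | zero =>
    refine ext_fixFirst fun a => ?_
    rw [fixFirst_δ_succ, fixFirst_δ_zero, sub_self]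
    rfl
  | succ n ih =>
    refine ext_fixFirst fun a => ?_
    rw [fixFirst_δ_succ, fixFirst_δ_succ, map_sub, ih, sub_zero, sub_self]
    rfl

end Basic

section Averaging

variable {k : Type} [CommRing k] {V : Type} [AddCommGroup V] [Module k V] {X Y Z : Type}

/-- An operator `E` from functions on `Y` to functions on `X`, thought of as `u ↦ (x ↦ E_x u)` for
a family of expectations `E_x` on `Y`, acts on cochains by taking the expectation in each argument
separately. For precomposition with a map `X → Y` this is the usual pullback of cochains. -/
def lift (E : (Y → V) →ₗ[k] (X → V)) : (n : ℕ) → ((Fin n → Y) → V) →ₗ[k] ((Fin n → X) → V)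
  | 0 => LinearMap.funLeft k V (fun _ => default)
  | n + 1 =>
    { toFun := fun F x => E (fun y => lift E n (fixFirst F y) (Fin.tail x)) (x 0)
      map_add' := fun F F' => by
        funext x
        have : (fun y => lift E n (fixFirst (F + F') y) (Fin.tail x)) =
            (fun y => lift E n (fixFirst F y) (Fin.tail x)) +
              fun y => lift E n (fixFirst F' y) (Fin.tail x) := by
          funext y
          exact congrFun (map_add (lift E n) (fixFirst F y) (fixFirst F' y)) _
        rw [this, map_add]; rfl
      map_smul' := fun c F => by
        funext x
        have : (fun y => lift E n (fixFirst (c • F) y) (Fin.tail x)) =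
            c • (fun y => lift E n (fixFirst F y) (Fin.tail x)) := by
          funext y
          exact congrFun (map_smul (lift E n) c (fixFirst F y)) _
        rw [this, map_smul]; rfl }

variable (E : (Y → V) →ₗ[k] (X → V))

theorem lift_zero_apply (F : (Fin 0 → Y) → V) (x : Fin 0 → X) : lift E 0 F x = F default := rfl

theorem lift_succ_apply (n : ℕ) (F : (Fin (n + 1) → Y) → V) (x : Fin (n + 1) → X) :
    lift E (n + 1) F x = E (fun y => lift E n (fixFirst F y) (Fin.tail x)) (x 0) := rfl

theorem fixFirst_lift (n : ℕ) (F : (Fin (n + 1) → Y) → V) (a : X) (x : Fin n → X) :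
    fixFirst (lift E (n + 1) F) a x = E (fun y => lift E n (fixFirst F y) x) a := rfl

/-- The expectation in one argument commutes with the differential in the others. -/
theorem δ_expectation (n : ℕ) (F : Y → (Fin n → Z) → V) (a : X) (x : Fin (n + 1) → Z) :
    δ k n (fun z => E (fun y => F y z) a) x = E (fun y => δ k n (F y) x) a := by
  have : (fun y => δ k n (F y) x) =
      ∑ i : Fin (n + 1), (-1 : k) ^ (i : ℕ) • fun y => F y (fun j => x (i.succAbove j)) := by
    funext y
    simp [δ_apply]
  rw [this, map_sum, Finset.sum_apply, δ_apply]
  simp only [map_smul, Pi.smul_apply]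

variable {E} (hE : ∀ v : V, E (fun _ => v) = fun _ => v)
include hE

theorem lift_δ (n : ℕ) (F : (Fin n → Y) → V) :
    lift E (n + 1) (δ k n F) = δ k n (lift E n F) := by
  induction n with
  | zero =>
    refine ext_fixFirst fun a => funext fun x => ?_
    rw [fixFirst_lift, fixFirst_δ_zero]
    simp only [fixFirst_δ_zero, lift_zero_apply, hE]
  | succ n ih =>
    refine ext_fixFirst fun a => funext fun x => ?_
    rw [fixFirst_lift, fixFirst_δ_succ]
    simp only [fixFirst_δ_succ, map_sub, ih]
    have h1 : (fun y => (lift E (n + 1) F - δ k n (lift E n (fixFirst F y))) x) =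
        (fun _ => lift E (n + 1) F x) - fun y => δ k n (lift E n (fixFirst F y)) x := rfl
    rw [h1, map_sub, hE, Pi.sub_apply, Pi.sub_apply, ← δ_expectation]
    rfl

end Averaging

section Homotopy

variable {k : Type} [CommRing k] {V : Type} [AddCommGroup V] [Module k V] {X : Type}

/-- The prism operator: a homotopy from the identity to `lift E`. It is
`F ↦ ∑ i, (-1) ^ i F (x_0, …, x_i, y_i, …, y_{n-1})` with the expectation taken over each `y_j`. -/
def prism (E : (X → V) →ₗ[k] (X → V)) : (n : ℕ) → ((Fin (n + 1) → X) → V) → ((Fin n → X) → V)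
  | 0 => fun _ => 0
  | n + 1 => fun F x => E (fun y => lift E n (fixFirst (fixFirst F (x 0)) y) (Fin.tail x)) (x 0) -
      prism E n (fixFirst F (x 0)) (Fin.tail x)

variable (E : (X → V) →ₗ[k] (X → V))

theorem fixFirst_prism (n : ℕ) (F : (Fin (n + 2) → X) → V) (a : X) :
    fixFirst (prism E (n + 1) F) a = (fun x => E (fun y => lift E n
      (fixFirst (fixFirst F a) y) x) a) - prism E n (fixFirst F a) := rfl

theorem prism_sub (n : ℕ) (F F' : (Fin (n + 1) → X) → V) :
    prism E n (F - F') = prism E n F - prism E n F' := by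
  induction n with
  | zero => simp [prism]
  | succ n ih =>
    refine ext_fixFirst fun a => ?_
    have h1 : fixFirst (prism E (n + 1) F - prism E (n + 1) F') a =
      fixFirst (prism E (n + 1) F) a - fixFirst (prism E (n + 1) F') a := rfl
    have h2 : fixFirst (F - F') a = fixFirst F a - fixFirst F' a := rfl
    have h3 : ∀ y, fixFirst (fixFirst F a - fixFirst F' a) y =
      fixFirst (fixFirst F a) y - fixFirst (fixFirst F' a) y := fun _ => rfl
    rw [h1, fixFirst_prism, fixFirst_prism, fixFirst_prism, h2, ih]
    simp only [h3, map_sub]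
    have h4 : ∀ x, (fun y => (lift E n (fixFirst (fixFirst F a) y) -
        lift E n (fixFirst (fixFirst F' a) y)) x) =
        (fun y => lift E n (fixFirst (fixFirst F a) y) x) -
          fun y => lift E n (fixFirst (fixFirst F' a) y) x := fun _ => rfl
    simp only [h4, map_sub]
    funext x
    simp only [Pi.sub_apply]
    abel

variable {E} (hE : ∀ v : V, E (fun _ => v) = fun _ => v)
include hE

/-- The prism operator is a chain homotopy from the identity to `lift E`. -/
theorem prism_homotopy (n : ℕ) (F : (Fin (n + 1) → X) → V) :
    δ k n (prism E n F) + prism E (n + 1) (δ k (n + 1) F) = lift E (n + 1) F - F := by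
  induction n with
  | zero =>
    refine ext_fixFirst fun a => funext fun x => ?_
    have h0 : δ k 0 (prism E 0 F) = 0 := map_zero _
    rw [h0, zero_add, fixFirst_prism]
    have h1 : ∀ y, fixFirst (fixFirst (δ k 1 F) a) y = fixFirst F y - fixFirst F a := by
      intro y
      rw [fixFirst_δ_succ]
      change _ - fixFirst (δ k 0 (fixFirst F a)) y = _
      rw [fixFirst_δ_zero]
    have h2 : (fun y => lift E 0 (fixFirst F y - fixFirst F a) x) =
      (fun y => lift E 0 (fixFirst F y) x) - fun _ => fixFirst F a x := by
      rw [Subsingleton.elim x default]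
      rfl
    simp only [h1, prism, sub_zero]
    rw [h2, map_sub, hE]
    rfl
  | succ n ih =>
    refine ext_fixFirst fun a => funext fun x => ?_
    change fixFirst (δ k (n + 1) (prism E (n + 1) F)) a x +
      fixFirst (prism E (n + 2) (δ k (n + 2) F)) a x =
        fixFirst (lift E (n + 2) F) a x - fixFirst F a x
    have key := congrFun (ih (fixFirst F a)) x
    simp only [Pi.add_apply, Pi.sub_apply] at key
    rw [fixFirst_δ_succ, fixFirst_prism, fixFirst_prism, fixFirst_lift, fixFirst_δ_succ,
      prism_sub, map_sub]
    simp only [Pi.sub_apply]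
    rw [δ_expectation]
    have h1 : ∀ y, fixFirst (F - δ k (n + 1) (fixFirst F a)) y =
        fixFirst F y - (fixFirst F a - δ k n (fixFirst (fixFirst F a) y)) := by
      intro y
      rw [← fixFirst_δ_succ n (fixFirst F a) y]
      rfl
    simp only [h1, map_sub, lift_δ hE]
    have h2 : (fun y => (lift E (n + 1) (fixFirst F y) - (lift E (n + 1) (fixFirst F a) -
        δ k n (lift E n (fixFirst (fixFirst F a) y)))) x) =
        (fun y => lift E (n + 1) (fixFirst F y) x) - ((fun _ => lift E (n + 1) (fixFirst F a) x) -
        fun y => δ k n (lift E n (fixFirst (fixFirst F a) y)) x) := rfl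
    rw [h2, map_sub, map_sub, hE]
    simp only [Pi.sub_apply]
    rw [← sub_eq_zero] at key ⊢
    rw [← key]
    abel

end Homotopy

end HomogCochain

namespace HomogCochain

/-! ### Equivariant cocycles and coboundaries -/

section Equivariant

variable {k : Type} [CommRing k] {V : Type} [AddCommGroup V] [Module k V] {X Y S : Type}

theorem cons_map {A B : Type} (φ : A → B) {n : ℕ} (a : A) (z : Fin n → A) :
    (Fin.cons (φ a) (fun i => φ (z i)) : Fin (n + 1) → B) =
      fun i => φ ((Fin.cons a z : Fin (n + 1) → A) i) := by
  funext i
  refine Fin.cases ?_ (fun i => ?_) i <;> simp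

/-- Equivariance of the operators `lift E`, for a single element that acts on `X` by `α`, on `Y` by
`β`, and on `V` by `τ`. -/
theorem lift_equivariant {E : (Y → V) →ₗ[k] (X → V)} {α : X → X} {β : Y → Y} {τ : V → V}
    (hE : ∀ u u' : Y → V, (∀ y, u' (β y) = τ (u y)) → ∀ x, E u' (α x) = τ (E u x))
    (n : ℕ) (F F' : (Fin n → Y) → V) (h : ∀ y, F' (fun i => β (y i)) = τ (F y)) (x : Fin n → X) :
    lift E n F' (fun i => α (x i)) = τ (lift E n F x) := by
  induction n with
  | zero =>
    rw [lift_zero_apply, lift_zero_apply, ← h]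
    congr 1
    exact Subsingleton.elim _ _
  | succ n ih =>
    refine hE _ _ (fun y => ih _ _ (fun z => ?_) (Fin.tail x)) _
    rw [← h, fixFirst, cons_map]

theorem prism_equivariant {E : (X → V) →ₗ[k] (X → V)} {α : X → X} {τ : V →ₗ[k] V}
    (hE : ∀ u u' : X → V, (∀ y, u' (α y) = τ (u y)) → ∀ x, E u' (α x) = τ (E u x))
    (n : ℕ) (F F' : (Fin (n + 1) → X) → V) (h : ∀ y, F' (fun i => α (y i)) = τ (F y))
    (x : Fin n → X) : prism E n F' (fun i => α (x i)) = τ (prism E n F x) := by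
  induction n with
  | zero => simp [prism]
  | succ n ih =>
    change E _ (α (x 0)) - prism E n (fixFirst F' (α (x 0))) (fun i => α (Fin.tail x i)) = τ (_ - _)
    rw [map_sub, ih (fixFirst F (x 0)) (fixFirst F' (α (x 0)))
      (fun z => by rw [fixFirst, cons_map, h])]
    congr 1
    refine hE _ _ (fun y => lift_equivariant (τ := τ) hE n _ _ (fun z => ?_) (Fin.tail x)) _
    rw [fixFirst, fixFirst, cons_map, cons_map, h]

variable (θ : S → X → X) (ρ : S → V →ₗ[k] V)

/-- The cochains that are equivariant for the elements of `S`, which act on `X` by `θ` and on the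
coefficients by `ρ`. -/
def eqCochains (n : ℕ) : Submodule k ((Fin n → X) → V) where
  carrier := {F | ∀ s x, F (fun i => θ s (x i)) = ρ s (F x)}
  zero_mem' := by simp
  add_mem' := fun h h' s x => by simp [h s x, h' s x]
  smul_mem' := fun c F h s x => by simp [h s x]

/-- The equivariant cocycles of degree `n`. -/
def cocyc (n : ℕ) : Submodule k ((Fin (n + 1) → X) → V) :=
  eqCochains θ ρ (n + 1) ⊓ LinearMap.ker (δ k (n + 1))

/-- The differentials of equivariant cochains of degree `n - 1`. Cochains in degree `-1` count as
zero: the complex is not augmented. -/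
def cobound (n : ℕ) : Submodule k ((Fin (n + 1) → X) → V) where
  carrier := {F | ∃ D ∈ eqCochains θ ρ n, (n = 0 → D = 0) ∧ δ k n D = F}
  zero_mem' := ⟨0, zero_mem _, fun _ => rfl, map_zero _⟩
  add_mem' := by
    rintro _ _ ⟨D, hD, h0, rfl⟩ ⟨D', hD', h0', rfl⟩
    exact ⟨D + D', add_mem hD hD', fun h => by rw [h0 h, h0' h, add_zero], map_add _ _ _⟩
  smul_mem' := by
    rintro c _ ⟨D, hD, h0, rfl⟩
    exact ⟨c • D, Submodule.smul_mem _ _ hD, fun h => by rw [h0 h, smul_zero], map_smul _ _ _⟩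

variable {θ ρ}

theorem mem_cocyc {n : ℕ} {F : (Fin (n + 1) → X) → V} :
    F ∈ cocyc θ ρ n ↔ F ∈ eqCochains θ ρ (n + 1) ∧ δ k (n + 1) F = 0 := Iff.rfl

theorem mem_cobound {n : ℕ} {F : (Fin (n + 1) → X) → V} :
    F ∈ cobound θ ρ n ↔ ∃ D ∈ eqCochains θ ρ n, (n = 0 → D = 0) ∧ δ k n D = F := Iff.rfl

theorem δ_mem_eqCochains {n : ℕ} {F : (Fin n → X) → V} (hF : F ∈ eqCochains θ ρ n) :
    δ k n F ∈ eqCochains θ ρ (n + 1) := fun s x => by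
  simp only [δ_apply, map_sum, map_smul]
  exact Finset.sum_congr rfl fun i _ => by rw [hF s fun j => x (i.succAbove j)]

variable {θ' : S → Y → Y}

/-- The operator `E` from functions on `Y` to functions on `X` is equivariant. It is required to
respect every relation `u' ∘ θ' s = ρ s ∘ u`; since `θ' s` and `ρ s` need not be invertible, there
may be no `u'` or several of them for a given `u`. -/
def IsEquivariantOp (θ : S → X → X) (θ' : S → Y → Y) (ρ : S → V →ₗ[k] V)
    (E : (Y → V) →ₗ[k] (X → V)) : Prop :=
  ∀ s, ∀ u u' : Y → V, (∀ y, u' (θ' s y) = ρ s (u y)) → ∀ x, E u' (θ s x) = ρ s (E u x)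

theorem lift_mem_eqCochains {E : (Y → V) →ₗ[k] (X → V)} (hE : IsEquivariantOp θ θ' ρ E) {n : ℕ}
    {F : (Fin n → Y) → V} (hF : F ∈ eqCochains θ' ρ n) : lift E n F ∈ eqCochains θ ρ n :=
  fun s x => lift_equivariant (hE s) n F F (hF s) x

theorem lift_mem_cocyc {E : (Y → V) →ₗ[k] (X → V)} (hE : IsEquivariantOp θ θ' ρ E)
    (hE1 : ∀ v : V, E (fun _ => v) = fun _ => v) {n : ℕ}
    {F : (Fin (n + 1) → Y) → V} (hF : F ∈ cocyc θ' ρ n) : lift E (n + 1) F ∈ cocyc θ ρ n :=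
  ⟨lift_mem_eqCochains hE hF.1, by
    change δ k (n + 1) (lift E (n + 1) F) = 0
    rw [← lift_δ hE1, (mem_cocyc.1 hF).2, map_zero]⟩

theorem lift_mem_cobound {E : (Y → V) →ₗ[k] (X → V)} (hE : IsEquivariantOp θ θ' ρ E)
    (hE1 : ∀ v : V, E (fun _ => v) = fun _ => v) {n : ℕ}
    {F : (Fin (n + 1) → Y) → V} (hF : F ∈ cobound θ' ρ n) : lift E (n + 1) F ∈ cobound θ ρ n := by
  obtain ⟨D, hD, h0, rfl⟩ := hF
  exact ⟨lift E n D, lift_mem_eqCochains hE hD, fun h => by rw [h0 h, map_zero],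
    (lift_δ hE1 n D).symm⟩

/-- An equivariant family of expectations acts as the identity on cohomology. -/
theorem lift_sub_mem_cobound {E : (X → V) →ₗ[k] (X → V)} (hE : IsEquivariantOp θ θ ρ E)
    (hE1 : ∀ v : V, E (fun _ => v) = fun _ => v) {n : ℕ}
    {F : (Fin (n + 1) → X) → V} (hF : F ∈ cocyc θ ρ n) :
    lift E (n + 1) F - F ∈ cobound θ ρ n := by
  refine ⟨prism E n F, fun s x => prism_equivariant (hE s) n F F (hF.1 s) x, ?_, ?_⟩
  · rintro rfl
    rfl
  · have h := prism_homotopy hE1 n F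
    have h0 : prism E (n + 1) (0 : (Fin (n + 2) → X) → V) = 0 := by
      simpa using prism_sub E (n + 1) 0 0
    rwa [hF.2, h0, add_zero] at h

theorem lift_funLeft (φ : X → Y) (n : ℕ) (F : (Fin n → Y) → V) :
    lift (LinearMap.funLeft k V φ) n F = fun x => F (fun i => φ (x i)) := by
  induction n with
  | zero =>
    funext x
    rw [lift_zero_apply]
    congr 1
    exact Subsingleton.elim _ _
  | succ n ih =>
    funext x
    rw [lift_succ_apply, LinearMap.funLeft_apply, ih]
    change F (Fin.cons (φ (x 0)) fun i => φ (Fin.tail x i)) = _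
    rw [cons_map, Fin.cons_self_tail]

theorem isEquivariantOp_funLeft {φ : X → Y} (hφ : ∀ s x, φ (θ s x) = θ' s (φ x)) :
    IsEquivariantOp θ θ' ρ (LinearMap.funLeft k V φ) := fun s u u' h x => by
  simp [LinearMap.funLeft_apply, hφ, h]

theorem comp_mem_cocyc {φ : X → Y} (hφ : ∀ s x, φ (θ s x) = θ' s (φ x)) {n : ℕ}
    {F : (Fin (n + 1) → Y) → V} (hF : F ∈ cocyc θ' ρ n) :
    (fun x : Fin (n + 1) → X => F (fun i => φ (x i))) ∈ cocyc θ ρ n := by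
  rw [← lift_funLeft (k := k)]
  exact lift_mem_cocyc (isEquivariantOp_funLeft hφ) (fun _ => rfl) hF

/-- An equivariant self-map acts as the identity on cohomology. -/
theorem comp_sub_mem_cobound {φ : X → X} (hφ : ∀ s x, φ (θ s x) = θ s (φ x)) {n : ℕ}
    {F : (Fin (n + 1) → X) → V} (hF : F ∈ cocyc θ ρ n) :
    (fun x : Fin (n + 1) → X => F (fun i => φ (x i))) - F ∈ cobound θ ρ n := by
  rw [← lift_funLeft (k := k)]
  exact lift_sub_mem_cobound (isEquivariantOp_funLeft hφ) (fun _ => rfl) hF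

/-- Averaging after pulling back along `φ : X → Y` is the identity, if `E` averages over the fibres
of `φ`. -/
theorem lift_comp {φ : X → Y} {E : (X → V) →ₗ[k] (Y → V)}
    (hE : ∀ u : Y → V, E (fun x => u (φ x)) = u) (n : ℕ) (F : (Fin n → Y) → V) :
    lift E n (fun x => F (fun i => φ (x i))) = F := by
  induction n with
  | zero =>
    funext x
    rw [lift_zero_apply]
    congr 1
    exact Subsingleton.elim _ _
  | succ n ih =>
    refine ext_fixFirst fun a => funext fun z => ?_
    rw [fixFirst_lift]
    have : ∀ y, fixFirst (fun x : Fin (n + 1) → X => F (fun i => φ (x i))) y =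
        fun x : Fin n → X => fixFirst F (φ y) (fun i => φ (x i)) := by
      intro y
      funext x
      rw [fixFirst, fixFirst, cons_map]
    simp only [this, ih]
    exact congrFun (hE fun b => fixFirst F b z) a

/-- Pulling back after averaging. -/
theorem comp_lift {φ : X → Y} (E : (X → V) →ₗ[k] (Y → V)) (n : ℕ) (F : (Fin n → X) → V) :
    (fun x : Fin n → X => lift E n F (fun i => φ (x i))) =
      lift (LinearMap.funLeft k V φ ∘ₗ E) n F := by
  induction n with
  | zero => rfl
  | succ n ih =>
    funext x
    rw [lift_succ_apply, lift_succ_apply, LinearMap.comp_apply, LinearMap.funLeft_apply]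
    have h : (fun y => lift E n (fixFirst F y) (Fin.tail fun i => φ (x i))) =
        fun y => lift (LinearMap.funLeft k V φ ∘ₗ E) n (fixFirst F y) (Fin.tail x) :=
      funext fun y => congrFun (ih (fixFirst F y)) (Fin.tail x)
    rw [h]

end Equivariant

end HomogCochain

namespace HomogCochain

/-! ### Group cohomology by homogeneous cochains -/

section GroupCohomology

variable {k : Type} [CommRing k] {G H : Type} [Group G] [Group H]

/-- The action of `H` on `G` by left multiplication through a homomorphism `f : H → G`. -/
abbrev leftAct (f : H →* G) : H → G → G := fun h x => f h * x

/-- The trivial action on the coefficients `V`. -/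
abbrev trivAct (k : Type) [CommRing k] (H V : Type) [AddCommGroup V] [Module k V] :
    H → V →ₗ[k] V := fun _ => LinearMap.id

/-- The inhomogeneous cochain `(g_1, …, g_n) ↦ F (1, g_1, g_1 g_2, …)`. -/
def toInhom (n : ℕ) : ((Fin (n + 1) → G) → k) →ₗ[k] ((Fin n → G) → k) :=
  LinearMap.funLeft k k Fin.partialProd

theorem toInhom_apply (n : ℕ) (F : (Fin (n + 1) → G) → k) (g : Fin n → G) :
    toInhom n F g = F (Fin.partialProd g) := rfl

theorem dCochain_toInhom (n : ℕ) {F : (Fin (n + 1) → G) → k}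
    (hF : F ∈ eqCochains (leftAct (MonoidHom.id G)) (trivAct k G k) (n + 1)) :
    dCochain n (toInhom n F) = toInhom (n + 1) (δ k (n + 1) F) := by
  funext g
  rw [dCochain_apply, toInhom_apply, toInhom_apply, δ_apply,
    Fin.sum_univ_succ (n := n + 1)]
  congr 1
  · have h : (fun j : Fin (n + 1) => Fin.partialProd g ((0 : Fin (n + 2)).succAbove j)) =
        fun j => g 0 * Fin.partialProd (Fin.tail g) j := by
      funext j
      rw [Fin.succAbove_zero, Fin.partialProd_succ']
    rw [h, Fin.val_zero, pow_zero, one_smul]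
    exact (hF (g 0) (Fin.partialProd (Fin.tail g))).symm
  · refine Finset.sum_congr rfl fun j _ => ?_
    rw [toInhom_apply, Fin.partialProd_contractNth]
    rfl

theorem toInhom_injOn (n : ℕ) {F F' : (Fin (n + 1) → G) → k}
    (hF : F ∈ eqCochains (leftAct (MonoidHom.id G)) (trivAct k G k) (n + 1))
    (hF' : F' ∈ eqCochains (leftAct (MonoidHom.id G)) (trivAct k G k) (n + 1))
    (h : toInhom n F = toInhom n F') : F = F' := by
  funext g
  have h1 := congrFun h fun i => (g i.castSucc)⁻¹ * g i.succ
  have h2 := Fin.partialProd_left_inv g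
  rw [← h2]
  have e1 := hF (g 0) (Fin.partialProd fun i : Fin n => (g i.castSucc)⁻¹ * g i.succ)
  have e2 := hF' (g 0) (Fin.partialProd fun i : Fin n => (g i.castSucc)⁻¹ * g i.succ)
  exact e1.trans (Eq.trans h1 e2.symm)

theorem exists_toInhom_eq (n : ℕ) (f : (Fin n → G) → k) :
    ∃ F ∈ eqCochains (leftAct (MonoidHom.id G)) (trivAct k G k) (n + 1), toInhom n F = f := by
  refine ⟨fun g => f fun i => (g i.castSucc)⁻¹ * g i.succ, fun s g => ?_, ?_⟩
  · simp [leftAct, mul_assoc]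
  · funext g
    rw [toInhom_apply]
    congr 1
    funext i
    exact Fin.partialProd_right_inv g i

/-- The inhomogeneous cocycle of a homogeneous cocycle. -/
noncomputable def homCocycle (n : ℕ) :
    cocyc (leftAct (MonoidHom.id G)) (trivAct k G k) n →ₗ[k]
      groupCohomology.cocycles (Rep.trivial k G k) n where
  toFun F := mkCocycle n (toInhom n F)
    (by rw [dCochain_toInhom n F.2.1, (mem_cocyc.1 F.2).2, map_zero])
  map_add' _ _ := cocycleVal_injective n (by simp [cocycleVal_mkCocycle])
  map_smul' _ _ := cocycleVal_injective n (by simp [cocycleVal_mkCocycle])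

theorem cocycleVal_homCocycle (n : ℕ) (F : cocyc (leftAct (MonoidHom.id G)) (trivAct k G k) n) :
    cocycleVal n (homCocycle n F) = toInhom n F :=
  cocycleVal_mkCocycle n (toInhom n F.1)
    (by rw [dCochain_toInhom n F.2.1, (mem_cocyc.1 F.2).2, map_zero])

/-- The cohomology class of a homogeneous cocycle. -/
noncomputable def homClass (n : ℕ) :
    cocyc (leftAct (MonoidHom.id G)) (trivAct k G k) n →ₗ[k] coh k G n :=
  cohClass n ∘ₗ homCocycle n

theorem homClass_eq {n : ℕ} (F : cocyc (leftAct (MonoidHom.id G)) (trivAct k G k) n)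
    (x : groupCohomology.cocycles (Rep.trivial k G k) n) (h : cocycleVal n x = toInhom n F) :
    homClass n F = cohClass n x := by
  refine congrArg (cohClass n) (cocycleVal_injective n ?_)
  rw [h, cocycleVal_homCocycle]

theorem exists_cocyc_toInhom_eq {n : ℕ} (x : groupCohomology.cocycles (Rep.trivial k G k) n) :
    ∃ F : cocyc (leftAct (MonoidHom.id G)) (trivAct k G k) n, cocycleVal n x = toInhom n F := by
  obtain ⟨F, hF, h⟩ := exists_toInhom_eq n (cocycleVal n x)
  refine ⟨⟨F, hF, ?_⟩, h.symm⟩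
  refine toInhom_injOn (n + 1) (δ_mem_eqCochains hF) (zero_mem _) ?_
  rw [← dCochain_toInhom n hF, h, dCochain_cocycleVal, map_zero]

theorem homClass_surjective (n : ℕ) : Function.Surjective (homClass (k := k) (G := G) n) := by
  intro c
  obtain ⟨x, rfl⟩ := cohClass_surjective n c
  obtain ⟨F, hF⟩ := exists_cocyc_toInhom_eq x
  exact ⟨F, homClass_eq F x hF⟩

/-- A cocycle whose class is zero is a coboundary. -/
theorem exists_dCochain_of_cohClass_eq_zero {n : ℕ}
    (x : groupCohomology.cocycles (Rep.trivial k G k) n) (h : cohClass n x = 0) :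
    x = 0 ∨ ∃ (m : ℕ) (hm : m + 1 = n) (f : (Fin m → G) → k),
      ∀ g, cocycleVal n x g = dCochain m f (fun i => g (Fin.cast hm i)) := by
  -- The quotient by the coboundaries is a linear image of the cohomology.
  rcases n with _ | m
  · left
    have := descCoh_cohClass (k := k) (G := G) 0 LinearMap.id
      (fun m hm => absurd hm (by omega)) x
    rw [h, map_zero] at this
    exact this.symm
  · right
    let q := (LinearMap.range (dCochain (k := k) (G := G) m)).mkQ ∘ₗ cocycleVal (m + 1)
    have := descCoh_cohClass (k := k) (G := G) (m + 1) q (fun l hl f y hy => by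
      obtain rfl : l = m := by omega
      exact (Submodule.Quotient.mk_eq_zero _).2 ⟨f, (funext hy).symm⟩) x
    rw [h, map_zero] at this
    obtain ⟨f, hf⟩ := (Submodule.Quotient.mk_eq_zero _).1 this.symm
    exact ⟨m, rfl, f, fun g => congrFun hf.symm g⟩

theorem homClass_eq_zero_iff {n : ℕ} (F : cocyc (leftAct (MonoidHom.id G)) (trivAct k G k) n) :
    homClass n F = 0 ↔
      (F : (Fin (n + 1) → G) → k) ∈ cobound (leftAct (MonoidHom.id G)) (trivAct k G k) n := by
  constructor
  · intro h
    rcases exists_dCochain_of_cohClass_eq_zero _ h with h | ⟨m, rfl, f, hf⟩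
    · have h1 : toInhom n (F : (Fin (n + 1) → G) → k) = 0 := by
        rw [← cocycleVal_homCocycle, h, map_zero]
      have h2 := toInhom_injOn n F.2.1 (zero_mem _) (h1.trans (map_zero _).symm)
      rw [h2]
      exact zero_mem _
    · obtain ⟨D, hD, rfl⟩ := exists_toInhom_eq m f
      refine ⟨D, hD, fun h => absurd h (by omega), ?_⟩
      refine toInhom_injOn (m + 1) (δ_mem_eqCochains hD) F.2.1 ?_
      rw [← dCochain_toInhom m hD]
      refine Eq.trans (funext fun g => (hf g).symm) (cocycleVal_homCocycle _ _)
  · rintro ⟨D, hD, h0, h⟩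
    rcases n with _ | m
    · obtain rfl : F = 0 := Subtype.ext (by rw [← h, h0 rfl, map_zero]; rfl)
      exact map_zero _
    · refine cohClass_eq_zero m _ (toInhom m D) ?_
      rw [dCochain_toInhom m hD, h, cocycleVal_homCocycle]

theorem homClass_congr {n : ℕ} {F F' : cocyc (leftAct (MonoidHom.id G)) (trivAct k G k) n}
    (h : (F : (Fin (n + 1) → G) → k) - F' ∈
      cobound (leftAct (MonoidHom.id G)) (trivAct k G k) n) : homClass n F = homClass n F' := by
  rw [← sub_eq_zero, ← map_sub, homClass_eq_zero_iff]
  exact h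

theorem homologyMap_cohClass (ψ : cochainCx k G ⟶ cochainCx k H) (n : ℕ)
    (x : groupCohomology.cocycles (Rep.trivial k G k) n)
    (y : groupCohomology.cocycles (Rep.trivial k H k) n)
    (h : cocycleVal n y = (ψ.f n).hom (cocycleVal n x)) :
    (HomologicalComplex.homologyMap ψ n).hom (cohClass n x) = cohClass n y := by
  have h1 := HomologicalComplex.homologyπ_naturality ψ n
  have h2 : (HomologicalComplex.cyclesMap ψ n).hom x = y := by
    apply cocycleVal_injective
    rw [h]
    exact congrArg (fun F => ModuleCat.Hom.hom F x) (HomologicalComplex.cyclesMap_i ψ n)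
  rw [← h2]
  exact congrArg (fun F => ModuleCat.Hom.hom F x) h1

theorem cohPullback_cohClass (f : G →* H) (n : ℕ)
    (x : groupCohomology.cocycles (Rep.trivial k H k) n)
    (y : groupCohomology.cocycles (Rep.trivial k G k) n)
    (h : cocycleVal n y = fun g => cocycleVal n x (fun i => f (g i))) :
    cohPullback k f n (cohClass n x) = cohClass n y :=
  homologyMap_cohClass _ n x y h

theorem transferSubgroup_cohClass [Finite G] (S : Subgroup G) (n : ℕ)
    (x : groupCohomology.cocycles (Rep.trivial k S k) n)
    (y : groupCohomology.cocycles (Rep.trivial k G k) n)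
    (h : letI := Fintype.ofFinite (RightCosets S)
      cocycleVal n y = transferCochain S n (cocycleVal n x)) :
    transferSubgroup k S n (cohClass n x) = cohClass n y :=
  letI := Fintype.ofFinite (RightCosets S)
  homologyMap_cohClass (transferCx S) n x y h

theorem cohPullback_homClass (f : G →* H) {n : ℕ}
    (F : cocyc (leftAct (MonoidHom.id H)) (trivAct k H k) n) :
    cohPullback k f n (homClass n F) =
      homClass n ⟨fun x => F.1 (fun i => f (x i)), comp_mem_cocyc (φ := f)
        (θ := leftAct (MonoidHom.id G)) (θ' := leftAct f) (fun s x => by simp)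
          ⟨fun s => F.2.1 (f s), F.2.2⟩⟩ := by
  refine cohPullback_cohClass f n _ _ ?_
  funext g
  rw [cocycleVal_homCocycle, cocycleVal_homCocycle, toInhom_apply, toInhom_apply]
  change F.1 _ = F.1 _
  refine congrArg F.1 (funext fun i => ?_)
  induction i using Fin.induction with
  | zero => simp
  | succ i ih => rw [Fin.partialProd_succ, Fin.partialProd_succ, map_mul, ih]

end GroupCohomology

end HomogCochain

namespace HomogCochain

/-! ### Inflation along a surjection whose kernel has invertible order -/

variable {k : Type} [CommRing k] {G H Q T : Type} [Group G] [Group H] [Group Q] [Group T]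

theorem eqCochains_leftAct_of_surjective {f : G →* Q} (hf : Function.Surjective f) (n : ℕ) :
    eqCochains (leftAct f) (trivAct k G k) n =
      eqCochains (leftAct (MonoidHom.id Q)) (trivAct k Q k) n := by
  ext F
  refine ⟨fun h q x => ?_, fun h g => h (f g)⟩
  obtain ⟨g, rfl⟩ := hf q
  exact h g x

section Inflation

variable [Finite G] {f : G →* Q} (hf : Function.Surjective f)

/-- The average of a function over the fibres of a surjective homomorphism. -/
noncomputable def fibreAverage : (G → k) →ₗ[k] (Q → k) where
  toFun u q := Ring.inverse (Nat.card f.ker : k) *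
    letI := Fintype.ofFinite f.ker; ∑ m : f.ker, u (Function.surjInv hf q * m)
  map_add' u v := by ext q; simp [Finset.sum_add_distrib, mul_add]
  map_smul' c u := by ext q; simp [← Finset.mul_sum, mul_left_comm]

theorem fibreAverage_apply [Fintype f.ker] (u : G → k) (q : Q) : fibreAverage hf u q =
    Ring.inverse (Nat.card f.ker : k) * ∑ m : f.ker, u (Function.surjInv hf q * m) := by
  refine congrArg (Ring.inverse (Nat.card f.ker : k) * ·) ?_
  congr!

theorem fibreAverage_comp (hk : IsUnit (Nat.card f.ker : k)) (u : Q → k) :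
    fibreAverage hf (fun g => u (f g)) = u := by
  let _ := Fintype.ofFinite f.ker
  funext q
  rw [fibreAverage_apply]
  have : ∀ m : f.ker, f m = 1 := fun m => m.2
  simp only [map_mul, this, mul_one, Function.surjInv_eq, Finset.sum_const, Finset.card_univ,
    nsmul_eq_mul, ← Nat.card_eq_fintype_card]
  rw [← mul_assoc, Ring.inverse_mul_cancel _ hk, one_mul]

theorem isEquivariantOp_fibreAverage :
    IsEquivariantOp (leftAct f) (leftAct (MonoidHom.id G)) (trivAct k G k)
      (fibreAverage (k := k) hf) := by
  let _ := Fintype.ofFinite f.ker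
  intro g u u' h q
  rw [fibreAverage_apply, fibreAverage_apply, LinearMap.id_apply]
  congr 1
  have hm : (Function.surjInv hf q)⁻¹ * g⁻¹ * Function.surjInv hf (f g * q) ∈ f.ker := by
    simp [MonoidHom.mem_ker, Function.surjInv_eq]
  rw [← Equiv.sum_comp (Equiv.mulLeft (⟨_, hm⟩ : f.ker))
    fun m : f.ker => u (Function.surjInv hf q * m)]
  refine Finset.sum_congr rfl fun m _ => ?_
  have h1 := h (g⁻¹ * Function.surjInv hf (f g * q) * m)
  simp only [leftAct, MonoidHom.id_apply, LinearMap.id_apply] at h1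
  rw [mul_assoc, mul_inv_cancel_left] at h1
  rw [leftAct, h1]
  simp [mul_assoc]

include hf in
/-- Inflation along a surjective homomorphism of finite groups is an isomorphism in cohomology, if
the order of the kernel is invertible in the coefficients. -/
theorem cohPullback_bijective (hk : IsUnit (Nat.card f.ker : k)) (d : ℕ) :
    Function.Bijective (cohPullback k f d) := by
  have hE := isEquivariantOp_fibreAverage (k := k) hf
  have hE0 := fibreAverage_comp (k := k) hf hk
  have hE1 : ∀ v : k, fibreAverage (k := k) hf (fun _ => v) = fun _ => v :=
    fun v => hE0 fun _ => v
  constructor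
  · rw [injective_iff_map_eq_zero]
    intro z hz
    obtain ⟨F, rfl⟩ := homClass_surjective d z
    rw [cohPullback_homClass, homClass_eq_zero_iff] at hz
    rw [homClass_eq_zero_iff]
    have := lift_mem_cobound hE hE1 hz
    rw [lift_comp hE0] at this
    rwa [mem_cobound, eqCochains_leftAct_of_surjective hf] at this
  · intro z
    obtain ⟨F, rfl⟩ := homClass_surjective d z
    have h1 := lift_mem_cocyc hE hE1 F.2
    have h2 : lift (fibreAverage (k := k) hf) (d + 1) F.1 ∈
        cocyc (leftAct (MonoidHom.id Q)) (trivAct k Q k) d := by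
      rwa [mem_cocyc, eqCochains_leftAct_of_surjective hf] at h1
    refine ⟨homClass d ⟨_, h2⟩, ?_⟩
    rw [cohPullback_homClass]
    apply homClass_congr
    change (fun x : Fin (d + 1) → G => lift (fibreAverage hf) (d + 1) F.1 fun i => f (x i)) -
      F.1 ∈ _
    rw [comp_lift]
    refine lift_sub_mem_cobound (fun s u u' h x => ?_) (fun v => ?_) F.2
    · have := hE s u u' h (f x)
      simpa using this
    · rw [LinearMap.comp_apply, hE1]
      rfl

end Inflation

/-! ### The transfer by homogeneous cochains -/

section Transfer

/-- Every class of `H` is the restriction of an `H`-invariant cocycle on a group `G` that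
contains `H`. -/
theorem exists_homClass_restrict {j : H →* G} (hj : Function.Injective j) {n : ℕ} (z : coh k H n) :
    ∃ F : cocyc (leftAct j) (trivAct k H k) n,
      ∃ h, z = homClass n ⟨fun x => F.1 fun i => j (x i), h⟩ := by
  obtain ⟨F, rfl⟩ := homClass_surjective n z
  let e := MonoidHom.ofInjective hj
  let r : G → H := fun x => e.symm (cosetRetract j.range x)
  have hr : ∀ h x, r (j h * x) = h * r x := by
    intro h x
    have h1 : j h * x = ((e h : j.range) : G) * x := rfl
    change e.symm (cosetRetract j.range (j h * x)) = h * e.symm (cosetRetract j.range x)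
    rw [h1, cosetRetract_mul, map_mul]
    simp
  refine ⟨⟨_, comp_mem_cocyc (φ := r) (θ := leftAct j) (θ' := leftAct (MonoidHom.id H)) hr F.2⟩,
    comp_mem_cocyc (φ := fun x => r (j x)) (fun h x => ?_) F.2, ?_⟩
  · change r (j (h * x)) = h * r (j x)
    rw [map_mul, hr]
  · symm
    apply homClass_congr
    refine comp_sub_mem_cobound (φ := fun x => r (j x)) (fun h x => ?_) F.2
    change r (j (h * x)) = h * r (j x)
    rw [map_mul, hr]

variable (S : Subgroup G) [iS : Fintype (RightCosets S)]

/-- The sum of the translates of a cochain over the right cosets of `S`. -/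
noncomputable def cosetSum (n : ℕ) : ((Fin n → G) → k) →ₗ[k] ((Fin n → G) → k) :=
  ∑ q : RightCosets S, LinearMap.funLeft k k fun x i => q.out * x i

theorem cosetSum_apply (n : ℕ) (F : (Fin n → G) → k) (x : Fin n → G) :
    cosetSum S n F x = ∑ q : RightCosets S, F fun i => q.out * x i := by
  simp [cosetSum]

theorem δ_cosetSum (n : ℕ) (F : (Fin n → G) → k) :
    δ k n (cosetSum S n F) = cosetSum S (n + 1) (δ k n F) := by
  funext x
  rw [cosetSum_apply, δ_apply]
  simp only [cosetSum_apply, Finset.smul_sum]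
  rw [Finset.sum_comm]
  rfl

variable {S}

omit iS in
/-- The translates of an `S`-invariant cochain depend on the right coset only. -/
theorem translate_eq_of_mk_eq {n : ℕ} {F : (Fin n → G) → k}
    (hF : F ∈ eqCochains (leftAct S.subtype) (trivAct k S k) n) {a b : G}
    (h : (Quotient.mk (QuotientGroup.rightRel S) a) = Quotient.mk _ b) (x : Fin n → G) :
    F (fun i => a * x i) = F fun i => b * x i := by
  have h1 : b * a⁻¹ ∈ S := QuotientGroup.rightRel_apply.1 (Quotient.exact h)
  have h2 := hF ⟨_, h1⟩ fun i => a * x i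
  simpa [leftAct] using h2.symm

omit iS in
theorem mk_out_translate (q : RightCosets S) (a : G) :
    Quotient.mk (QuotientGroup.rightRel S) (cosetTranslate S a q).out =
      Quotient.mk _ (q.out * a) := by
  rw [Quotient.out_eq]
  conv_lhs => rw [← Quotient.out_eq q]
  rfl

theorem cosetSum_mem_eqCochains {n : ℕ} {F : (Fin n → G) → k}
    (hF : F ∈ eqCochains (leftAct S.subtype) (trivAct k S k) n) :
    cosetSum S n F ∈ eqCochains (leftAct (MonoidHom.id G)) (trivAct k G k) n := by
  intro g x
  rw [cosetSum_apply, LinearMap.id_apply, cosetSum_apply,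
    ← Equiv.sum_comp (cosetTranslate S g) fun q => F fun i => q.out * x i]
  refine Finset.sum_congr rfl fun q _ => ?_
  rw [translate_eq_of_mk_eq hF (mk_out_translate q g)]
  simp [leftAct, mul_assoc]

theorem cosetSum_mem_cocyc {n : ℕ} {F : (Fin (n + 1) → G) → k}
    (hF : F ∈ cocyc (leftAct S.subtype) (trivAct k S k) n) :
    cosetSum S (n + 1) F ∈ cocyc (leftAct (MonoidHom.id G)) (trivAct k G k) n :=
  ⟨cosetSum_mem_eqCochains hF.1, by
    change δ k (n + 1) (cosetSum S (n + 1) F) = 0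
    rw [δ_cosetSum, (mem_cocyc.1 hF).2, map_zero]⟩

theorem cosetSum_mem_cobound {n : ℕ} {F : (Fin (n + 1) → G) → k}
    (hF : F ∈ cobound (leftAct S.subtype) (trivAct k S k) n) :
    cosetSum S (n + 1) F ∈ cobound (leftAct (MonoidHom.id G)) (trivAct k G k) n := by
  obtain ⟨D, hD, h0, rfl⟩ := hF
  exact ⟨_, cosetSum_mem_eqCochains hD, fun h => by rw [h0 h, map_zero], δ_cosetSum S n D⟩

/-- The transfer of the restriction of an `S`-invariant cocycle `F` on `G` is the class of the sum
of the translates of `F`. In contrast to the definition of the transfer, this involves no choice of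
a retraction `G → S`. -/
theorem transferSubgroup_homClass [Finite G] {n : ℕ} {F : (Fin (n + 1) → G) → k}
    (hF : F ∈ cocyc (leftAct S.subtype) (trivAct k S k) n) (h) :
    transferSubgroup k S n (homClass n ⟨fun x => F fun i => (x i : G), h⟩) =
      homClass n ⟨cosetSum S (n + 1) F, cosetSum_mem_cocyc hF⟩ := by
  obtain rfl : iS = Fintype.ofFinite _ := Subsingleton.elim _ _
  let _ := Fintype.ofFinite (RightCosets S)
  let r : G → G := fun x => cosetRetract S x
  have hr : ∀ (s : S) (x : G), r (leftAct S.subtype s x) = leftAct S.subtype s (r x) := by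
    intro s x
    change ((cosetRetract S (s * x) : S) : G) = _
    rw [cosetRetract_mul]
    rfl
  have hF' := comp_mem_cocyc (φ := r) hr hF
  have h1 : homClass n ⟨cosetSum S (n + 1) F, cosetSum_mem_cocyc hF⟩ =
      homClass n ⟨cosetSum S (n + 1) _, cosetSum_mem_cocyc hF'⟩ := by
    symm
    apply homClass_congr
    simp only
    rw [← map_sub]
    exact cosetSum_mem_cobound (comp_sub_mem_cobound hr hF)
  rw [h1]
  refine transferSubgroup_cohClass S n _ _ ?_
  rw [cocycleVal_homCocycle, cocycleVal_homCocycle]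
  funext g
  rw [toInhom_apply, transferCochain_apply]
  simp only
  rw [cosetSum_apply]
  refine Finset.sum_congr rfl fun q _ => ?_
  rw [toInhom_apply]
  simp only [partialProd_cosetTuple]
  have := hF.1 (cosetRetract S q.out)⁻¹ fun i => r (q.out * Fin.partialProd g i)
  rw [LinearMap.id_apply] at this
  rw [← this]
  rfl

end Transfer

end HomogCochain

namespace HomogCochain

variable {k : Type} [CommRing k] {G H Q T : Type} [Group G] [Group H] [Group Q] [Group T]

/-- The transfer along an injective homomorphism `j : H → G` of the restriction of an `H`-invariant
cocycle on `G`. -/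
theorem transferHom_homClass [Finite G] {j : H →* G} (hj : Function.Injective j)
    [Fintype (RightCosets j.range)] {n : ℕ} {F : (Fin (n + 1) → G) → k}
    (hF : F ∈ cocyc (leftAct j) (trivAct k H k) n) (h) (h') :
    transferHom k j hj n (homClass n ⟨fun x => F fun i => j (x i), h⟩) =
      homClass n ⟨cosetSum j.range (n + 1) F, h'⟩ := by
  have hF' : F ∈ cocyc (leftAct j.range.subtype) (trivAct k j.range k) n := by
    refine ⟨?_, hF.2⟩
    rintro ⟨_, a, rfl⟩ x
    exact hF.1 a x
  have hr : (fun x : Fin (n + 1) → j.range => F fun i => (x i : G)) ∈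
      cocyc (leftAct (MonoidHom.id j.range)) (trivAct k j.range k) n :=
    comp_mem_cocyc (φ := fun x : j.range => (x : G)) (fun _ _ => rfl) hF'
  rw [← transferSubgroup_homClass hF' hr, transferHom, LinearMap.comp_apply, cohPullback_homClass]
  congr 3
  funext x
  change F _ = F _
  congr 1
  funext i
  exact congrArg Subtype.val ((MonoidHom.ofInjective hj).apply_symm_apply (x i))

theorem card_rightCosets [Finite G] (S : Subgroup G) [Fintype (RightCosets S)] :
    Fintype.card (RightCosets S) = S.index := by
  rw [← Nat.card_eq_fintype_card, Subgroup.index]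
  exact Nat.card_congr (QuotientGroup.quotientRightRelEquivQuotientLeftRel S)

section BaseChange

variable {f : G →* Q} {S : Subgroup G} {R : Subgroup Q} (hSR : S ≤ R.comap f)

/-- The map of right cosets induced by a homomorphism. -/
def mapRightCosets : RightCosets S → RightCosets R :=
  Quotient.map f fun a b h => by
    have h' := hSR (QuotientGroup.rightRel_apply.1 h)
    exact QuotientGroup.rightRel_apply.2 (by simpa using h')

theorem mapRightCosets_translate (g : G) (q : RightCosets S) :
    mapRightCosets hSR (cosetTranslate S g q) =
      cosetTranslate R (f g) (mapRightCosets hSR q) := by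
  induction q using Quotient.inductionOn with | _ a => ?_
  change Quotient.mk _ (f (a * g)) = Quotient.mk _ (f a * f g)
  rw [map_mul]

/-- The fibres of the map of right cosets that a surjective homomorphism `f` induces all have
`[f⁻¹(R) : S]` elements. -/
theorem card_fibre_mapRightCosets [Finite G] [Finite Q] (hf : Function.Surjective f)
    [Fintype (RightCosets S)] [DecidableEq (RightCosets R)] (p : RightCosets R) :
    (Finset.univ.filter fun q => mapRightCosets hSR q = p).card = S.relIndex (R.comap f) := by
  let _ := Fintype.ofFinite (RightCosets R)
  have hconst : ∀ p', (Finset.univ.filter fun q => mapRightCosets hSR q = p').card =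
      (Finset.univ.filter fun q => mapRightCosets hSR q = p).card := by
    intro p'
    obtain ⟨g, hg⟩ : ∃ g, cosetTranslate R (f g) p' = p := by
      induction p using Quotient.inductionOn with | _ a => ?_
      induction p' using Quotient.inductionOn with | _ b => ?_
      obtain ⟨g, hg⟩ := hf (b⁻¹ * a)
      refine ⟨g, ?_⟩
      change Quotient.mk _ (b * f g) = _
      rw [hg, mul_inv_cancel_left]
    refine Finset.card_equiv (cosetTranslate S g) fun q => ?_
    simp only [Finset.mem_filter, Finset.mem_univ, true_and, mapRightCosets_translate, ← hg]
    exact (Equiv.apply_eq_iff_eq _).symm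
  have h1 : Fintype.card (RightCosets S) = Fintype.card (RightCosets R) *
      (Finset.univ.filter fun q => mapRightCosets hSR q = p).card := by
    rw [← Finset.card_univ, Finset.card_eq_sum_card_fiberwise
      (f := mapRightCosets hSR) (t := Finset.univ) fun _ _ => Finset.mem_coe.2 (Finset.mem_univ _)]
    simp only [hconst, Finset.sum_const, Finset.card_univ, smul_eq_mul]
  rw [card_rightCosets, card_rightCosets, ← Subgroup.relIndex_mul_index hSR,
    Subgroup.index_comap_of_surjective R hf, mul_comm] at h1
  exact (Nat.eq_of_mul_eq_mul_left (Nat.pos_of_ne_zero Subgroup.FiniteIndex.index_ne_zero) h1).symm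

end BaseChange

/-- Base change for the transfer: if `f : G → Q` is surjective, and maps the image of `j : H → G`
onto the image of `i : T → Q`, then inflation along `f` turns the transfer of `i` into the transfer
of `j`, up to the index of `j(H)` in the preimage of `i(T)`. -/
theorem transferHom_cohPullback [Finite G] [Finite Q] {f : G →* Q} (hf : Function.Surjective f)
    {j : H →* G} (hj : Function.Injective j) {i : T →* Q} (hi : Function.Injective i) (e : H →* T)
    (hcomm : ∀ h, f (j h) = i (e h)) (n : ℕ) (z : coh k T n) :
    transferHom k j hj n (cohPullback k e n z) =
      (j.range.relIndex (i.range.comap f) : k) • cohPullback k f n (transferHom k i hi n z) := by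
  classical
  let _ := Fintype.ofFinite (RightCosets j.range)
  let _ := Fintype.ofFinite (RightCosets i.range)
  obtain ⟨F, hF, rfl⟩ := exists_homClass_restrict hi z
  have hFR : F.1 ∈ eqCochains (leftAct i.range.subtype) (trivAct k i.range k) (n + 1) := by
    rintro ⟨_, a, rfl⟩ x
    exact F.2.1 a x
  have hFj : (fun x : Fin (n + 1) → G => F.1 fun i => f (x i)) ∈
      cocyc (leftAct j) (trivAct k H k) n :=
    comp_mem_cocyc (φ := f) (θ' := leftAct f ∘ j) (fun s x => by simp)
      ⟨fun s x => by simpa [leftAct, hcomm] using F.2.1 (e s) x, F.2.2⟩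
  have hSR : j.range ≤ i.range.comap f := by
    rintro _ ⟨a, rfl⟩
    exact ⟨e a, (hcomm a).symm⟩
  have hc1 : cosetSum i.range (n + 1) F.1 ∈
      cocyc (leftAct (MonoidHom.id Q)) (trivAct k Q k) n := cosetSum_mem_cocyc ⟨hFR, F.2.2⟩
  have hc2 : cosetSum j.range (n + 1) (fun x : Fin (n + 1) → G => F.1 fun i => f (x i)) ∈
      cocyc (leftAct (MonoidHom.id G)) (trivAct k G k) n := by
    refine cosetSum_mem_cocyc ⟨?_, hFj.2⟩
    rintro ⟨_, a, rfl⟩ x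
    exact hFj.1 a x
  have hc3 : (fun x : Fin (n + 1) → H => F.1 fun i => f (j (x i))) ∈
      cocyc (leftAct (MonoidHom.id H)) (trivAct k H k) n :=
    comp_mem_cocyc (φ := j) (θ' := leftAct j) (fun s x => by simp) hFj
  rw [cohPullback_homClass, transferHom_homClass hi F.2 hF hc1, cohPullback_homClass, ← map_smul]
  have : (fun x : Fin (n + 1) → H => F.1 fun l => i (e (x l))) =
      fun x => F.1 fun l => f (j (x l)) := by
    simp only [hcomm]
  refine Eq.trans (congrArg (transferHom k j hj n) (congrArg (homClass n) (Subtype.ext this) :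
    _ = homClass n ⟨_, hc3⟩)) ?_
  rw [transferHom_homClass hj hFj hc3 hc2]
  congr 1
  refine Subtype.ext (funext fun x => ?_)
  change cosetSum j.range (n + 1) _ x = _ * cosetSum i.range (n + 1) F.1 fun l => f (x l)
  rw [cosetSum_apply, cosetSum_apply, Finset.mul_sum,
    ← Finset.sum_fiberwise (g := mapRightCosets hSR)]
  refine Finset.sum_congr rfl fun p _ => ?_
  rw [← card_fibre_mapRightCosets hSR hf p, ← nsmul_eq_mul, ← Finset.sum_const]
  refine Finset.sum_congr rfl fun q hq => ?_
  simp only [map_mul]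
  refine translate_eq_of_mk_eq hFR ?_ fun l => f (x l)
  rw [Quotient.out_eq, ← (Finset.mem_filter.1 hq).2]
  conv_rhs => rw [← Quotient.out_eq q]
  rfl

end HomogCochain

/-! ### Functoriality of the pullback, the cup product and the cross product -/

section Functoriality

variable {k : Type} [CommRing k] {G H K G' H' : Type} [Group G] [Group H] [Group K] [Group G']
  [Group H']

/-- The pullback of a cocycle along a homomorphism. -/
theorem exists_cocycle_pullback (f : G →* H) {n : ℕ}
    (x : groupCohomology.cocycles (Rep.trivial k H k) n) :
    ∃ y : groupCohomology.cocycles (Rep.trivial k G k) n,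
      cocycleVal n y = fun g => cocycleVal n x fun i => f (g i) :=
  ⟨(groupCohomology.cocyclesMap f (Rep.ofHom ⟨LinearMap.id, fun _ => rfl⟩) n).hom x,
    congrArg (fun F => ModuleCat.Hom.hom F x) (HomologicalComplex.cyclesMap_i
      (groupCohomology.cochainsMap (A := Rep.trivial k H k) (B := Rep.trivial k G k) f
        (Rep.ofHom ⟨LinearMap.id, fun _ => rfl⟩)) n)⟩

theorem cohPullback_comp (f : G →* H) (g : H →* K) (n : ℕ) (z : coh k K n) :
    cohPullback k f n (cohPullback k g n z) = cohPullback k (g.comp f) n z := by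
  obtain ⟨x, rfl⟩ := cohClass_surjective n z
  obtain ⟨y, hy⟩ := exists_cocycle_pullback g x
  obtain ⟨w, hw⟩ := exists_cocycle_pullback f y
  rw [HomogCochain.cohPullback_cohClass g n x y hy, HomogCochain.cohPullback_cohClass f n y w hw,
    HomogCochain.cohPullback_cohClass (g.comp f) n x w (by rw [hw, hy]; rfl)]

theorem cohPullback_cup (f : G →* H) (m n : ℕ) (z : coh k H m) (w : coh k H n) :
    cohPullback k f (m + n) (cupCoh m n z w) =
      cupCoh m n (cohPullback k f m z) (cohPullback k f n w) := by
  obtain ⟨x, rfl⟩ := cohClass_surjective m z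
  obtain ⟨y, rfl⟩ := cohClass_surjective n w
  obtain ⟨x', hx⟩ := exists_cocycle_pullback f x
  obtain ⟨y', hy⟩ := exists_cocycle_pullback f y
  rw [HomogCochain.cohPullback_cohClass f m x x' hx, HomogCochain.cohPullback_cohClass f n y y' hy,
    cupCoh_cohClass, cupCoh_cohClass]
  refine HomogCochain.cohPullback_cohClass f (m + n) _ _ ?_
  rw [cocycleVal_cupCocycles, cocycleVal_cupCocycles, hx, hy]
  rfl

theorem cohPullback_cross (f : G →* G') (g : H →* H') (m n : ℕ) (z : coh k G' m)
    (w : coh k H' n) :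
    cohPullback k (f.prodMap g) (m + n) (crossCoh k G' H' m n z w) =
      crossCoh k G H m n (cohPullback k f m z) (cohPullback k g n w) := by
  simp only [crossCoh, LinearMap.compl₁₂_apply, cohPullback_cup, cohPullback_comp]
  rfl

theorem cohZeroEquiv_cohClass (x : groupCohomology.cocycles (Rep.trivial k G k) 0) :
    cohZeroEquiv k G (cohClass 0 x) = cocycleVal 0 x default :=
  congrArg (fun F => ModuleCat.Hom.hom F x)
    (groupCohomology.π_comp_H0IsoOfIsTrivial_hom (Rep.trivial k G k))

theorem cohZeroEquiv_cohPullback (f : G →* H) (z : coh k H 0) :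
    cohZeroEquiv k G (cohPullback k f 0 z) = cohZeroEquiv k H z := by
  obtain ⟨x, rfl⟩ := cohClass_surjective 0 z
  obtain ⟨y, hy⟩ := exists_cocycle_pullback f x
  rw [HomogCochain.cohPullback_cohClass f 0 x y hy, cohZeroEquiv_cohClass, cohZeroEquiv_cohClass,
    hy]
  exact congrArg _ (Subsingleton.elim _ _)

end Functoriality

section BilinOfComponents

variable {k : Type} [CommRing k] {I J : Type} [DecidableEq I] [DecidableEq J]
  {V : I → Type} {W : J → Type} {P : Type} [∀ i, AddCommGroup (V i)] [∀ i, Module k (V i)]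
  [∀ j, AddCommGroup (W j)] [∀ j, Module k (W j)] [AddCommGroup P] [Module k P]

theorem bilinOfComponents_lof (F : ∀ i j, V i →ₗ[k] W j →ₗ[k] P) (i : I) (j : J) (v : V i)
    (w : W j) : bilinOfComponents k F (DirectSum.lof k I V i v) (DirectSum.lof k J W j w) =
      F i j v w := by
  simp [bilinOfComponents]

theorem bilinear_ext_lof {B B' : (⨁ i, V i) →ₗ[k] (⨁ j, W j) →ₗ[k] P}
    (h : ∀ i j v w, B (DirectSum.lof k I V i v) (DirectSum.lof k J W j w) =
      B' (DirectSum.lof k I V i v) (DirectSum.lof k J W j w)) : B = B' := by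
  refine DirectSum.linearMap_ext k fun i => LinearMap.ext fun v => ?_
  refine DirectSum.linearMap_ext k fun j => LinearMap.ext fun w => ?_
  exact h i j v w

end BilinOfComponents

/-! ### A comparison of short exact sequences of complexes -/

namespace CochainChase

variable {A B : ℕ → Type} [∀ n, AddCommGroup (A n)] [∀ n, AddCommGroup (B n)]

/-- Coboundaries in a cochain complex that starts in degree `0`. -/
def IsCobdry (d : ∀ n, A n →+ A (n + 1)) : ∀ n, A n → Prop
  | 0, x => x = 0
  | n + 1, x => ∃ w, d n w = x

/-- The map `f` of complexes is injective on cohomology in degree `n`. -/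
def InjAt (dA : ∀ n, A n →+ A (n + 1)) (dB : ∀ n, B n →+ B (n + 1)) (f : ∀ n, A n →+ B n)
    (n : ℕ) : Prop :=
  ∀ x, dA n x = 0 → IsCobdry dB n (f n x) → IsCobdry dA n x

/-- The map `f` of complexes is surjective on cohomology in degree `n`. -/
def SurjAt (dA : ∀ n, A n →+ A (n + 1)) (dB : ∀ n, B n →+ B (n + 1)) (f : ∀ n, A n →+ B n)
    (n : ℕ) : Prop :=
  ∀ z, dB n z = 0 → ∃ x, dA n x = 0 ∧ IsCobdry dB n (z - f n x)

/-- A short exact sequence `0 → A → I → Q → 0` of cochain complexes. -/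
structure ShortExactSeq {A I Q : ℕ → Type} [∀ n, AddCommGroup (A n)] [∀ n, AddCommGroup (I n)]
    [∀ n, AddCommGroup (Q n)] (dA : ∀ n, A n →+ A (n + 1)) (dI : ∀ n, I n →+ I (n + 1))
    (dQ : ∀ n, Q n →+ Q (n + 1)) (j : ∀ n, A n →+ I n) (q : ∀ n, I n →+ Q n) : Prop where
  dd : ∀ n x, dI (n + 1) (dI n x) = 0
  j_d : ∀ n x, j (n + 1) (dA n x) = dI n (j n x)
  q_d : ∀ n x, q (n + 1) (dI n x) = dQ n (q n x)
  inj : ∀ n, Function.Injective (j n)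
  surj : ∀ n, Function.Surjective (q n)
  q_j : ∀ n x, q n (j n x) = 0
  exact : ∀ n x, q n x = 0 → ∃ y, j n y = x

theorem IsCobdry.map {dA : ∀ n, A n →+ A (n + 1)} {dB : ∀ n, B n →+ B (n + 1)}
    {f : ∀ n, A n →+ B n} (hf : ∀ n x, f (n + 1) (dA n x) = dB n (f n x)) {n : ℕ} {x : A n}
    (h : IsCobdry dA n x) : IsCobdry dB n (f n x) := by
  rcases n with _ | n
  · rw [show x = 0 from h]
    exact map_zero _
  · obtain ⟨w, rfl⟩ := h
    exact ⟨f n w, (hf n w).symm⟩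

theorem IsCobdry.neg {dA : ∀ n, A n →+ A (n + 1)} {n : ℕ} {x : A n} (h : IsCobdry dA n x) :
    IsCobdry dA n (-x) :=
  h.map (f := fun n => -AddMonoidHom.id (A n)) (fun n x => by simp)

variable {A₁ A₂ A₃ B₁ B₂ B₃ : ℕ → Type}
  [∀ n, AddCommGroup (A₁ n)] [∀ n, AddCommGroup (A₂ n)] [∀ n, AddCommGroup (A₃ n)]
  [∀ n, AddCommGroup (B₁ n)] [∀ n, AddCommGroup (B₂ n)] [∀ n, AddCommGroup (B₃ n)]
  {a₁ : ∀ n, A₁ n →+ A₁ (n + 1)} {a₂ : ∀ n, A₂ n →+ A₂ (n + 1)} {a₃ : ∀ n, A₃ n →+ A₃ (n + 1)}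
  {b₁ : ∀ n, B₁ n →+ B₁ (n + 1)} {b₂ : ∀ n, B₂ n →+ B₂ (n + 1)} {b₃ : ∀ n, B₃ n →+ B₃ (n + 1)}
  {jA : ∀ n, A₁ n →+ A₂ n} {qA : ∀ n, A₂ n →+ A₃ n}
  {jB : ∀ n, B₁ n →+ B₂ n} {qB : ∀ n, B₂ n →+ B₃ n}
  {f₁ : ∀ n, A₁ n →+ B₁ n} {f₂ : ∀ n, A₂ n →+ B₂ n} {f₃ : ∀ n, A₃ n →+ B₃ n}

/-- A coboundary of the quotient complex lifts to a coboundary. -/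
theorem ShortExactSeq.exists_lift_cobdry (hA : ShortExactSeq a₁ a₂ a₃ jA qA) {n : ℕ} {x : A₃ n}
    (h : IsCobdry a₃ n x) : ∃ y, IsCobdry a₂ n y ∧ qA n y = x ∧ a₂ n y = 0 := by
  rcases n with _ | n
  · exact ⟨0, rfl, by rw [map_zero, show x = 0 from h], map_zero _⟩
  · obtain ⟨w, rfl⟩ := h
    obtain ⟨v, rfl⟩ := hA.surj n w
    exact ⟨a₂ n v, ⟨v, rfl⟩, hA.q_d n v, hA.dd n v⟩

/-- The maps `f₁, f₂, f₃` form a morphism of sequences of complexes. -/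
structure IsMorphism (a₁ : ∀ n, A₁ n →+ A₁ (n + 1)) (a₂ : ∀ n, A₂ n →+ A₂ (n + 1))
    (b₁ : ∀ n, B₁ n →+ B₁ (n + 1)) (b₂ : ∀ n, B₂ n →+ B₂ (n + 1))
    (jA : ∀ n, A₁ n →+ A₂ n) (qA : ∀ n, A₂ n →+ A₃ n)
    (jB : ∀ n, B₁ n →+ B₂ n) (qB : ∀ n, B₂ n →+ B₃ n)
    (f₁ : ∀ n, A₁ n →+ B₁ n) (f₂ : ∀ n, A₂ n →+ B₂ n) (f₃ : ∀ n, A₃ n →+ B₃ n) : Prop where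
  d₁ : ∀ n x, f₁ (n + 1) (a₁ n x) = b₁ n (f₁ n x)
  d₂ : ∀ n x, f₂ (n + 1) (a₂ n x) = b₂ n (f₂ n x)
  j : ∀ n x, f₂ n (jA n x) = jB n (f₁ n x)
  q : ∀ n x, f₃ n (qA n x) = qB n (f₂ n x)

variable (hA : ShortExactSeq a₁ a₂ a₃ jA qA) (hB : ShortExactSeq b₁ b₂ b₃ jB qB)
  (hf : IsMorphism a₁ a₂ b₁ b₂ jA qA jB qB f₁ f₂ f₃)
include hA hB hf

omit hB in
theorem injAt_zero (h₂ : InjAt a₂ b₂ f₂ 0) : InjAt a₁ b₁ f₁ 0 := by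
  intro x hx h
  have h1 : jA 0 x = 0 := h₂ _ (by rw [← hA.j_d, hx, map_zero]) (by
    rw [hf.j, show f₁ 0 x = 0 from h, map_zero]; exact rfl)
  exact hA.inj 0 (h1.trans (map_zero _).symm)

/-- The four lemma for the long exact cohomology sequences: injectivity. -/
theorem injAt_succ {n : ℕ} (h₂ : SurjAt a₂ b₂ f₂ n) (h₂' : InjAt a₂ b₂ f₂ (n + 1))
    (h₃ : InjAt a₃ b₃ f₃ n) : InjAt a₁ b₁ f₁ (n + 1) := by
  rintro x hx ⟨u, hu⟩
  obtain ⟨w, hw⟩ := h₂' (jA (n + 1) x) (by rw [← hA.j_d, hx, map_zero])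
    ⟨jB n u, by rw [← hB.j_d, hu, hf.j]⟩
  obtain ⟨v, hv, hv'⟩ := h₂ (jB n u - f₂ n w) (by
    rw [map_sub, ← hB.j_d, hu, ← hf.d₂, hw, hf.j, sub_self])
  have h1 : IsCobdry b₃ n (f₃ n (qA n (w + v))) := by
    have h := (hv'.map hB.q_d).neg
    rw [hf.q, map_add, map_add]
    rw [map_sub, map_sub, hB.q_j] at h
    convert h using 1
    abel
  obtain ⟨r, -, hr, hr0⟩ := hA.exists_lift_cobdry (h₃ _ (by
    rw [← hA.q_d, map_add, hw, hv, add_zero, hA.q_j]) h1)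
  obtain ⟨s, hs⟩ := hA.exact n (w + v - r) (by rw [map_sub, hr, sub_self])
  refine ⟨s, hA.inj (n + 1) ?_⟩
  rw [hA.j_d, hs, map_sub, map_add, hw, hv, hr0, add_zero, sub_zero]

theorem surjAt_zero (h₂ : SurjAt a₂ b₂ f₂ 0) (h₃ : InjAt a₃ b₃ f₃ 0) : SurjAt a₁ b₁ f₁ 0 := by
  intro z hz
  obtain ⟨v, hv, hv'⟩ := h₂ (jB 0 z) (by rw [← hB.j_d, hz, map_zero])
  have hv1 : jB 0 z = f₂ 0 v := sub_eq_zero.1 hv'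
  have h1 : qA 0 v = 0 := h₃ _ (by rw [← hA.q_d, hv, map_zero]) (by
    rw [hf.q, ← hv1, hB.q_j]; exact rfl)
  obtain ⟨y, rfl⟩ := hA.exact 0 v h1
  refine ⟨y, hA.inj 1 (by rw [hA.j_d, hv, map_zero]), ?_⟩
  refine sub_eq_zero.2 (hB.inj 0 ?_)
  rw [hv1, hf.j]

/-- The four lemma for the long exact cohomology sequences: surjectivity. -/
theorem surjAt_succ {n : ℕ} (h₂ : SurjAt a₂ b₂ f₂ (n + 1)) (h₃ : InjAt a₃ b₃ f₃ (n + 1))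
    (h₃' : SurjAt a₃ b₃ f₃ n) : SurjAt a₁ b₁ f₁ (n + 1) := by
  intro z hz
  obtain ⟨v, hv, t, ht⟩ := h₂ (jB (n + 1) z) (by rw [← hB.j_d, hz, map_zero])
  obtain ⟨r', hr'⟩ := h₃ (qA (n + 1) v) (by rw [← hA.q_d, hv, map_zero]) (by
    refine ⟨-qB n t, ?_⟩
    rw [map_neg, ← hB.q_d, ht, map_sub, hB.q_j, hf.q, zero_sub, neg_neg])
  obtain ⟨r, rfl⟩ := hA.surj n r'
  obtain ⟨y, hy⟩ := hA.exact (n + 1) (v - a₂ n r) (by rw [map_sub, hA.q_d, hr', sub_self])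
  have hy0 : a₁ (n + 1) y = 0 := hA.inj _ (by
    rw [hA.j_d, hy, map_sub, hv, hA.dd, sub_zero, map_zero])
  have ht' : b₂ n (t + f₂ n r) = jB (n + 1) (z - f₁ (n + 1) y) := by
    rw [map_add, ht, map_sub, ← hf.j, hy, map_sub, ← hf.d₂]
    abel
  obtain ⟨m', hm', hp'⟩ := h₃' (qB n (t + f₂ n r)) (by rw [← hB.q_d, ht', hB.q_j])
  obtain ⟨m, rfl⟩ := hA.surj n m'
  obtain ⟨p, -, hp, hp0⟩ := hB.exists_lift_cobdry hp'
  obtain ⟨g, hg⟩ := hB.exact n (t + f₂ n r - f₂ n m - p) (by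
    rw [map_sub, hp, map_sub, ← hf.q n m, sub_self])
  obtain ⟨l, hl⟩ := hA.exact (n + 1) (a₂ n m) (by rw [hA.q_d, hm'])
  have hl0 : a₁ (n + 1) l = 0 := hA.inj _ (by rw [hA.j_d, hl, hA.dd, map_zero])
  refine ⟨y + l, by rw [map_add, hy0, hl0, add_zero], g, hB.inj _ ?_⟩
  rw [hB.j_d, hg, map_sub, map_sub, ht', hp0, ← hf.d₂, ← hl, hf.j, ← map_sub, sub_zero, map_add]
  congr 1
  abel

end CochainChase

/-! ### The cross product of homogeneous cochains -/

namespace HomogCochain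

section Cross

variable {k : Type} [CommRing k] {V : Type} [AddCommGroup V] [Module k V] {X Y : Type}

/-- The cross product of a cochain on `X` and a cochain on `Y`:
`(ξ × y)(l_0, …, l_N) = ξ(x_0, …, x_d) y(y_d, …, y_N)` for `l_i = (x_i, y_i)`. -/
def cross {d e N : ℕ} (h : d + e = N) :
    ((Fin (d + 1) → X) → k) →ₗ[k] ((Fin (e + 1) → Y) → V) →ₗ[k] ((Fin (N + 1) → X × Y) → V) :=
  LinearMap.mk₂ k
    (fun ξ y l => ξ (fun i => (l ⟨i, by omega⟩).1) • y (fun i => (l ⟨d + i, by omega⟩).2))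
    (fun _ _ _ => by ext; simp [add_smul]) (fun _ _ _ => by ext; simp [mul_smul])
    (fun _ _ _ => by ext; simp) (fun _ _ _ => funext fun _ => smul_comm _ _ _)

theorem cross_apply {d e N : ℕ} (h : d + e = N) (ξ : (Fin (d + 1) → X) → k)
    (y : (Fin (e + 1) → Y) → V) (l : Fin (N + 1) → X × Y) : cross h ξ y l =
      ξ (fun i => (l ⟨i, by omega⟩).1) • y (fun i => (l ⟨d + i, by omega⟩).2) := rfl

theorem fixFirst_cross_succ {d e N : ℕ} (h : d + 1 + e = N + 1) (ξ : (Fin (d + 2) → X) → k)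
    (y : (Fin (e + 1) → Y) → V) (a : X × Y) :
    fixFirst (cross h ξ y) a = cross (by omega : d + e = N) (fixFirst ξ a.1) y := by
  funext l
  rw [fixFirst, cross_apply, cross_apply, fixFirst]
  congr 2
  · funext i
    refine Fin.cases rfl (fun i => ?_) i
    rfl
  · funext i
    have : (⟨d + 1 + i, by omega⟩ : Fin (N + 1 + 1)) = Fin.succ ⟨d + i, by omega⟩ := by
      ext; simp; omega
    rw [this, Fin.cons_succ]

theorem fixFirst_cross_zero {e N : ℕ} (h : 0 + (e + 1) = N + 1) (ξ : (Fin 1 → X) → k)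
    (y : (Fin (e + 2) → Y) → V) (a : X × Y) : fixFirst (cross h ξ y) a =
      ξ (fun _ => a.1) • fun l => fixFirst y a.2 fun i => (l ⟨i, by omega⟩).2 := by
  funext l
  rw [fixFirst, cross_apply, Pi.smul_apply, fixFirst]
  congr 2
  · funext i
    rw [show i = 0 from Fin.ext (Nat.lt_one_iff.1 i.2)]
    rfl
  · funext i
    refine Fin.cases ?_ (fun i => ?_) i
    · rfl
    · have : (⟨0 + (i.succ : Fin (e + 2)), by omega⟩ : Fin (N + 1 + 1)) =
          Fin.succ ⟨i, by omega⟩ := by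
        ext; simp
      rw [this, Fin.cons_succ, Fin.cons_succ]

/-- The Leibniz rule for the cross product. -/
theorem δ_cross {d e N : ℕ} (h : d + e = N) (ξ : (Fin (d + 1) → X) → k)
    (y : (Fin (e + 1) → Y) → V) :
    δ k (N + 1) (cross h ξ y) = cross (by omega : d + 1 + e = N + 1) (δ k (d + 1) ξ) y +
      (-1 : k) ^ d • cross (by omega : d + (e + 1) = N + 1) ξ (δ k (e + 1) y) := by
  induction d generalizing N with
  | zero =>
    obtain rfl : e = N := by omega
    refine ext_fixFirst fun a => ?_
    have h1 : fixFirst (cross h ξ y) a =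
        ξ (fun _ => a.1) • fun l : Fin e → X × Y => fixFirst y a.2 fun i => (l i).2 := by
      funext l
      rw [fixFirst, cross_apply, Pi.smul_apply, fixFirst]
      congr 2
      · funext i
        rw [show i = 0 from Fin.ext (Nat.lt_one_iff.1 i.2)]
        rfl
      · funext i
        have : (⟨0 + i, by omega⟩ : Fin (e + 1)) = i := by ext; simp
        rw [this]
        refine Fin.cases rfl (fun i => ?_) i
        rfl
    have h2 : δ k e (fun l : Fin e → X × Y => fixFirst y a.2 fun i => (l i).2) =
        fun l : Fin (e + 1) → X × Y => δ k e (fixFirst y a.2) fun i => (l i).2 := rfl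
    have h3 : fixFirst (δ k 1 ξ) a.1 = ξ - fun _ => ξ fun _ => a.1 := by
      rw [fixFirst_δ_succ]
      congr 1
      refine ext_fixFirst fun b => funext fun z => ?_
      rw [fixFirst_δ_zero, fixFirst]
      congr 1
      funext i
      rw [show i = 0 from Fin.ext (Nat.lt_one_iff.1 i.2)]
      rfl
    have h4 : ∀ F G : (Fin (e + 2) → X × Y) → V, fixFirst (F + (-1 : k) ^ 0 • G) a =
        fixFirst F a + fixFirst G a := fun F G => by simp; rfl
    rw [h4, fixFirst_δ_succ, h1, map_smul, h2, fixFirst_cross_succ (d := 0), h3,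
      fixFirst_cross_zero, map_sub, LinearMap.sub_apply, fixFirst_δ_succ]
    funext l
    have h5 : (fun i : Fin (e + 1) => (l ⟨0 + i, by omega⟩).2) = fun i => (l i).2 := by
      funext i
      congr 2
      ext
      simp
    simp only [Pi.sub_apply, Pi.add_apply, Pi.smul_apply, cross_apply, h5, smul_sub]
    abel
  | succ d ih =>
    obtain ⟨N, rfl⟩ : ∃ N', N = N' + 1 := ⟨d + e, by omega⟩
    refine ext_fixFirst fun a => ?_
    have h4 : ∀ F G : (Fin (N + 3) → X × Y) → V, fixFirst (F + (-1 : k) ^ (d + 1) • G) a =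
        fixFirst F a - (-1 : k) ^ d • fixFirst G a := fun F G => by
      rw [pow_succ, mul_neg_one, neg_smul, ← sub_eq_add_neg]; rfl
    rw [h4, fixFirst_δ_succ, fixFirst_cross_succ, fixFirst_cross_succ, fixFirst_cross_succ,
      ih (by omega), fixFirst_δ_succ, map_sub, LinearMap.sub_apply]
    abel

end Cross

section CrossClass

variable {k : Type} [CommRing k] {G H : Type} [Group G] [Group H]

theorem partialProd_add {m n p : ℕ} (h : m + n = p) (g : Fin p → G) (b : Fin (n + 1)) :
    Fin.partialProd g ⟨m + b, by omega⟩ = Fin.partialProd g ⟨m, by omega⟩ *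
      Fin.partialProd (fun j : Fin n => g ⟨m + j, by omega⟩) b := by
  induction b using Fin.induction with
  | zero => simp
  | succ i ih =>
    have h1 : (⟨m + (i.succ : Fin (n + 1)), by omega⟩ : Fin (p + 1)) =
        Fin.succ ⟨m + i, by omega⟩ := by ext; simp; omega
    rw [h1, Fin.partialProd_succ, Fin.partialProd_succ, ← mul_assoc, ← ih]
    rfl

theorem partialProd_castLE {m n p : ℕ} (h : m + n = p) (g : Fin p → G) (b : Fin (m + 1)) :
    Fin.partialProd (fun j : Fin m => g ⟨j, by omega⟩) b = Fin.partialProd g ⟨b, by omega⟩ := by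
  induction b using Fin.induction with
  | zero => exact (Fin.partialProd_zero _).trans (Fin.partialProd_zero g).symm
  | succ i ih =>
    have h1 : (⟨(i.succ : Fin (m + 1)), by omega⟩ : Fin (p + 1)) =
        Fin.succ ⟨i, by omega⟩ := by ext; simp
    rw [h1, Fin.partialProd_succ, Fin.partialProd_succ, ih]
    rfl

/-- The cross product of cohomology classes, by homogeneous cochains. -/
theorem crossCoh_homClass {d e : ℕ} (F : cocyc (leftAct (MonoidHom.id G)) (trivAct k G k) d)
    (F' : cocyc (leftAct (MonoidHom.id H)) (trivAct k H k) e)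
    (h : cross rfl F.1 F'.1 ∈
      cocyc (leftAct (MonoidHom.id (G × H))) (trivAct k (G × H) k) (d + e)) :
    crossCoh k G H d e (homClass d F) (homClass e F') = homClass (d + e) ⟨_, h⟩ := by
  rw [crossCoh, LinearMap.compl₁₂_apply, cohPullback_homClass, cohPullback_homClass]
  refine (cupCoh_cohClass d e _ _).trans (homClass_eq _ _ ?_).symm
  rw [cocycleVal_cupCocycles, cocycleVal_homCocycle, cocycleVal_homCocycle]
  funext g
  rw [cupCochain_apply, toInhom_apply, toInhom_apply, toInhom_apply]
  simp only [cross_apply, smul_eq_mul]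
  congr 1
  · refine congrArg F.1 (funext fun i => ?_)
    rw [partialProd_castLE rfl g i]
    rfl
  · have h1 := F'.2.1 (Fin.partialProd g ⟨d, by omega⟩).2
      fun i => (Fin.partialProd (fun j : Fin e => g ⟨d + j, by omega⟩) i).2
    rw [LinearMap.id_apply] at h1
    refine h1.symm.trans (congrArg F'.1 (funext fun i => ?_))
    rw [partialProd_add rfl g i]
    rfl

end CrossClass

end HomogCochain

namespace HomogCochain

/-! ### Cochains with coefficients in a representation -/

section Representation

variable {k : Type} [CommRing k] {S : Type} [Group S]
  {M M' : Type} [AddCommGroup M] [Module k M] [AddCommGroup M'] [Module k M']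

/-- The homogeneous cochains of degree `n` of `S` with coefficients in the representation `σ`. -/
abbrev RepCochains (σ : Representation k S M) (n : ℕ) : Submodule k ((Fin (n + 1) → S) → M) :=
  eqCochains (leftAct (MonoidHom.id S)) (fun s => σ s) (n + 1)

/-- The differential of cochains with coefficients in a representation. -/
def repδ (σ : Representation k S M) (n : ℕ) : RepCochains σ n →ₗ[k] RepCochains σ (n + 1) :=
  (δ k (n + 1)).restrict fun _ h => δ_mem_eqCochains h

theorem repδ_repδ (σ : Representation k S M) (n : ℕ) (F : RepCochains σ n) :
    repδ σ (n + 1) (repδ σ n F) = 0 := Subtype.ext (δ_δ (n + 1) F.1)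

/-- The map on cochains that an equivariant map of coefficients induces. -/
def mapCoeff {σ : Representation k S M} {σ' : Representation k S M'} (T : M →ₗ[k] M')
    (hT : ∀ s m, T (σ s m) = σ' s (T m)) (n : ℕ) : RepCochains σ n →ₗ[k] RepCochains σ' n :=
  (T.compLeft _).restrict fun F hF s x => by
    change T (F _) = σ' s (T (F x))
    rw [hF, hT]

theorem mapCoeff_repδ {σ : Representation k S M} {σ' : Representation k S M'} (T : M →ₗ[k] M')
    (hT : ∀ s m, T (σ s m) = σ' s (T m)) (n : ℕ) (F : RepCochains σ n) :
    mapCoeff T hT (n + 1) (repδ σ n F) = repδ σ' n (mapCoeff T hT n F) := by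
  refine Subtype.ext (funext fun x => ?_)
  change T (δ k (n + 1) F.1 x) = δ k (n + 1) (fun x => T (F.1 x)) x
  simp only [δ_apply, map_sum, map_smul]

/-- Equivariant cochains lift along a surjection of coefficients: on each orbit a value can be
chosen freely at the tuples that start with `1`. -/
theorem mapCoeff_surjective {σ : Representation k S M} {σ' : Representation k S M'}
    (T : M →ₗ[k] M') (hT : ∀ s m, T (σ s m) = σ' s (T m)) (hs : Function.Surjective T) (n : ℕ) :
    Function.Surjective (mapCoeff T hT n) := by
  intro F
  refine ⟨⟨fun x => σ (x 0) (Function.surjInv hs (σ' (x 0)⁻¹ (F.1 x))), fun s x => ?_⟩,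
    Subtype.ext (funext fun x => ?_)⟩
  · have h := F.2 s x
    simp only [leftAct, MonoidHom.id_apply] at h ⊢
    rw [h, ← Module.End.mul_apply, ← Module.End.mul_apply, ← map_mul, ← map_mul]
    simp [mul_assoc]
  · change T (σ (x 0) _) = _
    rw [hT, Function.surjInv_eq hs, ← Module.End.mul_apply, ← map_mul, mul_inv_cancel, map_one]
    rfl

variable {M'' : Type} [AddCommGroup M''] [Module k M'']
  {σ : Representation k S M} {σ' : Representation k S M'} {σ'' : Representation k S M''}

/-- A short exact sequence of coefficients induces a short exact sequence of complexes. -/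
theorem shortExactSeq_repCochains {T : M →ₗ[k] M'} {Q : M' →ₗ[k] M''}
    (hT : ∀ s m, T (σ s m) = σ' s (T m)) (hQ : ∀ s m, Q (σ' s m) = σ'' s (Q m))
    (hTi : Function.Injective T) (hQs : Function.Surjective Q) (hQT : ∀ m, Q (T m) = 0)
    (hex : ∀ m, Q m = 0 → ∃ m', T m' = m) :
    CochainChase.ShortExactSeq (fun n => (repδ σ n).toAddMonoidHom)
      (fun n => (repδ σ' n).toAddMonoidHom) (fun n => (repδ σ'' n).toAddMonoidHom)
      (fun n => (mapCoeff T hT n).toAddMonoidHom) (fun n => (mapCoeff Q hQ n).toAddMonoidHom) where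
  dd := repδ_repδ σ'
  j_d := mapCoeff_repδ T hT
  q_d := mapCoeff_repδ Q hQ
  inj n F F' h := Subtype.ext (funext fun x => hTi (congrFun (congrArg Subtype.val h) x))
  surj := mapCoeff_surjective Q hQ hQs
  q_j n F := Subtype.ext (funext fun x => hQT _)
  exact n F h := by
    choose g hg using fun x => hex (F.1 x) (congrFun (congrArg Subtype.val h) x)
    refine ⟨⟨g, fun s x => hTi ?_⟩, Subtype.ext (funext hg)⟩
    rw [hg, hT, hg]
    exact F.2 s x

theorem isCobdry_repδ_iff (n : ℕ) (F : RepCochains σ n) :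
    CochainChase.IsCobdry (fun n => (repδ σ n).toAddMonoidHom) n F ↔
      F.1 ∈ cobound (leftAct (MonoidHom.id S)) (fun s => σ s) n := by
  rcases n with _ | n
  · constructor
    · intro h
      rw [show F = 0 from h]
      exact zero_mem _
    · rintro ⟨D, -, h0, h⟩
      refine Subtype.ext ?_
      rw [← h, h0 rfl, map_zero]
      rfl
  · constructor
    · rintro ⟨D, rfl⟩
      exact ⟨D.1, D.2, fun h => absurd h (Nat.succ_ne_zero n), rfl⟩
    · rintro ⟨D, hD, -, h⟩
      exact ⟨⟨D, hD⟩, Subtype.ext h⟩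

end Representation

/-! ### The comparison map of the Künneth theorem -/

section Comparison

variable {k : Type} [CommRing k] {G H : Type} [Group G] [Group H] {M M' M'' : Type}
  [AddCommGroup M] [Module k M] [AddCommGroup M'] [Module k M'] [AddCommGroup M''] [Module k M'']
  {ι : ℕ → Type} [∀ d, Fintype (ι d)]
  {d : ℕ} (ξ : ∀ d, ι d → cocyc (leftAct (MonoidHom.id G)) (trivAct k G k) d)

/-- A representation of `H`, as a representation of `G × H` on which `G` acts trivially. -/
abbrev inflateRep (G : Type) [Group G] (σ : Representation k H M) : Representation k (G × H) M :=
  σ.comp (MonoidHom.snd G H)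

/-- The cross product with a cocycle of `G`, on cochains of `H`. -/
def crossCocyc (F : cocyc (leftAct (MonoidHom.id G)) (trivAct k G k) d)
    (σ : Representation k H M) {e N : ℕ} (h : d + e = N) :
    RepCochains σ e →ₗ[k] RepCochains (inflateRep G σ) N :=
  (cross h F.1).restrict fun y hy s x => by
    rw [cross_apply, cross_apply]
    have h1 := F.2.1 s.1 fun i => (x ⟨i, by omega⟩).1
    have h2 := hy s.2 fun i => (x ⟨d + i, by omega⟩).2
    simp only [leftAct, MonoidHom.id_apply, LinearMap.id_apply] at h1 h2
    change F.1 (fun i => s.1 * _) • y (fun i => s.2 * _) = _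
    rw [h1, h2, ← map_smul]
    rfl

theorem repδ_crossCocyc (F : cocyc (leftAct (MonoidHom.id G)) (trivAct k G k) d)
    (σ : Representation k H M) {e N : ℕ} (h : d + e = N) (y : RepCochains σ e) :
    repδ _ N (crossCocyc F σ h y) =
      (-1 : k) ^ d • crossCocyc F σ (by omega : d + (e + 1) = N + 1) (repδ σ e y) := by
  refine Subtype.ext ?_
  change δ k (N + 1) (cross h F.1 y.1) =
    (-1 : k) ^ d • cross (by omega : d + (e + 1) = N + 1) F.1 (δ k (e + 1) y.1)
  rw [δ_cross, (mem_cocyc.1 F.2).2, map_zero, LinearMap.zero_apply, zero_add]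

/-- The families of cochains of `H` that are indexed by cocycles `ξ d a` of `G`, such that the
degrees add up to `N`. This is the tensor product of a graded vector space with basis `ξ` and the
complex of cochains of `H`. -/
abbrev Families (ι : ℕ → Type) (σ : Representation k H M) (N : ℕ) : Type :=
  ∀ p : {p : ℕ × ℕ // p.1 + p.2 = N}, ι p.1.1 → RepCochains σ p.1.2

/-- The differential of families. -/
def famδ (ι : ℕ → Type) (σ : Representation k H M) (N : ℕ) :
    Families ι σ N →ₗ[k] Families ι σ (N + 1) where
  toFun y p a := match p, a with
    | ⟨(_, 0), _⟩, _ => 0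
    | ⟨(d, e + 1), h⟩, a => (-1 : k) ^ d • repδ σ e (y ⟨(d, e), by dsimp at h ⊢; omega⟩ a)
  map_add' y y' := by
    funext ⟨⟨d, e⟩, h⟩ a
    rcases e with _ | e
    · exact (add_zero _).symm
    · simp
  map_smul' c y := by
    funext ⟨⟨d, e⟩, h⟩ a
    rcases e with _ | e
    · exact (smul_zero (A := RepCochains σ 0) c).symm
    · simp [smul_comm c]

omit [∀ d, Fintype (ι d)] in
theorem famδ_zero (σ : Representation k H M) {N : ℕ} (y : Families ι σ N) (d : ℕ)
    (h : d + 0 = N + 1) (a : ι d) : famδ ι σ N y ⟨(d, 0), h⟩ a = 0 := rfl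

omit [∀ d, Fintype (ι d)] in
theorem famδ_succ (σ : Representation k H M) {N : ℕ} (y : Families ι σ N) (d e : ℕ)
    (h : d + (e + 1) = N + 1) (a : ι d) : famδ ι σ N y ⟨(d, e + 1), h⟩ a =
      (-1 : k) ^ d • repδ σ e (y ⟨(d, e), by omega⟩ a) := rfl

omit [∀ d, Fintype (ι d)] in
theorem famδ_eq_zero_iff (σ : Representation k H M) {N : ℕ} (y : Families ι σ N) :
    famδ ι σ N y = 0 ↔ ∀ d e h a, repδ σ e (y ⟨(d, e), h⟩ a) = 0 := by
  constructor
  · intro hy d e h a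
    have h1 : (-1 : k) ^ d • repδ σ e (y ⟨(d, e), h⟩ a) = 0 :=
      congrFun (congrFun hy ⟨(d, e + 1), by omega⟩) a
    have h2 := congrArg (fun v => (-1 : k) ^ d • v) h1
    simpa [smul_smul, ← mul_pow] using h2
  · intro hy
    funext ⟨⟨d, e⟩, h⟩ a
    rcases e with _ | e
    · rfl
    · rw [famδ_succ, hy, smul_zero]
      rfl

omit [∀ d, Fintype (ι d)] in
theorem isCobdry_famδ_iff (σ : Representation k H M) {N : ℕ} (y : Families ι σ N) :
    CochainChase.IsCobdry (fun n => (famδ ι σ n).toAddMonoidHom) N y ↔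
      ∀ d e h a,
        CochainChase.IsCobdry (fun n => (repδ σ n).toAddMonoidHom) e (y ⟨(d, e), h⟩ a) := by
  rcases N with _ | N
  · constructor
    · intro hy d e h a
      rw [show y = 0 from hy]
      obtain rfl : e = 0 := by omega
      rfl
    · intro hy
      funext ⟨⟨d, e⟩, h⟩ a
      obtain rfl : e = 0 := by omega
      exact hy d 0 h a
  · constructor
    · rintro ⟨w, rfl⟩ d e h a
      rcases e with _ | e
      · rfl
      · exact ⟨(-1 : k) ^ d • w ⟨(d, e), by omega⟩ a, map_smul (repδ σ e) _ _⟩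
    · intro hy
      choose w hw using fun (d e : ℕ) (h : d + (e + 1) = N + 1) (a : ι d) => hy d (e + 1) h a
      refine ⟨fun p a => (-1 : k) ^ p.1.1 • w p.1.1 p.1.2 (by have := p.2; omega) a, ?_⟩
      funext ⟨⟨d, e⟩, h⟩ a
      rcases e with _ | e
      · exact (hy d 0 h a).symm
      · change (-1 : k) ^ d • repδ σ e ((-1 : k) ^ d • w d e _ a) = _
        rw [map_smul, smul_smul, ← mul_pow, neg_one_mul, neg_neg, one_pow, one_smul]
        exact hw d e h a

/-- The map of families that an equivariant map of coefficients induces. -/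
def mapFam (ι : ℕ → Type) {σ : Representation k H M} {σ' : Representation k H M'} (T : M →ₗ[k] M')
    (hT : ∀ s m, T (σ s m) = σ' s (T m)) (N : ℕ) : Families ι σ N →ₗ[k] Families ι σ' N where
  toFun y p a := mapCoeff T hT p.1.2 (y p a)
  map_add' y y' := by funext ⟨⟨d, e⟩, h⟩ a; simp
  map_smul' c y := by funext ⟨⟨d, e⟩, h⟩ a; simp

omit [∀ d, Fintype (ι d)] in
theorem mapFam_famδ {σ : Representation k H M} {σ' : Representation k H M'} (T : M →ₗ[k] M')
    (hT : ∀ s m, T (σ s m) = σ' s (T m)) (N : ℕ) (y : Families ι σ N) :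
    mapFam ι T hT (N + 1) (famδ ι σ N y) = famδ ι σ' N (mapFam ι T hT N y) := by
  funext ⟨⟨d, e⟩, h⟩ a
  rcases e with _ | e
  · exact map_zero (mapCoeff T hT 0)
  · change mapCoeff T hT (e + 1) ((-1 : k) ^ d • repδ σ e (y ⟨(d, e), _⟩ a)) =
      (-1 : k) ^ d • repδ σ' e _
    rw [map_smul, mapCoeff_repδ]
    rfl

omit [∀ d, Fintype (ι d)] in
theorem shortExactSeq_families {σ : Representation k H M} {σ' : Representation k H M'}
    {σ'' : Representation k H M''} {T : M →ₗ[k] M'} {Q : M' →ₗ[k] M''}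
    (hT : ∀ s m, T (σ s m) = σ' s (T m)) (hQ : ∀ s m, Q (σ' s m) = σ'' s (Q m))
    (hTi : Function.Injective T) (hQs : Function.Surjective Q) (hQT : ∀ m, Q (T m) = 0)
    (hex : ∀ m, Q m = 0 → ∃ m', T m' = m) :
    CochainChase.ShortExactSeq (fun n => (famδ ι σ n).toAddMonoidHom)
      (fun n => (famδ ι σ' n).toAddMonoidHom) (fun n => (famδ ι σ'' n).toAddMonoidHom)
      (fun n => (mapFam ι T hT n).toAddMonoidHom) (fun n => (mapFam ι Q hQ n).toAddMonoidHom) := by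
  have hC := shortExactSeq_repCochains hT hQ hTi hQs hQT hex
  refine ⟨fun n y => ?_, mapFam_famδ T hT, mapFam_famδ Q hQ, fun n y y' h => ?_, fun n y => ?_,
    fun n y => ?_, fun n y h => ?_⟩
  · refine (famδ_eq_zero_iff σ' _).2 fun d e h a => ?_
    rcases e with _ | e
    · exact map_zero _
    · change repδ σ' (e + 1) ((-1 : k) ^ d • repδ σ' e _) = 0
      rw [map_smul, repδ_repδ, smul_zero]
  · funext ⟨⟨d, e⟩, h'⟩ a
    exact hC.inj e (congrFun (congrFun h ⟨(d, e), h'⟩) a)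
  · choose w hw using fun (d e : ℕ) (h : d + e = n) (a : ι d) => hC.surj e (y ⟨(d, e), h⟩ a)
    exact ⟨fun p a => w p.1.1 p.1.2 p.2 a, by funext ⟨⟨d, e⟩, h⟩ a; exact hw d e h a⟩
  · funext ⟨⟨d, e⟩, h⟩ a
    exact hC.q_j e _
  · choose w hw using fun (d e : ℕ) (h' : d + e = n) (a : ι d) =>
      hC.exact e (y ⟨(d, e), h'⟩ a) (congrFun (congrFun h ⟨(d, e), h'⟩) a)
    exact ⟨fun p a => w p.1.1 p.1.2 p.2 a, by funext ⟨⟨d, e⟩, h⟩ a; exact hw d e h a⟩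

/-- The comparison map `(y_i)_i ↦ ∑ i, ξ_i × y_i`. -/
def crossSum (σ : Representation k H M) (N : ℕ) :
    Families ι σ N →ₗ[k] RepCochains (inflateRep G σ) N :=
  ∑ p ∈ Finset.HasAntidiagonal.antidiagonal N, if h : p.1 + p.2 = N then
    ∑ a : ι p.1, crossCocyc (ξ p.1 a) σ h ∘ₗ
      { toFun := fun y => y ⟨p, h⟩ a, map_add' := fun _ _ => rfl, map_smul' := fun _ _ => rfl }
    else 0

theorem crossSum_apply (σ : Representation k H M) (N : ℕ) (y : Families ι σ N) :
    crossSum ξ σ N y = ∑ p ∈ Finset.HasAntidiagonal.antidiagonal N, if h : p.1 + p.2 = N then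
      ∑ a : ι p.1, crossCocyc (ξ p.1 a) σ h (y ⟨p, h⟩ a) else 0 := by
  rw [crossSum, LinearMap.sum_apply]
  refine Finset.sum_congr rfl fun p hp => ?_
  rw [dif_pos (Finset.HasAntidiagonal.mem_antidiagonal.1 hp),
    dif_pos (Finset.HasAntidiagonal.mem_antidiagonal.1 hp), LinearMap.sum_apply]
  rfl

theorem crossSum_famδ (σ : Representation k H M) (N : ℕ) (y : Families ι σ N) :
    crossSum ξ σ (N + 1) (famδ ι σ N y) = repδ _ N (crossSum ξ σ N y) := by
  rw [crossSum_apply, crossSum_apply, Finset.Nat.sum_antidiagonal_succ', map_sum]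
  have h0 : (∑ a : ι (N + 1), crossCocyc (ξ (N + 1) a) σ (by omega : N + 1 + 0 = N + 1)
      (famδ ι σ N y ⟨(N + 1, 0), by omega⟩ a)) = 0 :=
    Finset.sum_eq_zero fun a _ => by rw [famδ_zero, map_zero]
  simp only [add_zero, dite_true]
  rw [h0, zero_add]
  refine Finset.sum_congr rfl fun p hp => ?_
  have hp' := Finset.HasAntidiagonal.mem_antidiagonal.1 hp
  rw [dif_pos hp', dif_pos (by omega), map_sum]
  refine Finset.sum_congr rfl fun a _ => ?_
  rw [famδ_succ, map_smul, repδ_crossCocyc]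

theorem crossSum_mapFam {σ : Representation k H M} {σ' : Representation k H M'} (T : M →ₗ[k] M')
    (hT : ∀ s m, T (σ s m) = σ' s (T m)) (N : ℕ) (y : Families ι σ N) :
    crossSum ξ σ' N (mapFam ι T hT N y) =
      mapCoeff (σ := inflateRep G σ) (σ' := inflateRep G σ') T (fun s m => hT s.2 m) N
        (crossSum ξ σ N y) := by
  rw [crossSum_apply, crossSum_apply, map_sum]
  refine Finset.sum_congr rfl fun p hp => ?_
  have hp' := Finset.HasAntidiagonal.mem_antidiagonal.1 hp
  rw [dif_pos hp', dif_pos hp', map_sum]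
  refine Finset.sum_congr rfl fun a _ => Subtype.ext (funext fun l => ?_)
  change (ξ p.1 a).1 _ • T ((y ⟨p, hp'⟩ a).1 _) = T ((ξ p.1 a).1 _ • (y ⟨p, hp'⟩ a).1 _)
  rw [map_smul]

theorem isMorphism_crossSum {σ : Representation k H M} {σ' : Representation k H M'}
    {σ'' : Representation k H M''} {T : M →ₗ[k] M'} {Q : M' →ₗ[k] M''}
    (hT : ∀ s m, T (σ s m) = σ' s (T m)) (hQ : ∀ s m, Q (σ' s m) = σ'' s (Q m)) :
    CochainChase.IsMorphism (fun n => (famδ ι σ n).toAddMonoidHom)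
      (fun n => (famδ ι σ' n).toAddMonoidHom)
      (fun n => (repδ (inflateRep G σ) n).toAddMonoidHom)
      (fun n => (repδ (inflateRep G σ') n).toAddMonoidHom)
      (fun n => (mapFam ι T hT n).toAddMonoidHom) (fun n => (mapFam ι Q hQ n).toAddMonoidHom)
      (fun n => (mapCoeff (σ := inflateRep G σ) (σ' := inflateRep G σ') T
        (fun s m => hT s.2 m) n).toAddMonoidHom)
      (fun n => (mapCoeff (σ := inflateRep G σ') (σ' := inflateRep G σ'') Q
        (fun s m => hQ s.2 m) n).toAddMonoidHom)
      (fun n => (crossSum ξ σ n).toAddMonoidHom) (fun n => (crossSum ξ σ' n).toAddMonoidHom)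
      (fun n => (crossSum ξ σ'' n).toAddMonoidHom) where
  d₁ := crossSum_famδ ξ σ
  d₂ := crossSum_famδ ξ σ'
  j := crossSum_mapFam ξ T hT
  q := crossSum_mapFam ξ Q hQ

/-- The comparison map is injective on cohomology in degree `N`. -/
def CrossInj (σ : Representation k H M) (N : ℕ) : Prop :=
  CochainChase.InjAt (fun n => (famδ ι σ n).toAddMonoidHom)
    (fun n => (repδ (inflateRep G σ) n).toAddMonoidHom)
    (fun n => (crossSum ξ σ n).toAddMonoidHom) N

/-- The comparison map is surjective on cohomology in degree `N`. -/
def CrossSurj (σ : Representation k H M) (N : ℕ) : Prop :=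
  CochainChase.SurjAt (fun n => (famδ ι σ n).toAddMonoidHom)
    (fun n => (repδ (inflateRep G σ) n).toAddMonoidHom)
    (fun n => (crossSum ξ σ n).toAddMonoidHom) N

end Comparison

end HomogCochain

namespace HomogCochain

section ChainMap

variable {k : Type} [CommRing k] {V V' X X' S S' : Type} [AddCommGroup V] [Module k V]
  [AddCommGroup V'] [Module k V'] {θ : S → X → X} {ρ : S → V →ₗ[k] V} {θ' : S' → X' → X'}
  {ρ' : S' → V' →ₗ[k] V'}

/-- A chain map that preserves equivariance preserves coboundaries. -/
theorem map_mem_cobound (Φ : ∀ n, ((Fin n → X) → V) →ₗ[k] ((Fin n → X') → V'))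
    (hΦ : ∀ n F, F ∈ eqCochains θ ρ n → Φ n F ∈ eqCochains θ' ρ' n)
    (hδ : ∀ n F, Φ (n + 1) (δ k n F) = δ k n (Φ n F)) {n : ℕ} {F : (Fin (n + 1) → X) → V}
    (hF : F ∈ cobound θ ρ n) : Φ (n + 1) F ∈ cobound θ' ρ' n := by
  obtain ⟨D, hD, h0, rfl⟩ := hF
  exact ⟨Φ n D, hΦ n D hD, fun h => by rw [h0 h, map_zero], (hδ n D).symm⟩

theorem compLeft_mem_cobound {G : Type} [Group G] (T : V →ₗ[k] V') {n : ℕ}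
    {F : (Fin (n + 1) → G) → V}
    (hF : F ∈ cobound (leftAct (MonoidHom.id G)) (trivAct k G V) n) :
    (fun x => T (F x)) ∈ cobound (leftAct (MonoidHom.id G)) (trivAct k G V') n :=
  map_mem_cobound (θ := leftAct (MonoidHom.id G)) (ρ := trivAct k G V)
    (θ' := leftAct (MonoidHom.id G)) (ρ' := trivAct k G V') (fun n => T.compLeft (Fin n → G))
    (fun n F h s x => congrArg T (h s x))
    (fun n F => by
      funext x
      change T (δ k n F x) = δ k n (fun x => T (F x)) x
      simp only [δ_apply, map_sum, map_smul]) hF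

theorem compLeft_mem_cocyc {G : Type} [Group G] (T : V →ₗ[k] V') {n : ℕ}
    {F : (Fin (n + 1) → G) → V}
    (hF : F ∈ cocyc (leftAct (MonoidHom.id G)) (trivAct k G V) n) :
    (fun x => T (F x)) ∈ cocyc (leftAct (MonoidHom.id G)) (trivAct k G V') n := by
  refine ⟨fun s x => congrArg T (hF.1 s x), funext fun x => ?_⟩
  have h := congrArg T (congrFun (mem_cocyc.1 hF).2 x)
  simpa only [δ_apply, map_sum, map_smul, Pi.zero_apply, map_zero] using h

end ChainMap

/-! ### Coinduced coefficients -/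

section Coinduced

variable {k : Type} [CommRing k] {H : Type} [Group H] {M : Type} [AddCommGroup M] [Module k M]

/-- The functions `H → M`, with the diagonal action of `H`. -/
def coindRep (σ : Representation k H M) : Representation k H (H → M) where
  toFun h :=
    { toFun := fun f u => σ h (f (h⁻¹ * u))
      map_add' := fun f f' => by funext u; simp
      map_smul' := fun c f => by funext u; simp }
  map_one' := by ext f u; simp
  map_mul' h h' := by ext f u; simp [mul_assoc]

theorem coindRep_apply (σ : Representation k H M) (h : H) (f : H → M) (u : H) :
    coindRep σ h f u = σ h (f (h⁻¹ * u)) := rfl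

/-- The constant functions in the coinduced representation. -/
def constCoind (k H M : Type) [CommRing k] [AddCommGroup M] [Module k M] : M →ₗ[k] (H → M) where
  toFun m _ := m
  map_add' _ _ := rfl
  map_smul' _ _ := rfl

/-- The quotient of the coinduced representation by the constant functions. -/
def coindQuot (σ : Representation k H M) :
    Representation k H ((H → M) ⧸ LinearMap.range (constCoind k H M)) where
  toFun h := Submodule.mapQ _ _ (coindRep σ h) (by
    rintro _ ⟨m, rfl⟩
    exact ⟨σ h m, rfl⟩)
  map_one' := by
    refine Submodule.linearMap_qext _ (LinearMap.ext fun f => ?_)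
    simp
  map_mul' h h' := by
    refine Submodule.linearMap_qext _ (LinearMap.ext fun f => ?_)
    simp

variable (σ : Representation k H M)

/-- The coinduced representation has no cohomology in positive degrees; the contraction is
evaluation at the diagonal. -/
theorem exists_repδ_eq_of_coind {n : ℕ} (F : RepCochains (coindRep σ) (n + 1))
    (hF : repδ _ (n + 1) F = 0) : ∃ D, repδ _ n D = F := by
  refine ⟨⟨fun x u => F.1 (Fin.cons u x) u, fun s x => funext fun u => ?_⟩, Subtype.ext ?_⟩
  · have h := congrFun (F.2 s (Fin.cons (s⁻¹ * u) x)) u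
    change F.1 _ u = σ s (F.1 _ (s⁻¹ * u)) at h
    change F.1 (Fin.cons u fun i => s * x i) u = σ s (F.1 _ (s⁻¹ * u))
    rw [← h]
    refine congrFun (congrArg F.1 ?_) u
    refine Eq.trans ?_ (cons_map (fun z : H => s * z) (s⁻¹ * u) x)
    rw [mul_inv_cancel_left]
  · funext x u
    have h := congrFun (congrFun (congrArg Subtype.val hF) (Fin.cons u x)) u
    change fixFirst (δ k (n + 2) F.1) u x u = 0 at h
    rw [fixFirst_δ_succ, Pi.sub_apply, Pi.sub_apply, sub_eq_zero] at h
    rw [h]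
    change δ k (n + 1) (fun x u => F.1 (Fin.cons u x) u) x u = δ k (n + 1) (fixFirst F.1 u) x u
    simp only [δ_apply, Finset.sum_apply, Pi.smul_apply]

/-- The invariants of the coinduced representation. -/
theorem apply_of_coind_zero (F : RepCochains (coindRep σ) 0) (hF : repδ _ 0 F = 0)
    (x : Fin 1 → H) (u : H) : F.1 x u = σ u (F.1 (fun _ => 1) 1) := by
  have h1 : ∀ a b : H, F.1 (fun _ => b) = F.1 fun _ => a := by
    intro a b
    have h : fixFirst (δ k 1 F.1) a (fun _ => b) = 0 :=
      congrFun (congrArg Subtype.val hF) (Fin.cons a fun _ => b)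
    rw [fixFirst_δ_succ, Pi.sub_apply, sub_eq_zero] at h
    rw [h]
    rw [δ_apply, Fin.sum_univ_one, Fin.val_zero, pow_zero, one_smul]
    refine congrArg F.1 (funext fun i => ?_)
    obtain rfl : i = 0 := Fin.eq_zero i
    rfl
  have h2 := congrFun (F.2 u fun _ => 1) u
  simp only [coindRep_apply, inv_mul_cancel] at h2
  rw [← h2]
  have h3 : x = fun _ => x 0 := by
    funext i
    rw [Subsingleton.elim i 0]
  rw [h3]
  exact congrFun (h1 _ _) u

/-- The invariant of the coinduced representation with value `m` at `1`. -/
def coindInvariant (m : M) : RepCochains (coindRep σ) 0 :=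
  ⟨fun _ u => σ u m, fun s x => funext fun u => by
    rw [coindRep_apply, ← Module.End.mul_apply, ← map_mul, mul_inv_cancel_left]⟩

theorem repδ_coindInvariant (m : M) : repδ _ 0 (coindInvariant σ m) = 0 := by
  refine Subtype.ext (funext fun x => ?_)
  change δ k 1 (fun (_ : Fin 1 → H) (u : H) => σ u m) x = 0
  rw [δ_apply, Fin.sum_univ_two]
  simp

variable {G : Type} [Group G]

/-- The operator that replaces the second component of the argument by the variable `u` of the
coinduced representation. -/
def coindDiag (k G H M : Type) [CommRing k] [AddCommGroup M] [Module k M] :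
    (G × H → (H → M)) →ₗ[k] (G × H → (H → M)) where
  toFun φ x u := φ (x.1, u) u
  map_add' _ _ := rfl
  map_smul' _ _ := rfl

omit [Group H] [Group G] in
theorem lift_coindDiag (n : ℕ) (F : (Fin n → G × H) → (H → M)) (x : Fin n → G × H) (u : H) :
    lift (coindDiag k G H M) n F x u = F (fun i => ((x i).1, u)) u := by
  induction n with
  | zero =>
    rw [lift_zero_apply]
    congr 1
    exact Subsingleton.elim _ _
  | succ n ih =>
    rw [lift_succ_apply]
    change lift (coindDiag k G H M) n (fixFirst F ((x 0).1, u)) (Fin.tail x) u = _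
    rw [ih, fixFirst]
    refine congrFun (congrArg F ?_) u
    exact (cons_map (fun z : G × H => (z.1, u)) (x 0) (Fin.tail x)).trans
      (by rw [Fin.cons_self_tail])

theorem isEquivariantOp_coindDiag :
    IsEquivariantOp (leftAct (MonoidHom.id (G × H))) (leftAct (MonoidHom.id (G × H)))
      (fun s => inflateRep G (coindRep σ) s) (coindDiag k G H M) := by
  intro s φ φ' h x
  funext u
  have h1 := congrFun (h (x.1, s.2⁻¹ * u)) u
  have h2 : leftAct (MonoidHom.id (G × H)) s (x.1, s.2⁻¹ * u) = (s.1 * x.1, u) := by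
    simp [leftAct, Prod.mul_def]
  rw [h2] at h1
  exact h1

/-- Evaluation of cochains of `G × H` with coinduced coefficients on `G`. -/
def evalOne (k G H M : Type) [CommRing k] [Group H] [AddCommGroup M] [Module k M] (n : ℕ) :
    ((Fin n → G × H) → (H → M)) →ₗ[k] ((Fin n → G) → M) where
  toFun F g := F (fun i => (g i, 1)) 1
  map_add' _ _ := rfl
  map_smul' _ _ := rfl

omit [Group G] in
theorem evalOne_δ (n : ℕ) (F : (Fin n → G × H) → (H → M)) :
    evalOne k G H M (n + 1) (δ k n F) = δ k n (evalOne k G H M n F) := by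
  funext g
  change δ k n F (fun i => (g i, 1)) 1 = _
  rw [δ_apply, δ_apply, Finset.sum_apply]
  rfl

theorem evalOne_mem {n : ℕ} {F : (Fin n → G × H) → (H → M)}
    (hF : F ∈ eqCochains (leftAct (MonoidHom.id (G × H)))
      (fun s => inflateRep G (coindRep σ) s) n) :
    evalOne k G H M n F ∈ eqCochains (leftAct (MonoidHom.id G)) (trivAct k G M) n := by
  intro s x
  have h := congrFun (hF (s, 1) fun i => (x i, 1)) 1
  have h2 : (inflateRep G (coindRep σ)) (s, 1) = 1 := map_one (coindRep σ)
  change F (fun i => (s * x i, 1 * 1)) 1 = inflateRep G (coindRep σ) (s, 1) _ 1 at h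
  rw [h2, mul_one] at h
  exact h

/-- The extension of a cochain of `G` to a cochain of `G × H` with coinduced coefficients. -/
def spread (G : Type) (n : ℕ) : ((Fin n → G) → M) →ₗ[k] ((Fin n → G × H) → (H → M)) where
  toFun r x u := σ u (r fun i => (x i).1)
  map_add' _ _ := by funext x u; simp
  map_smul' _ _ := by funext x u; simp

omit [Group G] in
theorem spread_δ (n : ℕ) (F : (Fin n → G) → M) :
    spread σ G (n + 1) (δ k n F) = δ k n (spread σ G n F) := by
  funext x u
  change σ u (δ k n F fun i => (x i).1) = _
  rw [δ_apply, δ_apply, Finset.sum_apply, map_sum]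
  simp only [map_smul]
  rfl

theorem spread_mem {n : ℕ} {F : (Fin n → G) → M}
    (hF : F ∈ eqCochains (leftAct (MonoidHom.id G)) (trivAct k G M) n) :
    spread σ G n F ∈ eqCochains (leftAct (MonoidHom.id (G × H)))
      (fun s => inflateRep G (coindRep σ) s) n := by
  intro s x
  funext u
  change σ u (F fun i => s.1 * (x i).1) = σ s.2 (σ (s.2⁻¹ * u) (F fun i => (x i).1))
  rw [← Module.End.mul_apply, ← map_mul, mul_inv_cancel_left]
  exact congrArg (σ u) (hF s.1 fun i => (x i).1)

/-- Extension after evaluation is one of the operators `lift E`, so that it is the identity on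
cohomology by `lift_sub_mem_cobound`. So the cohomology of `G × H` with coinduced coefficients is
that of `G` with values in `M`. -/
theorem spread_evalOne {n : ℕ} {F : (Fin n → G × H) → (H → M)}
    (hF : F ∈ eqCochains (leftAct (MonoidHom.id (G × H)))
      (fun s => inflateRep G (coindRep σ) s) n) :
    spread σ G n (evalOne k G H M n F) = lift (coindDiag k G H M) n F := by
  funext x u
  rw [lift_coindDiag]
  have h := congrFun (hF (1, u) fun i => ((x i).1, 1)) u
  change F (fun i => (1 * (x i).1, u * 1)) u = σ u (F _ (u⁻¹ * u)) at h
  simp only [one_mul, mul_one, inv_mul_cancel] at h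
  exact h.symm

end Coinduced

end HomogCochain

namespace HomogCochain

/-! ### The Künneth theorem with coefficients -/

section KunnethCoefficients

variable {k : Type} [Field k] {G H : Type} [Group G] [Group H] {ι : ℕ → Type} [∀ d, Fintype (ι d)]
  {M : Type} [AddCommGroup M] [Module k M]

/-- The classes of the cocycles `ξ d a` form a basis of the cohomology of `G` in each degree `d`. -/
structure IsCohBasis (ξ : ∀ d, ι d → cocyc (leftAct (MonoidHom.id G)) (trivAct k G k) d) :
    Prop where
  gen : ∀ d, ∀ F ∈ cocyc (leftAct (MonoidHom.id G)) (trivAct k G k) d, ∃ c : ι d → k,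
    F - ∑ a, c a • (ξ d a).1 ∈ cobound (leftAct (MonoidHom.id G)) (trivAct k G k) d
  indep : ∀ d (c : ι d → k),
    ∑ a, c a • (ξ d a).1 ∈ cobound (leftAct (MonoidHom.id G)) (trivAct k G k) d → c = 0

variable {ξ : ∀ d, ι d → cocyc (leftAct (MonoidHom.id G)) (trivAct k G k) d}

/-- Up to coboundaries, the cocycles with values in a finite-dimensional vector space `M` are the
combinations of the `ξ d a` with coefficients in `M`. -/
theorem IsCohBasis.exists_coeff (hξ : IsCohBasis ξ) [FiniteDimensional k M] {d : ℕ}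
    {F : (Fin (d + 1) → G) → M} (hF : F ∈ cocyc (leftAct (MonoidHom.id G)) (trivAct k G M) d) :
    ∃ v : ι d → M, (F - fun x => ∑ a, (ξ d a).1 x • v a) ∈
      cobound (leftAct (MonoidHom.id G)) (trivAct k G M) d := by
  let b := Module.finBasis k M
  choose c hc using fun j => hξ.gen d _ (compLeft_mem_cocyc (b.coord j) hF)
  refine ⟨fun a => ∑ j, c j a • b j, ?_⟩
  have h := Submodule.sum_mem _ fun j (_ : j ∈ Finset.univ) =>
    compLeft_mem_cobound (LinearMap.toSpanSingleton k M (b j)) (hc j)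
  convert h using 1
  funext x
  simp only [Finset.sum_apply, LinearMap.toSpanSingleton_apply, Pi.sub_apply, Pi.smul_apply,
    sub_smul, Finset.sum_sub_distrib, Module.Basis.coord_apply, b.sum_repr, Finset.sum_smul,
    Finset.smul_sum, smul_eq_mul, smul_smul]
  rw [Finset.sum_comm]
  simp only [mul_comm]

/-- The coefficients of `IsCohBasis.exists_coeff` are unique. -/
theorem IsCohBasis.coeff_eq_zero (hξ : IsCohBasis ξ) {d : ℕ} {v : ι d → M}
    (h : (fun x => ∑ a, (ξ d a).1 x • v a) ∈
      cobound (leftAct (MonoidHom.id G)) (trivAct k G M) d) : v = 0 := by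
  funext a
  refine (Module.forall_dual_apply_eq_zero_iff k (v a)).1 fun φ => ?_
  refine congrFun (hξ.indep d (fun a => φ (v a)) ?_) a
  convert compLeft_mem_cobound φ h using 1
  funext x
  simp [mul_comm]

theorem crossSum_single (ξ : ∀ d, ι d → cocyc (leftAct (MonoidHom.id G)) (trivAct k G k) d)
    (σ : Representation k H M) {N : ℕ} (p : {p : ℕ × ℕ // p.1 + p.2 = N})
    (w : ι p.1.1 → RepCochains σ p.1.2) :
    crossSum ξ σ N (Pi.single p w) = ∑ a, crossCocyc (ξ p.1.1 a) σ p.2 (w a) := by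
  rw [crossSum_apply, Finset.sum_eq_single p.1, dif_pos p.2]
  · exact Finset.sum_congr rfl fun a _ => by rw [Pi.single_eq_same (M := fun p :
      {p : ℕ × ℕ // p.1 + p.2 = N} => ι p.1.1 → RepCochains σ p.1.2) p w]
  · intro q hq hqp
    rw [dif_pos (Finset.HasAntidiagonal.mem_antidiagonal.1 hq)]
    refine Finset.sum_eq_zero fun a _ => ?_
    rw [Pi.single_eq_of_ne (fun h => hqp (congrArg Subtype.val h))]
    exact map_zero _
  · exact fun h => absurd (Finset.HasAntidiagonal.mem_antidiagonal.2 p.2) h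

omit [∀ d, Fintype (ι d)] in
theorem famδ_single (σ : Representation k H M) {N : ℕ} (p : {p : ℕ × ℕ // p.1 + p.2 = N})
    (w : ι p.1.1 → RepCochains σ p.1.2) (hw : ∀ a, repδ σ p.1.2 (w a) = 0) :
    famδ ι σ N (Pi.single p w) = 0 := by
  refine (famδ_eq_zero_iff σ _).2 fun d e h a => ?_
  by_cases hp : (⟨(d, e), h⟩ : {p : ℕ × ℕ // p.1 + p.2 = N}) = p
  · subst hp
    rw [Pi.single_eq_same]
    exact hw a
  · rw [Pi.single_eq_of_ne hp]
    exact map_zero _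

variable (ξ) in
/-- The comparison map sends the invariants `u ↦ σ u (v a)` in degree `0` to the extension of the
cochain `∑ a, ξ_a v_a` of `G`. -/
theorem crossSum_coindInvariant (σ : Representation k H M) (N : ℕ) (v : ι N → M) :
    (crossSum ξ (coindRep σ) N (Pi.single ⟨(N, 0), rfl⟩ fun a => coindInvariant σ (v a))).1 =
      spread σ G (N + 1) fun x => ∑ a, (ξ N a).1 x • v a := by
  rw [crossSum_single]
  funext x u
  change (∑ a, crossCocyc (ξ N a) (coindRep σ) rfl (coindInvariant σ (v a))).1 x u =
    σ u (∑ a, (ξ N a).1 (fun i => (x i).1) • v a)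
  rw [map_sum, AddSubmonoidClass.coe_finsetSum, Finset.sum_apply, Finset.sum_apply]
  refine Finset.sum_congr rfl fun a _ => ?_
  rw [map_smul]
  rfl

/-- For coinduced coefficients every cocycle of `G × H` is cohomologous to the extension of a
cocycle of `G` with values in `M`, and such a cocycle is a combination of the `ξ N a`. -/
theorem crossSurj_coindRep (hξ : IsCohBasis ξ) [FiniteDimensional k M] (σ : Representation k H M)
    (N : ℕ) : CrossSurj ξ (coindRep σ) N := by
  intro z hz
  have hδ : δ k (N + 1) z.1 = 0 := congrArg Subtype.val hz
  have h1 := lift_sub_mem_cobound (isEquivariantOp_coindDiag (G := G) σ) (fun _ => rfl)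
    (n := N) (F := z.1) ⟨z.2, hδ⟩
  rw [← spread_evalOne σ z.2] at h1
  obtain ⟨v, hv⟩ := hξ.exists_coeff (d := N) (F := evalOne k G H M (N + 1) z.1)
    ⟨evalOne_mem σ z.2, by
      change δ k (N + 1) _ = 0
      rw [← evalOne_δ, hδ, map_zero]⟩
  have h2 := map_mem_cobound (spread σ G) (fun n F hF => spread_mem σ hF) (spread_δ σ) hv
  refine ⟨Pi.single ⟨(N, 0), rfl⟩ fun a => coindInvariant σ (v a),
    famδ_single _ _ _ fun a => repδ_coindInvariant σ (v a), (isCobdry_repδ_iff _ _).2 ?_⟩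
  convert sub_mem h2 h1 using 1
  rw [map_sub]
  change z.1 - (crossSum ξ (coindRep σ) N _).1 = _
  rw [crossSum_coindInvariant]
  abel

theorem crossInj_coindRep (hξ : IsCohBasis ξ) (σ : Representation k H M)
    (N : ℕ) : CrossInj ξ (coindRep σ) N := by
  intro y hy hc
  have hy' := (famδ_eq_zero_iff _ y).1 hy
  -- In positive degrees the components of `y` are coboundaries, so that only invariants matter.
  let v : ι N → M := fun a => (y ⟨(N, 0), rfl⟩ a).1 (fun _ => 1) 1
  have hv : ∀ a, y ⟨(N, 0), rfl⟩ a = coindInvariant σ (v a) := fun a =>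
    Subtype.ext (funext fun x => funext fun u => apply_of_coind_zero σ _ (hy' N 0 rfl a) x u)
  let y₀ : Families ι (coindRep σ) N :=
    Pi.single ⟨(N, 0), rfl⟩ fun a => coindInvariant σ (v a)
  have h1 : CochainChase.IsCobdry (fun n => (famδ ι (coindRep σ) n).toAddMonoidHom) N (y - y₀) := by
    refine (isCobdry_famδ_iff _ _).2 fun d e h a => ?_
    rcases e with _ | e
    · obtain rfl : d = N := h
      change y ⟨(d, 0), rfl⟩ a - y₀ ⟨(d, 0), rfl⟩ a = 0
      rw [hv, sub_eq_zero]
      exact (congrFun (Pi.single_eq_same (M := fun p : {p : ℕ × ℕ // p.1 + p.2 = d} =>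
        ι p.1.1 → RepCochains (coindRep σ) p.1.2) ⟨(d, 0), rfl⟩
          fun a => coindInvariant σ (v a)) a).symm
    · have h2 : (y - y₀) ⟨(d, e + 1), h⟩ a = y ⟨(d, e + 1), h⟩ a := by
        change y _ a - y₀ _ a = _
        rw [show y₀ ⟨(d, e + 1), h⟩ = 0 from Pi.single_eq_of_ne (by simp) _]
        exact sub_zero _
      rw [h2]
      exact exists_repδ_eq_of_coind σ _ (hy' d (e + 1) h a)
  have h2 := sub_mem ((isCobdry_repδ_iff _ _).1 hc)
    ((isCobdry_repδ_iff _ _).1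
      (h1.map (f := fun n => (crossSum ξ (coindRep σ) n).toAddMonoidHom)
        (crossSum_famδ ξ (coindRep σ))))
  have h3 : (crossSum ξ (coindRep σ) N y).1 - (crossSum ξ (coindRep σ) N (y - y₀)).1 =
      spread σ G (N + 1) fun x => ∑ a, (ξ N a).1 x • v a := by
    rw [map_sub, Submodule.coe_sub, sub_sub_cancel, ← crossSum_coindInvariant]
  have h4 := map_mem_cobound (evalOne k G H M) (fun n F hF => evalOne_mem σ hF) evalOne_δ
    (h3 ▸ h2)
  have h5 : evalOne k G H M (N + 1) (spread σ G (N + 1) fun x => ∑ a, (ξ N a).1 x • v a) =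
      fun x => ∑ a, (ξ N a).1 x • v a := by
    funext x
    change σ 1 _ = _
    rw [map_one]
    rfl
  have h6 : v = 0 := hξ.coeff_eq_zero (h5 ▸ h4)
  have h7 : y₀ = 0 := by
    refine Pi.single_eq_zero_iff.2 (funext fun a =>
      Subtype.ext (funext fun x => funext fun u => ?_))
    change σ u (v a) = 0
    rw [h6]
    exact map_zero _
  rwa [h7, sub_zero] at h1

/-- The comparison map is bijective on cohomology, for all finite-dimensional coefficients: by
dimension shifting along the embedding of the coefficients into a coinduced representation. -/
theorem crossInj_and_crossSurj [Finite H] (hξ : IsCohBasis ξ) (N : ℕ) :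
    ∀ (M : Type) [AddCommGroup M] [Module k M] [FiniteDimensional k M]
      (σ : Representation k H M), CrossInj ξ σ N ∧ CrossSurj ξ σ N := by
  have hT : ∀ (M : Type) [AddCommGroup M] [Module k M] (σ : Representation k H M) (s : H) (m : M),
    constCoind k H M (σ s m) = coindRep σ s (constCoind k H M m) := fun _ _ _ _ _ _ => rfl
  have hQ : ∀ (M : Type) [AddCommGroup M] [Module k M] (σ : Representation k H M) (s : H)
    (f : H → M), (LinearMap.range (constCoind k H M)).mkQ (coindRep σ s f) =
      coindQuot σ s ((LinearMap.range (constCoind k H M)).mkQ f) := fun _ _ _ _ _ _ => rfl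
  have hTi : ∀ (M : Type) [AddCommGroup M] [Module k M], Function.Injective (constCoind k H M) :=
    fun _ _ _ _ _ h => congrFun h 1
  have hQs : ∀ (M : Type) [AddCommGroup M] [Module k M],
    Function.Surjective (LinearMap.range (constCoind k H M)).mkQ :=
    fun _ _ _ => Submodule.mkQ_surjective _
  have hQT : ∀ (M : Type) [AddCommGroup M] [Module k M] (m : M),
    (LinearMap.range (constCoind k H M)).mkQ (constCoind k H M m) = 0 := fun _ _ _ m => by simp
  have hex : ∀ (M : Type) [AddCommGroup M] [Module k M] (f : H → M),
    (LinearMap.range (constCoind k H M)).mkQ f = 0 → ∃ m, constCoind k H M m = f :=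
    fun _ _ _ f h => by simpa using h
  induction N with
  | zero =>
    have hinj : ∀ (M : Type) [AddCommGroup M] [Module k M] [FiniteDimensional k M]
        (σ : Representation k H M), CrossInj ξ σ 0 := fun M _ _ _ σ =>
      CochainChase.injAt_zero
        (shortExactSeq_families (hT M σ) (hQ M σ) (hTi M) (hQs M) (hQT M) (hex M))
        (isMorphism_crossSum ξ (hT M σ) (hQ M σ)) (crossInj_coindRep hξ σ 0)
    intro M _ _ _ σ
    exact ⟨hinj M σ, CochainChase.surjAt_zero
      (shortExactSeq_families (hT M σ) (hQ M σ) (hTi M) (hQs M) (hQT M) (hex M))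
      (shortExactSeq_repCochains _ _ (hTi M) (hQs M) (hQT M) (hex M))
      (isMorphism_crossSum ξ (hT M σ) (hQ M σ)) (crossSurj_coindRep hξ σ 0)
      (hinj _ (coindQuot σ))⟩
  | succ N ih =>
    have hinj : ∀ (M : Type) [AddCommGroup M] [Module k M] [FiniteDimensional k M]
        (σ : Representation k H M), CrossInj ξ σ (N + 1) := fun M _ _ _ σ =>
      CochainChase.injAt_succ
        (shortExactSeq_families (hT M σ) (hQ M σ) (hTi M) (hQs M) (hQT M) (hex M))
        (shortExactSeq_repCochains _ _ (hTi M) (hQs M) (hQT M) (hex M))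
        (isMorphism_crossSum ξ (hT M σ) (hQ M σ)) (crossSurj_coindRep hξ σ N)
        (crossInj_coindRep hξ σ (N + 1)) (ih _ (coindQuot σ)).1
    intro M _ _ _ σ
    exact ⟨hinj M σ, CochainChase.surjAt_succ
      (shortExactSeq_families (hT M σ) (hQ M σ) (hTi M) (hQs M) (hQT M) (hex M))
      (shortExactSeq_repCochains _ _ (hTi M) (hQs M) (hQT M) (hex M))
      (isMorphism_crossSum ξ (hT M σ) (hQ M σ)) (crossSurj_coindRep hξ σ (N + 1))
      (hinj _ (coindQuot σ)) (ih _ (coindQuot σ)).2⟩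

end KunnethCoefficients

end HomogCochain

namespace HomogCochain

/-! ### The Künneth theorem -/

section Kunneth

variable (k : Type) [Field k] (G H : Type) [Group G] [Finite G] [Group H]

instance (d : ℕ) : FiniteDimensional k (coh k G d) :=
  Module.Finite.of_surjective (homClass (k := k) (G := G) d) (homClass_surjective d)

/-- Cocycles whose classes form a basis of the cohomology of `G`. -/
noncomputable def basisCocyc (d : ℕ) (a : Fin (Module.finrank k (coh k G d))) :
    cocyc (leftAct (MonoidHom.id G)) (trivAct k G k) d :=
  Function.surjInv (homClass_surjective d) (Module.finBasis k (coh k G d) a)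

theorem homClass_basisCocyc (d : ℕ) (a : Fin (Module.finrank k (coh k G d))) :
    homClass d (basisCocyc k G d a) = Module.finBasis k (coh k G d) a :=
  Function.surjInv_eq _ _

theorem isCohBasis_basisCocyc : IsCohBasis (basisCocyc k G) where
  gen d F hF := by
    refine ⟨fun a => (Module.finBasis k (coh k G d)).repr (homClass d ⟨F, hF⟩) a, ?_⟩
    have h := (homClass_eq_zero_iff (⟨F, hF⟩ - ∑ a, (Module.finBasis k (coh k G d)).repr
      (homClass d ⟨F, hF⟩) a • basisCocyc k G d a)).1 (by
        rw [map_sub, map_sum]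
        simp only [map_smul, homClass_basisCocyc]
        rw [Module.Basis.sum_repr, sub_self])
    simpa using h
  indep d c hc := by
    have h := (homClass_eq_zero_iff (∑ a, c a • basisCocyc k G d a)).2 (by simpa using hc)
    rw [map_sum] at h
    simp only [map_smul, homClass_basisCocyc] at h
    funext a
    exact Fintype.linearIndependent_iff.1 (Module.finBasis k (coh k G d)).linearIndependent c h a

variable {k G H}

/-- The class of a cocycle with coefficients in the trivial representation. -/
noncomputable def repClass (n : ℕ) : LinearMap.ker (repδ (1 : Representation k H k) n) →ₗ[k]
    coh k H n :=
  homClass n ∘ₗ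
    { toFun := fun y => ⟨y.1.1, y.1.2, congrArg Subtype.val y.2⟩
      map_add' := fun _ _ => rfl
      map_smul' := fun _ _ => rfl }

theorem repClass_surjective (n : ℕ) : Function.Surjective (repClass (k := k) (H := H) n) := by
  intro z
  obtain ⟨F, rfl⟩ := homClass_surjective n z
  exact ⟨⟨⟨F.1, F.2.1⟩, Subtype.ext F.2.2⟩, rfl⟩

theorem repClass_eq_zero_iff {n : ℕ} (y : LinearMap.ker (repδ (1 : Representation k H k) n)) :
    repClass n y = 0 ↔
      CochainChase.IsCobdry (fun n =>
        (repδ (1 : Representation k H k) n).toAddMonoidHom) n y.1 := by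
  rw [isCobdry_repδ_iff, repClass, LinearMap.comp_apply, homClass_eq_zero_iff]
  exact Iff.rfl

omit [Finite G] in
theorem repClass_crossCocyc {d e N : ℕ} (h : d + e = N)
    (F : cocyc (leftAct (MonoidHom.id G)) (trivAct k G k) d)
    (y : LinearMap.ker (repδ (1 : Representation k H k) e))
    (hy : repδ (1 : Representation k (G × H) k) N
      (crossCocyc F (1 : Representation k H k) h y.1) = 0) :
    repClass (H := G × H) N ⟨crossCocyc F (1 : Representation k H k) h y.1, hy⟩ =
      h ▸ crossCoh k G H d e (homClass d F) (repClass e y) := by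
  subst h
  exact (crossCoh_homClass F ⟨y.1.1, y.1.2, congrArg Subtype.val y.2⟩ _).symm

/-- The families of cocycles of `H`, indexed by a basis of the cohomology of `G`. -/
abbrev CocycFamilies (k G H : Type) [Field k] [Group G] [Finite G] [Group H] (N : ℕ) :
    Submodule k (Families (fun d => Fin (Module.finrank k (coh k G d)))
      (1 : Representation k H k) N) :=
  LinearMap.ker (famδ (fun d => Fin (Module.finrank k (coh k G d))) (1 : Representation k H k) N)

/-- The class of a component of a family of cocycles. -/
noncomputable def famClass {N : ℕ} (p : {p : ℕ × ℕ // p.1 + p.2 = N})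
    (a : Fin (Module.finrank k (coh k G p.1.1))) :
    CocycFamilies k G H N →ₗ[k] coh k H p.1.2 :=
  repClass p.1.2 ∘ₗ
    { toFun := fun y => ⟨y.1 p a, (famδ_eq_zero_iff _ y.1).1 y.2 p.1.1 p.1.2 p.2 a⟩
      map_add' := fun _ _ => rfl
      map_smul' := fun _ _ => rfl }

/-- The class of `∑ i, ξ_i × y_i`, for a family `y` of cocycles. -/
noncomputable def crossSumClass (N : ℕ) : CocycFamilies k G H N →ₗ[k] coh k (G × H) N :=
  repClass N ∘ₗ
    { toFun := fun y => ⟨crossSum (basisCocyc k G) 1 N y.1,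
        (crossSum_famδ (basisCocyc k G) 1 N y.1).symm.trans (by rw [y.2, map_zero])⟩
      map_add' := fun _ _ => Subtype.ext (map_add _ _ _)
      map_smul' := fun _ _ => Subtype.ext (map_smul _ _ _) }

theorem crossSumClass_surjective [Finite H] (N : ℕ) :
    Function.Surjective (crossSumClass (k := k) (G := G) (H := H) N) := by
  intro z
  obtain ⟨F, rfl⟩ := repClass_surjective N z
  obtain ⟨y, hy, h⟩ := (crossInj_and_crossSurj (isCohBasis_basisCocyc k G) N k
    (1 : Representation k H k)).2 F.1 F.2
  refine ⟨⟨y, hy⟩, (sub_eq_zero.1 ?_).symm⟩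
  rw [crossSumClass, LinearMap.comp_apply, ← map_sub]
  exact (repClass_eq_zero_iff _).2 h

theorem famClass_eq_zero [Finite H] {N : ℕ} {y : CocycFamilies k G H N} (hy : crossSumClass N y = 0)
    (p : {p : ℕ × ℕ // p.1 + p.2 = N}) (a : Fin (Module.finrank k (coh k G p.1.1))) :
    famClass p a y = 0 := by
  have h := (crossInj_and_crossSurj (isCohBasis_basisCocyc k G) N k
    (1 : Representation k H k)).1 y.1 y.2 ((repClass_eq_zero_iff _).1 hy)
  exact (repClass_eq_zero_iff _).2 ((isCobdry_famδ_iff _ _).1 h p.1.1 p.1.2 p.2 a)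

theorem crossSumClass_eq {N : ℕ} (y : CocycFamilies k G H N) : crossSumClass N y =
    ∑ p ∈ (Finset.HasAntidiagonal.antidiagonal N).attach, ∑ a,
      (Finset.HasAntidiagonal.mem_antidiagonal.1 p.2 : p.1.1 + p.1.2 = N) ▸
        crossCoh k G H p.1.1 p.1.2 (Module.finBasis k (coh k G p.1.1) a)
          (famClass ⟨p.1, Finset.HasAntidiagonal.mem_antidiagonal.1 p.2⟩ a y) := by
  have hc : ∀ (p : {p : ℕ × ℕ // p ∈ Finset.HasAntidiagonal.antidiagonal N}) a,
      repδ (1 : Representation k (G × H) k) N (crossCocyc (basisCocyc k G p.1.1 a) 1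
        (Finset.HasAntidiagonal.mem_antidiagonal.1 p.2)
        (y.1 ⟨p.1, Finset.HasAntidiagonal.mem_antidiagonal.1 p.2⟩ a)) = 0 := fun p a => by
    refine (repδ_crossCocyc _ 1 _ _).trans ?_
    rw [(famδ_eq_zero_iff _ y.1).1 y.2, map_zero, smul_zero]
  have h : crossSumClass N y = ∑ p ∈ (Finset.HasAntidiagonal.antidiagonal N).attach, ∑ a,
      repClass N ⟨_, hc p a⟩ := by
    simp only [← map_sum]
    refine congrArg (repClass N) (Subtype.ext ?_)
    simp only [AddSubmonoidClass.coe_finsetSum]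
    refine (crossSum_apply _ _ _ _).trans ?_
    rw [← Finset.sum_attach]
    refine Finset.sum_congr rfl fun p _ => ?_
    rw [dif_pos (Finset.HasAntidiagonal.mem_antidiagonal.1 p.2)]
  rw [h]
  refine Finset.sum_congr rfl fun p _ => Finset.sum_congr rfl fun a _ => ?_
  rw [← homClass_basisCocyc]
  exact repClass_crossCocyc _ _ ⟨_, (famδ_eq_zero_iff _ y.1).1 y.2 p.1.1 p.1.2
    (Finset.HasAntidiagonal.mem_antidiagonal.1 p.2) a⟩ _

/-- The cross products span the cohomology of `G × H`. -/
theorem mem_of_crossCoh_mem [Finite H] {N : ℕ} (R : Submodule k (coh k (G × H) N))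
    (hR : ∀ d e (h : d + e = N) (x : coh k G d) (y : coh k H e), h ▸ crossCoh k G H d e x y ∈ R)
    (z : coh k (G × H) N) : z ∈ R := by
  obtain ⟨y, rfl⟩ := crossSumClass_surjective N z
  rw [crossSumClass_eq]
  exact sum_mem fun p _ => sum_mem fun a _ => hR _ _ _ _ _

theorem exists_comp_eq {V W P : Type} [AddCommMonoid V] [Module k V] [AddCommGroup W] [Module k W]
    [AddCommGroup P] [Module k P] (α : V →ₗ[k] W) (β : V →ₗ[k] P) (hα : Function.Surjective α)
    (h : ∀ v, α v = 0 → β v = 0) : ∃ L : W →ₗ[k] P, ∀ v, L (α v) = β v := by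
  have h1 : ∀ v v', α v = α v' → β v = β v' := fun v v' hv => by
    have h2 := h (v + (-1 : k) • v') (by simp [hv])
    simpa [← sub_eq_add_neg, sub_eq_zero] using h2
  have hs := Function.surjInv_eq hα
  exact ⟨{  toFun := fun w => β (Function.surjInv hα w)
            map_add' := fun w w' => by
              rw [← map_add]
              exact h1 _ _ (by rw [map_add, hs, hs, hs])
            map_smul' := fun c w => by
              rw [RingHom.id_apply, ← map_smul]
              exact h1 _ _ (by rw [map_smul, hs, hs]) }, fun v => h1 _ _ (hs _)⟩

/-- Bilinear maps on the cohomology of `G` and `H` factor through the cross product. -/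
theorem exists_factor_crossCoh [Finite H] {P : Type} [AddCommGroup P] [Module k P]
    (B : ∀ d e, coh k G d →ₗ[k] coh k H e →ₗ[k] P) (N : ℕ) :
    ∃ L : coh k (G × H) N →ₗ[k] P, ∀ d e (h : d + e = N) (x : coh k G d) (y : coh k H e),
      L (h ▸ crossCoh k G H d e x y) = B d e x y := by
  let β : CocycFamilies k G H N →ₗ[k] P :=
    ∑ p ∈ (Finset.HasAntidiagonal.antidiagonal N).attach, ∑ a,
      B p.1.1 p.1.2 (Module.finBasis k (coh k G p.1.1) a) ∘ₗ
        famClass ⟨p.1, Finset.HasAntidiagonal.mem_antidiagonal.1 p.2⟩ a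
  have hβ : ∀ y, β y = ∑ p ∈ (Finset.HasAntidiagonal.antidiagonal N).attach, ∑ a,
      B p.1.1 p.1.2 (Module.finBasis k (coh k G p.1.1) a)
        (famClass ⟨p.1, Finset.HasAntidiagonal.mem_antidiagonal.1 p.2⟩ a y) := fun y => by
    simp [β]
  have hker : ∀ y : CocycFamilies k G H N, crossSumClass N y = 0 → β y = 0 := fun y hy => by
    rw [hβ]
    refine Finset.sum_eq_zero fun p _ => Finset.sum_eq_zero fun a _ => ?_
    rw [famClass_eq_zero hy, map_zero]
  -- The class of `∑ i, ξ_i × y_i` determines the classes of the `y_i`, hence the value of `β`.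
  obtain ⟨L, hL⟩ := exists_comp_eq (crossSumClass (k := k) (G := G) (H := H) N) β
    (crossSumClass_surjective (k := k) (G := G) (H := H) N) hker
  refine ⟨L, ?_⟩
  rintro d e rfl x y
  revert x
  obtain ⟨w, rfl⟩ := repClass_surjective e y
  suffices h : ((crossCoh k G H d e).compr₂ L).flip (repClass e w) =
      (B d e).flip (repClass e w) from fun x => LinearMap.congr_fun h x
  refine (Module.finBasis k (coh k G d)).ext fun a => ?_
  -- The family whose only non-zero member is the cocycle `w` at the index `a`.
  let s : CocycFamilies k G H (d + e) := ⟨Pi.single ⟨(d, e), rfl⟩ (Pi.single a w.1), by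
    refine famδ_single _ _ _ fun a' => ?_
    by_cases ha : a' = a
    · subst ha
      rw [Pi.single_eq_same]
      exact w.2
    · rw [Pi.single_eq_of_ne ha, map_zero]⟩
  have hs : famClass ⟨(d, e), rfl⟩ a s = repClass e w := by
    refine congrArg (repClass e) (Subtype.ext ?_)
    change (Pi.single (M := fun p : {p : ℕ × ℕ // p.1 + p.2 = d + e} =>
      Fin (Module.finrank k (coh k G p.1.1)) → RepCochains (1 : Representation k H k) p.1.2)
      ⟨(d, e), rfl⟩ (Pi.single a w.1)) ⟨(d, e), rfl⟩ a = w.1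
    rw [Pi.single_eq_same, Pi.single_eq_same]
  have hs' : ∀ p a', (p = ⟨(d, e), rfl⟩ → ¬ HEq a' a) → famClass p a' s = 0 := by
    intro p a' hp
    refine (congrArg (repClass p.1.2) (Subtype.ext ?_)).trans (map_zero _)
    change (Pi.single (M := fun p : {p : ℕ × ℕ // p.1 + p.2 = d + e} =>
      Fin (Module.finrank k (coh k G p.1.1)) → RepCochains (1 : Representation k H k) p.1.2)
      ⟨(d, e), rfl⟩ (Pi.single a w.1)) p a' = 0
    by_cases h : p = ⟨(d, e), rfl⟩
    · subst h
      rw [Pi.single_eq_same, Pi.single_eq_of_ne (fun h => hp rfl (heq_of_eq h))]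
    · rw [Pi.single_eq_of_ne h]
      rfl
  have hsum : ∀ {Q : Type} [AddCommGroup Q] (Φ : ∀ p : {p : ℕ × ℕ // p.1 + p.2 = d + e},
      Fin (Module.finrank k (coh k G p.1.1)) → Q), (∀ p a', famClass p a' s = 0 → Φ p a' = 0) →
      ∑ p ∈ (Finset.HasAntidiagonal.antidiagonal (d + e)).attach, ∑ a',
        Φ ⟨p.1, Finset.HasAntidiagonal.mem_antidiagonal.1 p.2⟩ a' = Φ ⟨(d, e), rfl⟩ a := by
    intro Q _ Φ hΦ
    rw [Finset.sum_eq_single ⟨(d, e), Finset.HasAntidiagonal.mem_antidiagonal.2 rfl⟩]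
    · refine Finset.sum_eq_single a (fun a' _ h => hΦ _ _ (hs' _ _ fun _ h' => ?_)) fun h =>
        absurd (Finset.mem_univ a) h
      exact h (eq_of_heq h')
    · refine fun p _ h => Finset.sum_eq_zero fun a' _ => hΦ _ _ (hs' _ _ fun h' => ?_)
      exact (h (Subtype.ext (Subtype.mk.inj h'))).elim
    · exact fun h => absurd (Finset.mem_attach _ _) h
  have h1 : crossSumClass (d + e) s =
      crossCoh k G H d e (Module.finBasis k (coh k G d) a) (repClass e w) := by
    refine (crossSumClass_eq s).trans ((hsum (fun p a' => p.2 ▸ crossCoh k G H p.1.1 p.1.2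
      (Module.finBasis k (coh k G p.1.1) a') (famClass p a' s)) ?_).trans (by rw [hs]))
    have h0 : ∀ {i N : ℕ} (h : i = N), h ▸ (0 : coh k (G × H) i) = (0 : coh k (G × H) N) := by
      rintro i _ rfl
      rfl
    intro p a' hp
    rw [hp, map_zero]
    exact h0 p.2
  have h2 : β s = B d e (Module.finBasis k (coh k G d) a) (repClass e w) := by
    rw [hβ, hsum (fun p a' => B p.1.1 p.1.2 (Module.finBasis k (coh k G p.1.1) a')
      (famClass p a' s)), hs]
    rintro p a' h0
    rw [h0, map_zero]
  rw [LinearMap.flip_apply, LinearMap.compr₂_apply, LinearMap.flip_apply, ← h1, hL, h2]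

end Kunneth

end HomogCochain

namespace GroupSystem

variable {k : Type} [Field k] (X : GroupSystem)

theorem kunneth_of_tmul_of (n m d e : ℕ) (x : coh k (X.G n) d) (y : coh k (X.G m) e) :
    X.kunneth k (X.of k n d x ⊗ₜ X.of k m e y) =
      DirectSum.lof k ((ℕ × ℕ) × ℕ) (fun i => coh k (X.G i.1.1 × X.G i.1.2) i.2) ((n, m), d + e)
        (crossCoh k (X.G n) (X.G m) d e x y) := by
  rw [kunneth, TensorProduct.lift.tmul, bilinOfComponents_lof, LinearMap.compr₂_apply]

/-- The Künneth theorem for the groups of a system. -/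
theorem kunneth_bijective : Function.Bijective (X.kunneth k) := by
  constructor
  · -- A left inverse exists since `x ⊗ y` is a bilinear function of `x` and `y`.
    choose L hL using fun n m : ℕ => HomogCochain.exists_factor_crossCoh (k := k) (G := X.G n)
      (H := X.G m) (fun d e => (TensorProduct.mk k (X.A k) (X.A k)).compl₁₂ (X.of k n d)
        (X.of k m e))
    let L' : X.AA k →ₗ[k] TensorProduct k (X.A k) (X.A k) :=
      DirectSum.toModule k _ _ fun i => L i.1.1 i.1.2 i.2
    have h : L' ∘ₗ X.kunneth k = LinearMap.id := by
      refine TensorProduct.ext (bilinear_ext_lof fun i j v w => ?_)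
      refine (congrArg L' (X.kunneth_of_tmul_of i.1 j.1 i.2 j.2 v w)).trans ?_
      rw [DirectSum.toModule_lof]
      exact hL i.1 j.1 _ i.2 j.2 rfl v w
    exact Function.LeftInverse.injective (g := L') fun t => LinearMap.congr_fun h t
  · rw [← LinearMap.range_eq_top, eq_top_iff]
    rintro z -
    induction z using DirectSum.induction_on with
    | zero => exact zero_mem _
    | add z z' h h' => exact add_mem h h'
    | of i z =>
      refine HomogCochain.mem_of_crossCoh_mem ((LinearMap.range (X.kunneth k)).comap
        (DirectSum.lof k _ (fun i : (ℕ × ℕ) × ℕ => coh k (X.G i.1.1 × X.G i.1.2) i.2) i))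
        (fun d e h x y => ?_) z
      obtain ⟨⟨n, m⟩, N⟩ := i
      dsimp only at h x y
      subst h
      exact ⟨_, X.kunneth_of_tmul_of n m d e x y⟩

end GroupSystem

/-! ### Morphisms of systems of groups -/

namespace GroupSystem

variable {k : Type} [Field k] {X Y : GroupSystem} (π : ∀ n, Y.G n →* X.G n)

/-- The map `⨁ H^d(X n; k) → ⨁ H^d(Y n; k)` induced by homomorphisms `Y n → X n`. -/
noncomputable def pullback (k : Type) [Field k] : X.A k →ₗ[k] Y.A k :=
  DirectSum.lmap fun i => cohPullback k (π i.1) i.2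

/-- The map `⨁ H^d(X n × X m; k) → ⨁ H^d(Y n × Y m; k)` induced by homomorphisms `Y n → X n`. -/
noncomputable def pullbackPairs (k : Type) [Field k] : X.AA k →ₗ[k] Y.AA k :=
  DirectSum.lmap fun i => cohPullback k ((π i.1.1).prodMap (π i.1.2)) i.2

theorem pullback_of (n d : ℕ) (x : coh k (X.G n) d) :
    pullback π k (X.of k n d x) = Y.of k n d (cohPullback k (π n) d x) :=
  DirectSum.lmap_lof _ _ _

theorem pullbackPairs_lof (q : ℕ × ℕ) (d : ℕ) (z : coh k (X.G q.1 × X.G q.2) d) :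
    pullbackPairs π k (DirectSum.lof k ((ℕ × ℕ) × ℕ) (fun i => coh k (X.G i.1.1 × X.G i.1.2) i.2)
      (q, d) z) = DirectSum.lof k ((ℕ × ℕ) × ℕ) (fun i => coh k (Y.G i.1.1 × Y.G i.1.2) i.2)
        (q, d) (cohPullback k ((π q.1).prodMap (π q.2)) d z) :=
  DirectSum.lmap_lof _ _ _

theorem pullback_cup (x y : X.A k) :
    pullback π k (X.cup k x y) = Y.cup k (pullback π k x) (pullback π k y) := by
  suffices h : (X.cup k).compr₂ (pullback π k) =
      (Y.cup k).compl₁₂ (pullback π k) (pullback π k) from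
    congrArg (fun B => B x y) h
  refine bilinear_ext_lof fun i j v w => ?_
  rw [LinearMap.compr₂_apply, LinearMap.compl₁₂_apply]
  obtain ⟨n, d⟩ := i
  obtain ⟨m, e⟩ := j
  rw [pullback_of, pullback_of, cup, cup, bilinOfComponents_lof, bilinOfComponents_lof]
  by_cases h : n = m
  · subst h
    simp only [dite_true, LinearMap.compr₂_apply, LinearMap.compl₂_apply]
    rw [pullback_of, cohPullback_cup]
    simp only [cohPullback_comp]
    rfl
  · simp only [h, dite_false, LinearMap.zero_apply, map_zero]

theorem pullback_kunneth (t : TensorProduct k (X.A k) (X.A k)) :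
    Y.kunneth k (TensorProduct.map (pullback π k) (pullback π k) t) =
      pullbackPairs π k (X.kunneth k t) := by
  induction t using TensorProduct.induction_on with
  | zero => simp only [map_zero]
  | add x y hx hy => simp only [map_add, hx, hy]
  | tmul x y =>
    rw [TensorProduct.map_tmul, kunneth, kunneth, TensorProduct.lift.tmul, TensorProduct.lift.tmul]
    let B := bilinOfComponents k fun i j : ℕ × ℕ =>
      (crossCoh k (X.G i.1) (X.G j.1) i.2 j.2).compr₂
        (DirectSum.lof k ((ℕ × ℕ) × ℕ) (fun i => coh k (X.G i.1.1 × X.G i.1.2) i.2)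
          ((i.1, j.1), i.2 + j.2))
    let B' := bilinOfComponents k fun i j : ℕ × ℕ =>
      (crossCoh k (Y.G i.1) (Y.G j.1) i.2 j.2).compr₂
        (DirectSum.lof k ((ℕ × ℕ) × ℕ) (fun i => coh k (Y.G i.1.1 × Y.G i.1.2) i.2)
          ((i.1, j.1), i.2 + j.2))
    suffices h : B'.compl₁₂ (pullback π k) (pullback π k) = B.compr₂ (pullbackPairs π k) from
      congrArg (fun B => B x y) h
    refine bilinear_ext_lof fun i j v w => ?_
    rw [LinearMap.compr₂_apply, LinearMap.compl₁₂_apply]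
    obtain ⟨n, d⟩ := i
    obtain ⟨m, e⟩ := j
    rw [pullback_of, pullback_of, bilinOfComponents_lof, bilinOfComponents_lof,
      LinearMap.compr₂_apply, LinearMap.compr₂_apply, ← cohPullback_cross]
    exact (pullbackPairs_lof π _ _ _).symm

theorem pullback_unit (c : k) : pullback π k (X.unit k c) = Y.unit k c := by
  rw [unit, unit, LinearMap.comp_apply, LinearMap.comp_apply, pullback_of]
  congr 1
  rw [LinearEquiv.coe_coe, LinearEquiv.coe_coe, LinearEquiv.eq_symm_apply,
    cohZeroEquiv_cohPullback, LinearEquiv.apply_symm_apply]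

theorem counit_pullback (x : X.A k) : Y.counit k (pullback π k x) = X.counit k x :=
  cohZeroEquiv_cohPullback (π 0) (DirectSum.component k _ _ (0, 0) x)

theorem pullback_antipode (x : X.A k) :
    pullback π k (X.antipode k x) = Y.antipode k (pullback π k x) := by
  suffices h : pullback π k ∘ₗ X.antipode k = Y.antipode k ∘ₗ pullback π k from
    congrArg (fun B => B x) h
  refine DirectSum.linearMap_ext k fun i => LinearMap.ext fun v => ?_
  obtain ⟨n, d⟩ := i
  simp only [LinearMap.comp_apply, antipode]
  rw [pullback_of, DirectSum.lmap_lof, DirectSum.lmap_lof, pullback_of, LinearMap.smul_apply,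
    map_smul]
  rfl

variable (hcomm : ∀ n m x, π (n + m) (Y.incl n m x) = X.incl n m (π n x.1, π m x.2))
include hcomm

theorem inclOf_comm {n m N : ℕ} (h : n + m = N) :
    (π N).comp (Y.inclOf h) = (X.inclOf h).comp ((π n).prodMap (π m)) := by
  subst h
  exact MonoidHom.ext (hcomm n m)

theorem pullback_restriction (x : X.A k) :
    Y.restriction k (pullback π k x) = pullbackPairs π k (X.restriction k x) := by
  suffices h : Y.restriction k ∘ₗ pullback π k = pullbackPairs π k ∘ₗ X.restriction k from
    congrArg (fun B => B x) h
  refine DirectSum.linearMap_ext k fun i => LinearMap.ext fun v => ?_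
  obtain ⟨n, d⟩ := i
  simp only [LinearMap.comp_apply]
  rw [pullback_of, restriction, restriction, DirectSum.toModule_lof, DirectSum.toModule_lof,
    LinearMap.sum_apply, LinearMap.sum_apply, map_sum]
  refine Finset.sum_congr rfl fun q _ => ?_
  rw [LinearMap.comp_apply, LinearMap.comp_apply, cohPullback_comp, inclOf_comm π hcomm,
    ← cohPullback_comp]
  exact (pullbackPairs_lof π _ _ _).symm

theorem pullback_coproduct (x : X.A k) :
    TensorProduct.map (pullback π k) (pullback π k) (X.coproduct k x) =
      Y.coproduct k (pullback π k x) := by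
  have hX := X.kunneth_bijective (k := k)
  have hY := Y.kunneth_bijective (k := k)
  rw [coproduct, coproduct, dif_pos hX, dif_pos hY]
  apply hY.1
  rw [pullback_kunneth]
  simp only [LinearMap.comp_apply, LinearEquiv.coe_coe, pullback_restriction π hcomm]
  have h1 := (LinearEquiv.ofBijective (X.kunneth k) hX).apply_symm_apply (X.restriction k x)
  have h2 := (LinearEquiv.ofBijective (Y.kunneth k) hY).apply_symm_apply
    (pullbackPairs π k (X.restriction k x))
  rw [LinearEquiv.ofBijective_apply] at h1 h2
  rw [h1, h2]

variable (hsurj : ∀ n, Function.Surjective (π n))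
include hsurj

theorem pullback_transferProd
    (hsheets : ∀ n m, (Y.sheets n m : k)⁻¹ *
      ((Y.incl n m).range.relIndex ((X.incl n m).range.comap (π (n + m))) : k) =
        (X.sheets n m : k)⁻¹) (x y : X.A k) :
    pullback π k (X.transferProd k x y) = Y.transferProd k (pullback π k x) (pullback π k y) := by
  suffices h : (X.transferProd k).compr₂ (pullback π k) =
      (Y.transferProd k).compl₁₂ (pullback π k) (pullback π k) from
    congrArg (fun B => B x y) h
  refine bilinear_ext_lof fun i j v w => ?_
  rw [LinearMap.compr₂_apply, LinearMap.compl₁₂_apply]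
  obtain ⟨n, d⟩ := i
  obtain ⟨m, e⟩ := j
  rw [pullback_of, pullback_of, transferProd, transferProd, bilinOfComponents_lof,
    bilinOfComponents_lof, LinearMap.compr₂_apply, LinearMap.compr₂_apply, LinearMap.comp_apply,
    LinearMap.comp_apply, pullback_of, ← cohPullback_cross]
  simp only [LinearMap.smul_apply, map_smul]
  rw [HomogCochain.transferHom_cohPullback (hsurj (n + m)) (Y.incl_injective n m)
    (X.incl_injective n m) ((π n).prodMap (π m)) (hcomm n m), map_smul, smul_smul, hsheets]

variable (hker : ∀ n, (Nat.card (π n).ker : k) ≠ 0)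
include hker

omit hcomm in
theorem pullback_bijective : Function.Bijective (pullback π k) :=
  ⟨(DirectSum.lmap_injective _).2 fun i =>
      (HomogCochain.cohPullback_bijective (hsurj i.1) (hker i.1).isUnit i.2).1,
    (DirectSum.lmap_surjective _).2 fun i =>
      (HomogCochain.cohPullback_bijective (hsurj i.1) (hker i.1).isUnit i.2).2⟩

/-- Compatible surjections of groups whose kernels have invertible orders induce an isomorphism of
Hopf rings, if the normalisations of the transfers agree. -/
theorem isHopfRingIso_pullback (hsheets : ∀ n m, (Y.sheets n m : k)⁻¹ *
      ((Y.incl n m).range.relIndex ((X.incl n m).range.comap (π (n + m))) : k) =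
        (X.sheets n m : k)⁻¹) :
    IsHopfRingIso k X Y (pullback π k) where
  bijective := pullback_bijective π hsurj hker
  bigraded n d x := ⟨_, pullback_of π n d x⟩
  map_cup := pullback_cup π
  map_transferProd := pullback_transferProd π hcomm hsurj hsheets
  map_coproduct := pullback_coproduct π hcomm
  map_unit := pullback_unit π
  map_counit := counit_pullback π
  map_antipode := pullback_antipode π

end GroupSystem

/-! ### The projection from signed permutations to permutations -/

section Index

variable {G Q H T : Type} [Group G] [Group Q] [Group H] [Group T]

/-- The index of the image of `j` in the preimage of the image of `i` divides the order of the
kernel of `f`, if `f` maps the image of `j` onto that of `i`. -/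
theorem relIndex_dvd_card_ker [Finite G] (f : G →* Q) (j : H →* G) (i : T →* Q) (e : H →* T)
    (he : Function.Surjective e) (hcomm : ∀ h, f (j h) = i (e h)) :
    j.range.relIndex (i.range.comap f) ∣ Nat.card f.ker := by
  have h1 : i.range = j.range.map f := by
    ext q
    constructor
    · rintro ⟨t, rfl⟩
      obtain ⟨h, rfl⟩ := he t
      exact ⟨j h, ⟨h, rfl⟩, hcomm h⟩
    · rintro ⟨_, ⟨h, rfl⟩, rfl⟩
      exact ⟨e h, (hcomm h).symm⟩
  have h2 : j.range ≤ i.range.comap f := h1 ▸ Subgroup.le_comap_map f j.range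
  have h3 : f.ker ≤ i.range.comap f := MonoidHom.comap_bot f ▸ Subgroup.comap_mono bot_le
  -- Both `[P : 1] = [j(H) : 1] [P : j(H)]` and `[P : 1] = |ker f| [P : ker f]`, where `[P : ker f]`
  -- divides the order of `j(H)`.
  have e1 := Subgroup.relIndex_mul_relIndex ⊥ j.range (i.range.comap f) bot_le h2
  have e2 := Subgroup.relIndex_mul_relIndex ⊥ f.ker (i.range.comap f) bot_le h3
  have e3 : f.ker.relIndex (i.range.comap f) = f.ker.relIndex j.range := by
    rw [h1, Subgroup.comap_map_eq, Subgroup.relIndex_sup_right]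
  obtain ⟨c, hc⟩ := Subgroup.relIndex_dvd_card f.ker j.range
  rw [Subgroup.relIndex_bot_left] at e1 e2
  rw [e3] at e2
  have hpos : 0 < f.ker.relIndex j.range :=
    Nat.pos_of_ne_zero fun h => by
      rw [h, zero_mul] at hc
      exact Nat.card_pos.ne' hc
  refine ⟨c, Nat.eq_of_mul_eq_mul_right hpos ?_⟩
  rw [e2, ← e1, hc]
  ring

end Index

section SignedPermutations

open Equiv

theorem altProj_surjective (n : ℕ) : Function.Surjective (altProj n) := by
  intro σ
  rcases n with _ | n
  · exact ⟨1, Subsingleton.elim _ _⟩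
  · let x : Hyperoctahedral (n + 1) := ⟨Function.update 1 0 (Perm.sign σ), σ⟩
    have hx : x ∈ AltHyper (n + 1) := by
      change (∏ i, (Function.update (1 : Fin (n + 1) → ℤˣ) 0 (Perm.sign σ)) i) * Perm.sign σ = 1
      rw [Finset.prod_update_of_mem (Finset.mem_univ _)]
      simp
    exact ⟨⟨x, hx⟩, rfl⟩

/-- The kernel of `B_n^+ → Σ_n` consists of sign vectors, so that it is a `2`-group. -/
theorem card_ker_altProj_dvd (n : ℕ) : Nat.card (altProj n).ker ∣ 2 ^ n := by
  have h1 : (altProj n).ker.map (AltHyper n).subtype ≤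
      (SemidirectProduct.inl : (Fin n → ℤˣ) →* Hyperoctahedral n).range := by
    rw [SemidirectProduct.range_inl_eq_ker_rightHom]
    rintro _ ⟨x, hx, rfl⟩
    exact hx
  have h2 := Subgroup.card_dvd_of_le h1
  rw [Nat.card_congr (MonoidHom.ofInjective SemidirectProduct.inl_injective).toEquiv.symm] at h2
  rw [Nat.card_congr ((altProj n).ker.equivMapOfInjective _
    (AltHyper n).subtype_injective).toEquiv]
  simpa using h2

theorem altProj_altIncl (n m : ℕ) (x : AltHyper n × AltHyper m) :
    altProj (n + m) (altIncl n m x) = permIncl n m (altProj n x.1, altProj m x.2) := rfl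

theorem natCast_ne_zero_of_dvd_two_pow {p : ℕ} [Fact p.Prime] (hp : 2 < p) {c n : ℕ}
    (h : c ∣ 2 ^ n) : (c : ZMod p) ≠ 0 := by
  rw [Ne, ZMod.natCast_eq_zero_iff]
  intro hc
  have := Nat.le_of_dvd two_pos ((Fact.out : p.Prime).dvd_of_dvd_pow (hc.trans h))
  omega

theorem card_ker_altProj_ne_zero {p : ℕ} [Fact p.Prime] (hp : 2 < p) (n : ℕ) :
    (Nat.card (altProj n).ker : ZMod p) ≠ 0 :=
  natCast_ne_zero_of_dvd_two_pow hp (card_ker_altProj_dvd n)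

theorem sheets_altHyperSystem_ne_zero {p : ℕ} [Fact p.Prime] (hp : 2 < p) (n m : ℕ) :
    (altHyperSystem.sheets n m : ZMod p) ≠ 0 :=
  natCast_ne_zero_of_dvd_two_pow hp <|
    (relIndex_dvd_card_ker (altProj (n + m)) (altIncl n m) (permIncl n m)
      ((altProj n).prodMap (altProj m)) ((altProj_surjective n).prodMap (altProj_surjective m))
      (altProj_altIncl n m)).trans (card_ker_altProj_dvd (n + m))

end SignedPermutations

theorem mainTheorem9 (p : ℕ) [Fact p.Prime] (hp : 2 < p) :
    (∀ n d : ℕ, Function.Bijective (cohPullback (ZMod p) (altProj n) d)) ∧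
      GroupSystem.IsHopfRingIso (ZMod p) symmetricSystem altHyperSystem (projPullback (ZMod p)) := by
  refine ⟨fun n d => HomogCochain.cohPullback_bijective (altProj_surjective n)
    (card_ker_altProj_ne_zero hp n).isUnit d, ?_⟩
  refine GroupSystem.isHopfRingIso_pullback (X := symmetricSystem) (Y := altHyperSystem) altProj
    altProj_altIncl altProj_surjective (card_ker_altProj_ne_zero hp)
    fun n m => ?_
  have h : (symmetricSystem.sheets n m : ZMod p)⁻¹ = 1 := by
    change ((1 : ℕ) : ZMod p)⁻¹ = 1
    rw [Nat.cast_one, inv_one]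
  rw [h]
  exact inv_mul_cancel₀ (sheets_altHyperSystem_ne_zero hp n m)
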